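/- **Setting.** Let $m\ge 1$, $0<T<\infty$, $\nu_1\ge\nu_2\ge\dots\ge\nu_m>0$, $\nu_q\notin\mathbb N$, $\omega_q=\nu_q^2-\tfrac14$, $\mu_{1q}=\tfrac12-\nu_q$, $\mu_{2q}=\tfrac12+\nu_q$, $\beta=\min\{1,2\nu_1\}$, and let $Q$ be a complex $m\times m$ matrix function on $(0,T)$ such that $x^{1-2\nu_1}Q(x)$ is integrable on $(0,T)$. The equation studied is $-Y''+\bigl(\tfrac{1}{x^2}\operatorname{diag}\{\omega_q\}+Q(x)\bigr)Y=\lambda Y$, $\lambda=\rho^2$, $\operatorname{Re}\rho\ge0$. All powers are principal branches. *Unperturbed solutions.* Fix constants with $c_{10q}c_{20q}=(2\nu_q)^{-1}$ and put, for $z\in\mathbb C\setminus(-\infty,0]$, $$c_{jq}(z)=z^{\mu_{jq}}\sum_{k\ge0}c_{jkq}z^{2k},\qquad c_{jkq}=(-1)^kc_{j0q}\Bigl(\prod_{s=1}^k\bigl((2s+\mu_{jq})(2s+\mu_{jq}-1)-\omega_q\bigr)\Bigr)^{-1},\qquad j=1,2.$$ Let $e_{1q}$ be the Jost solution, $e_{1q}(z)=e^{iz}-\int_z^\infty\sin(z-t)\,\omega_qt^{-2}e_{1q}(t)\,dt$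 for $\operatorname{Im}z>0$ (an absolutely convergent integral along the ray $\arg t=\arg z$), and $e_{2q}(z)=e_{1q}(-z)$ for $\operatorname{Im}z<0$. There are constants $\beta^0_{kjq}$ with $e_{kq}=\beta^0_{k1q}c_{1q}+\beta^0_{k2q}c_{2q}$, $k=1,2$, and this formula continues $e_{kq}$ to $\mathbb C\setminus(-\infty,0]$. Put $C_j(x,\lambda)=\operatorname{diag}\{\rho^{-\mu_{jq}}c_{jq}(\rho x)\}_q$ (entire in $\lambda$), $E_k(x,\rho)=\operatorname{diag}\{e_{kq}(\rho x)\}_q$, $B^0_{kj}=\operatorname{diag}\{\beta^0_{kjq}\}_q$, $D_j(\rho)=\operatorname{diag}\{\rho^{\mu_{jq}}\}_q$, and $G(x,t,\lambda)=C_2(x,\lambda)C_1(t,\lambda)-C_1(x,\lambda)C_2(t,\lambda)$. *Bessel-type solutions.* $S_j(\cdot,\lambda)$, $j=1,2$, $\lambda\in\mathbb C$, is the solution on $(0,T]$ of $$S_j(x,\lambda)=C_j(x,\lambda)+\int_0^xG(x,t,\lambda)Q(t)S_j(t,\lambda)\,dt$$ among continuous matrix functions whose $q$-th column is $O(x^{\mu_{jq}})$.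 *Birkhoff-type solutions.* For $0\le\arg\rho\le\pi/2$, $Y_1(\cdot,\rho),Y_2(\cdot,\rho)$ are the solutions on $(0,T]$ of $$Y_1(x)=E_1(x)+\frac1{2i\rho}\int_0^xE_1(x)E_2(t)Q(t)Y_1(t)\,dt+\frac1{2i\rho}\int_x^TE_2(x)E_1(t)Q(t)Y_1(t)\,dt,$$ $$Y_2(x)=E_2(x)+\frac1{2i\rho}\int_0^x\bigl(E_1(x)E_2(t)-E_2(x)E_1(t)\bigr)Q(t)Y_2(t)\,dt$$ among continuous matrix functions that are $O(x^{\mu_{11}})$ (the argument $\rho$ is omitted). For $-\pi/2\le\arg\rho\le0$ the same equations are used with the indices $1$ and $2$ interchanged and $i$ replaced by $-i$. **Theorem.** The constants $\beta^0_{kjq}$ exist, and the solutions $S_j(\cdot,\lambda)$ exist for every $\lambda\in\mathbb C$. There are constants $\rho^*>0$ and $C$ such that for every $\rho$ with $\operatorname{Re}\rho\ge0$ and $|\rho|\ge\rho^*$ (and for either choice of the quadrant if $\rho>0$), the solutions $Y_1,Y_2$ exist; there are matrices $B_{kj}(\rho)$, the Stokes multipliers, with $$Y_k(x,\rho)=S_1(x,\rho^2)B_{k1}(\rho)+S_2(x,\rho^2)B_{k2}(\rho),\qquad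 x\in(0,T],\ k=1,2;$$ and any such matrices satisfy $$B_{kj}(\rho)=D_j(\rho)B^0_{kj}\bigl(I+P_{kj}(\rho)\bigr),\qquad \max_{p,q}\bigl|(P_{kj}(\rho))_{pq}\bigr|\le C|\rho|^{-\beta},\qquad k,j=1,2.$$ That is, $B_{kj}(\rho)=D_j(\rho)B^0_{kj}(I+O(\rho^{-\beta}))$ as $|\rho|\to\infty$, $\operatorname{Re}\rho\ge0$. -/

import Mathlib

noncomputable section

namespace StokesSL

open MeasureTheory

/-! The indices `j, k ∈ {1, 2}` are elements of `Fin 2` (`0` stands for `1`, and `1` for `2`). -/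

/-- The exponents `μ₁ = 1/2 - ν`, `μ₂ = 1/2 + ν`. -/
def mu (j : Fin 2) (ν : ℝ) : ℝ := if j = 0 then 1 / 2 - ν else 1 / 2 + ν

/-- `ω = ν² - 1/4`. -/
def omega (ν : ℝ) : ℝ := ν ^ 2 - 1 / 4

/-- The coefficients `c_{jk}` of the Bessel solutions, with `c_{j0} = c₀`. -/
def besselCoeff (ν : ℝ) (j : Fin 2) (c₀ : ℂ) (k : ℕ) : ℂ :=
  (-1) ^ k * c₀ *
    (((∏ s ∈ Finset.Icc 1 k,
      ((2 * (s : ℝ) + mu j ν) * (2 * (s : ℝ) + mu j ν - 1) - omega ν) : ℝ) : ℂ))⁻¹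

/-- `c_j(z) = z^{μ_j} ∑ c_{jk} z^{2k}`, with the principal branch of the power
(the plane is cut along `z ≤ 0`). It solves `-y'' + ω z⁻² y = y`. -/
def besselC (ν : ℝ) (j : Fin 2) (c₀ : ℂ) (z : ℂ) : ℂ :=
  z ^ ((mu j ν : ℝ) : ℂ) * ∑' k : ℕ, besselCoeff ν j c₀ k * z ^ (2 * k)

/-- `c_j(x, lam) = x^{μ_j} ∑ c_{jk} (lam x²)^k`, that is, `ρ^{-μ_j} c_j(ρ x)` for `lam = ρ²`
(see `besselCLam_sq`). It solves `-y'' + ω x⁻² y = lam y`. -/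
def besselCLam (ν : ℝ) (j : Fin 2) (c₀ : ℂ) (x : ℝ) (lam : ℂ) : ℂ :=
  ((x ^ mu j ν : ℝ) : ℂ) * ∑' k : ℕ, besselCoeff ν j c₀ k * (lam * (x : ℂ) ^ 2) ^ k

theorem besselCLam_sq (ν : ℝ) (j : Fin 2) (c₀ : ℂ) (x : ℝ) (hx : 0 < x) (ρ : ℂ) (hρ : ρ ≠ 0) :
    besselCLam ν j c₀ x (ρ ^ 2) =
      ρ ^ (-((mu j ν : ℝ) : ℂ)) * besselC ν j c₀ (ρ * (x : ℂ)) := by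
  have hx' : (x : ℂ) ≠ 0 := by exact_mod_cast hx.ne'
  have hpow : (ρ * (x : ℂ)) ^ ((mu j ν : ℝ) : ℂ)
      = ((x ^ mu j ν : ℝ) : ℂ) * ρ ^ ((mu j ν : ℝ) : ℂ) := by
    rw [Complex.ofReal_cpow hx.le, Complex.cpow_def_of_ne_zero (mul_ne_zero hρ hx'),
      Complex.cpow_def_of_ne_zero hx', Complex.cpow_def_of_ne_zero hρ,
      Complex.log_mul_ofReal x hx ρ hρ, ← Complex.ofReal_log hx.le, ← Complex.exp_add]
    ring_nf
  have h1 : ρ ^ (-((mu j ν : ℝ) : ℂ)) * ρ ^ ((mu j ν : ℝ) : ℂ) = 1 := by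
    rw [← Complex.cpow_add _ _ hρ]; simp
  have h2 : ∀ k : ℕ, (ρ ^ 2 * (x : ℂ) ^ 2) ^ k = (ρ * (x : ℂ)) ^ (2 * k) := by
    intro k
    rw [pow_mul, ← mul_pow]
  unfold besselCLam besselC
  rw [hpow]
  simp only [h2]
  linear_combination (-((x ^ mu j ν : ℝ) : ℂ) *
    ∑' k : ℕ, besselCoeff ν j c₀ k * (ρ * (x : ℂ)) ^ (2 * k)) * h1

/-- `e_k(z) = β_{k1} c_1(z) + β_{k2} c_2(z)` on the plane cut along `z ≤ 0`. -/
def jostE (ν : ℝ) (c₀ : Fin 2 → ℂ) (b : Fin 2 → Fin 2 → ℂ) (k : Fin 2) (z : ℂ) : ℂ :=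
  ∑ j : Fin 2, b k j * besselC ν j (c₀ j) z

/-- The integrand of the Jost integral equation at `z`, along the ray `t = r z`, `r > 1`
(so that `dt = z dr`). -/
def jostIntegrand (ν : ℝ) (c₀ : Fin 2 → ℂ) (b : Fin 2 → Fin 2 → ℂ) (z : ℂ) (r : ℝ) : ℂ :=
  Complex.sin (z - (r : ℂ) * z) * ((omega ν : ℝ) : ℂ) / ((r : ℂ) * z) ^ 2 *
    jostE ν c₀ b 0 ((r : ℂ) * z) * z

/-- `b k j` are the constants `β⁰_{kj}` connecting the Jost solutions with the Bessel solutions: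
`e_1 = β_{11} c_1 + β_{12} c_2` solves
`e_1(z) = exp(i z) - ∫_z^∞ sin(z - t) ω t⁻² e_1(t) dt` for `Im z > 0`, the integral being taken
along the ray `arg t = arg z`, and `e_2 = β_{21} c_1 + β_{22} c_2` is `e_1(-z)` for `Im z < 0`. -/
structure IsJostConnection (ν : ℝ) (c₀ : Fin 2 → ℂ) (b : Fin 2 → Fin 2 → ℂ) : Prop where
  integrable : ∀ z : ℂ, 0 < z.im → IntegrableOn (jostIntegrand ν c₀ b z) (Set.Ioi 1)
  eq : ∀ z : ℂ, 0 < z.im →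
    jostE ν c₀ b 0 z = Complex.exp (Complex.I * z) - ∫ r in Set.Ioi (1 : ℝ), jostIntegrand ν c₀ b z r
  refl : ∀ z : ℂ, z.im < 0 → jostE ν c₀ b 1 z = jostE ν c₀ b 0 (-z)

/-- The entrywise integral of a matrix function. -/
def matInt {m : ℕ} (a b : ℝ) (F : ℝ → Matrix (Fin m) (Fin m) ℂ) : Matrix (Fin m) (Fin m) ℂ :=
  Matrix.of fun p q => ∫ t in a..b, F t p q

/-- `C_j(x, lam) = diag {c_{jq}(x, lam)}`. -/
def CMat {m : ℕ} (ν : Fin m → ℝ) (c₀ : Fin 2 → Fin m → ℂ) (j : Fin 2) (x : ℝ) (lam : ℂ) :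
    Matrix (Fin m) (Fin m) ℂ :=
  Matrix.diagonal fun q => besselCLam (ν q) j (c₀ j q) x lam

/-- `E_k(x, ρ) = diag {e_{kq}(ρ x)}`. -/
def EMat {m : ℕ} (ν : Fin m → ℝ) (c₀ : Fin 2 → Fin m → ℂ) (b : Fin 2 → Fin 2 → Fin m → ℂ)
    (k : Fin 2) (x : ℝ) (ρ : ℂ) : Matrix (Fin m) (Fin m) ℂ :=
  Matrix.diagonal fun q =>
    jostE (ν q) (fun j => c₀ j q) (fun k j => b k j q) k (ρ * (x : ℂ))

/-- `G(x, t, lam) = C_2(x, lam) C_1(t, lam) - C_1(x, lam) C_2(t, lam)`. -/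
def GMat {m : ℕ} (ν : Fin m → ℝ) (c₀ : Fin 2 → Fin m → ℂ) (x t : ℝ) (lam : ℂ) :
    Matrix (Fin m) (Fin m) ℂ :=
  CMat ν c₀ 1 x lam * CMat ν c₀ 0 t lam - CMat ν c₀ 0 x lam * CMat ν c₀ 1 t lam

/-- `S = S_j(·, lam)` is the Bessel-type solution on `(0, T]`: the solution of the Volterra
equation `S = C_j + ∫_0^x G Q S dt` in the class of continuous functions whose `q`-th column is
`O(x^{μ_{jq}})`; in this class the integral converges absolutely. -/
structure IsBesselType {m : ℕ} (T : ℝ) (ν : Fin m → ℝ) (Q : ℝ → Matrix (Fin m) (Fin m) ℂ)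
    (c₀ : Fin 2 → Fin m → ℂ) (j : Fin 2) (lam : ℂ) (S : ℝ → Matrix (Fin m) (Fin m) ℂ) : Prop where
  cont : ContinuousOn S (Set.Ioc 0 T)
  bound : ∃ M : ℝ, ∀ x ∈ Set.Ioc 0 T, ∀ p q, ‖S x p q‖ ≤ M * x ^ mu j (ν q)
  eq : ∀ x ∈ Set.Ioc 0 T,
    S x = CMat ν c₀ j x lam + matInt 0 x fun t => GMat ν c₀ x t lam * Q t * S t

/-- The class of functions in which the integral equations of the Birkhoff-type solutions are
solved: continuous on `(0, T]` and `O(x^{μ_{11}})`, so that all integrals converge absolutely. -/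
def InBirkhoffClass {m : ℕ} [NeZero m] (T : ℝ) (ν : Fin m → ℝ)
    (Y : ℝ → Matrix (Fin m) (Fin m) ℂ) : Prop :=
  ContinuousOn Y (Set.Ioc 0 T) ∧
    ∃ M : ℝ, ∀ x ∈ Set.Ioc 0 T, ∀ p q, ‖Y x p q‖ ≤ M * x ^ mu 0 (ν 0)

/-- The closed quadrants of the half-plane `Re ρ ≥ 0`: `s = 0` is `0 ≤ arg ρ ≤ π/2`, where
`exp(iρx)` is bounded for `x > 0`, and `s = 1` is `-π/2 ≤ arg ρ ≤ 0`, where `exp(-iρx)` is. -/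
def InSector (s : Fin 2) (ρ : ℂ) : Prop :=
  0 ≤ ρ.re ∧ if s = 0 then 0 ≤ ρ.im else ρ.im ≤ 0

/-- `Y k = Y_k(·, ρ)`, `k = 1, 2`, are the Birkhoff-type solutions for `ρ` in the sector `s`.
In the upper quadrant (`s = 0`),
`Y_1 = E_1 + (2iρ)⁻¹ (∫_0^x E_1(x) E_2(t) Q Y_1 dt + ∫_x^T E_2(x) E_1(t) Q Y_1 dt)`,
`Y_2 = E_2 + (2iρ)⁻¹ ∫_0^x (E_1(x) E_2(t) - E_2(x) E_1(t)) Q Y_2 dt`;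
in the lower quadrant the roles of the indices `1` and `2` (and of `i` and `-i`) are exchanged.
In the code `1 - s` is the index different from `s`. -/
structure IsBirkhoffType {m : ℕ} [NeZero m] (T : ℝ) (ν : Fin m → ℝ)
    (Q : ℝ → Matrix (Fin m) (Fin m) ℂ) (c₀ : Fin 2 → Fin m → ℂ) (b : Fin 2 → Fin 2 → Fin m → ℂ)
    (s : Fin 2) (ρ : ℂ) (Y : Fin 2 → ℝ → Matrix (Fin m) (Fin m) ℂ) : Prop where
  mem : ∀ k, InBirkhoffClass T ν (Y k)
  eq_bounded : ∀ x ∈ Set.Ioc 0 T,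
    Y s x = EMat ν c₀ b s x ρ +
      ((-1) ^ (s : ℕ) / (2 * Complex.I * ρ)) •
        (matInt 0 x (fun t => EMat ν c₀ b s x ρ * EMat ν c₀ b (1 - s) t ρ * Q t * Y s t) +
         matInt x T (fun t => EMat ν c₀ b (1 - s) x ρ * EMat ν c₀ b s t ρ * Q t * Y s t))
  eq_growing : ∀ x ∈ Set.Ioc 0 T,
    Y (1 - s) x = EMat ν c₀ b (1 - s) x ρ +
      (1 / (2 * Complex.I * ρ)) •
        matInt 0 x (fun t =>
          (EMat ν c₀ b 0 x ρ * EMat ν c₀ b 1 t ρ - EMat ν c₀ b 1 x ρ * EMat ν c₀ b 0 t ρ) *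
            Q t * Y (1 - s) t)

/-- `B k j = B_{kj}(ρ)` are the Stokes multipliers: `Y_k = S_1 B_{k1} + S_2 B_{k2}`. -/
def IsStokesMultiplier {m : ℕ} (T : ℝ) (S Y : Fin 2 → ℝ → Matrix (Fin m) (Fin m) ℂ)
    (B : Fin 2 → Fin 2 → Matrix (Fin m) (Fin m) ℂ) : Prop :=
  ∀ k, ∀ x ∈ Set.Ioc 0 T, Y k x = S 0 x * B k 0 + S 1 x * B k 1

/-- `D_j(ρ) = diag {ρ^{μ_{jq}}}` (principal branch). -/
def DMat {m : ℕ} (ν : Fin m → ℝ) (j : Fin 2) (ρ : ℂ) : Matrix (Fin m) (Fin m) ℂ :=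
  Matrix.diagonal fun q => ρ ^ ((mu j (ν q) : ℝ) : ℂ)

end StokesSL

end

open StokesSL MeasureTheory

/-! Everything reduces to one identity between integral kernels and to one finite-dimensional linear
equation for a constant matrix.

The Wronskian of c_1, c_2 is 1, so the Wronskian of e_1, e_2 is det β⁰; letting the argument tend to
infinity along the positive axis shows that it is -2i (`IsJostConnection.det_eq`). Since ρ^{μ_1}
ρ^{μ_2} = ρ, this turns the Bessel kernel G(x,t,ρ²) into (2iρ)⁻¹ (E_1(x)E_2(t) - E_2(x)E_1(t))
(`Setting.gFun_eq`). Put U_k = S_1 D_1 B⁰_{k1} + S_2 D_2 B⁰_{k2} (`besselComb`). Right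
multiplication by constant matrices commutes with the Volterra operator, so U_k = E_k + ∫_0^x G Q
U_k. For the growing index 1-s this is exactly the Birkhoff equation, hence Y_{1-s} = U_{1-s} and
its multipliers have P = 0.

For the recessive index s, writing ∫_x^T = ∫_0^T - ∫_0^x shows that the operator is the same
Volterra operator plus E_{1-s}(x) times a constant matrix A = κ ∫_0^T E_s Q Y_s, where κ = ±(2iρ)⁻¹
(`Setting.bounded_operator_eq`). Therefore Y_s = U_s + U_{1-s} A, and inserting this into the
definition of A gives A = N_s + N_{1-s} A with N_k = κ ∫_0^T E_s Q U_k. If the N_k are small, this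
has a solution, and A is as small as they are. Rewriting U_{1-s} A with the coefficients of U_s
gives P_{sj} = diag(β⁰_{1-s,j} / β⁰_{s,j}) A; no β⁰_{kj} vanishes, because β⁰_{2j} is a nonzero
multiple of β⁰_{1j} and the determinant is not zero.

The rate comes from `wt_sq_div_le`. With w(r) = (r/(1+r))^{μ_{11}}, the functions E_k, and then U_k
by absorption, are O(w(|ρ|x) e^{|Im ρ| x}), while E_s is O(w(|ρ|x) e^{-|Im ρ| x}). The exponentials
cancel in N_k, and w(|ρ|t)²/|ρ| is at most a constant times |ρ|^{-β} t^{1-2ν_1}, whose last factor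
is the weight against which Q is integrable. The multipliers are unique because S_1, S_2 are
independent.

Two existence statements remain. The Jost constants come from Hankel's integral, which solves the
same differential equation and behaves like Γ(ν + 1/2) e^{iz} at infinity. The Bessel-type solutions
come from a contraction in an exponentially weighted norm. -/

noncomputable section
namespace StokesSL
open MeasureTheory Filter Topology

/-! ### Entire power series with coefficients of exponential type -/

/-- The sum of a power series. -/
def powSum (a : ℕ → ℂ) (u : ℂ) : ℂ := ∑' k : ℕ, a k * u ^ k

/-- The coefficients of the derivative of a power series. -/
def derivCoeff (a : ℕ → ℂ) (k : ℕ) : ℂ := (k + 1) * a (k + 1)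

/-- The coefficients are bounded by those of `M * exp (D * u)`. -/
def ExpBounded (a : ℕ → ℂ) : Prop :=
  ∃ M D : ℝ, 0 ≤ M ∧ 0 ≤ D ∧ ∀ k, ‖a k‖ ≤ M * (D ^ k / k.factorial)

theorem ExpBounded.derivCoeff {a : ℕ → ℂ} (ha : ExpBounded a) : ExpBounded (derivCoeff a) := by
  obtain ⟨M, D, hM, hD, h⟩ := ha
  refine ⟨M * D, D, mul_nonneg hM hD, hD, fun k => ?_⟩
  have h1 := h (k + 1)
  have hk : (0 : ℝ) < k + 1 := by positivity
  have hf : (0 : ℝ) < k.factorial := by exact_mod_cast k.factorial_pos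
  rw [StokesSL.derivCoeff, norm_mul]
  have : ‖((k : ℂ) + 1)‖ = k + 1 := by
    have := Complex.norm_natCast (k + 1)
    push_cast at this
    exact this
  rw [this]
  calc (k + 1) * ‖a (k + 1)‖ ≤ (k + 1) * (M * (D ^ (k + 1) / (k + 1).factorial)) := by gcongr
    _ = M * D * (D ^ k / k.factorial) := by
      rw [Nat.factorial_succ, pow_succ]; push_cast; field_simp

theorem summable_expBound (M D r : ℝ) :
    Summable fun k : ℕ => M * (D ^ k / k.factorial) * r ^ k := by
  have := (Real.summable_pow_div_factorial (D * r)).mul_left M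
  refine this.congr fun k => ?_
  rw [mul_pow]; ring

theorem ExpBounded.summable_norm {a : ℕ → ℂ} (ha : ExpBounded a) (u : ℂ) :
    Summable fun k : ℕ => ‖a k * u ^ k‖ := by
  obtain ⟨M, D, hM, hD, h⟩ := ha
  refine (summable_expBound M D ‖u‖).of_nonneg_of_le (fun _ => norm_nonneg _) fun k => ?_
  rw [norm_mul, norm_pow]
  gcongr
  exact h k

theorem ExpBounded.summable {a : ℕ → ℂ} (ha : ExpBounded a) (u : ℂ) :
    Summable fun k : ℕ => a k * u ^ k := (ha.summable_norm u).of_norm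

theorem ExpBounded.hasDerivAt {a : ℕ → ℂ} (ha : ExpBounded a) (u : ℂ) :
    HasDerivAt (powSum a) (powSum (StokesSL.derivCoeff a) u) u := by
  obtain ⟨M, D, hM, hD, h⟩ := ha.derivCoeff
  set r := ‖u‖ + 1
  have hr : 0 < r := by positivity
  have key := hasDerivAt_tsum_of_isPreconnected
    (g := fun (k : ℕ) (z : ℂ) => a (k + 1) * z ^ (k + 1))
    (g' := fun (k : ℕ) (z : ℂ) => StokesSL.derivCoeff a k * z ^ k)
    (t := Metric.ball (0 : ℂ) r) (y₀ := 0) (y := u)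
    (summable_expBound M D r) Metric.isOpen_ball (convex_ball _ _).isPreconnected
    (fun k z _ => by
      have := (hasDerivAt_pow (k + 1) z).const_mul (a (k + 1))
      refine this.congr_deriv ?_
      simp only [StokesSL.derivCoeff, Nat.add_sub_cancel]
      push_cast; ring)
    (fun k z hz => by
      rw [norm_mul, norm_pow]
      have hz' : ‖z‖ ≤ r := by simpa using (Metric.mem_ball.1 hz).le
      gcongr
      exact h k)
    (by simpa using hr)
    (by simp [summable_zero])
    (by simp [r])
  have heq : powSum a = fun z => a 0 + ∑' k : ℕ, a (k + 1) * z ^ (k + 1) := by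
    funext z
    rw [powSum, (ha.summable z).tsum_eq_zero_add]
    simp
  rw [heq]
  exact key.const_add _

theorem ExpBounded.continuous {a : ℕ → ℂ} (ha : ExpBounded a) : Continuous (powSum a) :=
  continuous_iff_continuousAt.2 fun u => (ha.hasDerivAt u).continuousAt

theorem powSum_zero (a : ℕ → ℂ) : powSum a 0 = a 0 := by
  rw [powSum, tsum_eq_single 0]
  · simp
  · intro k hk; simp [hk]

/-- `a` are the coefficients of an entire solution of `4 u φ'' + (4 μ + 2) φ' + φ = 0`. -/
def BesselRec (μ : ℝ) (a : ℕ → ℂ) : Prop :=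
  ∀ k : ℕ, (2 * (k + 1) * (2 * (k + 1) + 2 * μ - 1) : ℂ) * a (k + 1) = -a k

/-- The coefficient of u^k in 4uφ'' + (4μ+2)φ' is (4k + 4μ + 2)(k+1) a_{k+1}, which is the left side
of the recurrence. -/
theorem BesselRec.ode {μ : ℝ} {a : ℕ → ℂ} (ha : ExpBounded a) (h : BesselRec μ a) (u : ℂ) :
    4 * u * powSum (derivCoeff (derivCoeff a)) u + (4 * μ + 2) * powSum (derivCoeff a) u
      + powSum a u = 0 := by
  have h1 := (ha.derivCoeff.derivCoeff.summable u).hasSum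
  have h2 := (ha.derivCoeff.summable u).hasSum
  have h3 := (ha.summable u).hasSum
  have h1' : HasSum (fun k : ℕ => (k : ℂ) * derivCoeff a k * u ^ k)
      (u * powSum (derivCoeff (derivCoeff a)) u) := by
    rw [← hasSum_nat_add_iff' 1]
    simp only [Finset.range_one, Finset.sum_singleton, Nat.cast_zero, zero_mul, sub_zero]
    refine (h1.mul_left u).congr_fun ?_
    intro k
    simp only [derivCoeff]; push_cast; ring
  have := ((h1'.mul_left 4).add (h2.mul_left (4 * (μ : ℂ) + 2))).add h3
  rw [mul_assoc]
  refine this.unique ?_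
  convert hasSum_zero using 2 with k
  have hk := h k
  simp only [derivCoeff]
  linear_combination (u ^ k) * hk

/-! ### Coefficients of the Bessel series: recurrence and factorial decay. -/

theorem besselCoeff_zero (ν : ℝ) (j : Fin 2) (c : ℂ) : besselCoeff ν j c 0 = c := by
  simp [besselCoeff]

theorem indicial_factor (ν : ℝ) (j : Fin 2) (s : ℝ) :
    (2 * s + mu j ν) * (2 * s + mu j ν - 1) - omega ν = 2 * s * (2 * s + 2 * mu j ν - 1) := by
  unfold mu omega; split_ifs <;> ring

theorem exists_le_abs_add {ν : ℝ} (hν : ∀ n : ℕ, ν ≠ n) :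
    ∃ δ > 0, ∀ k : ℕ, δ ≤ |(k : ℝ) - ν| := by
  obtain ⟨N, hN⟩ := exists_nat_gt (ν + 1)
  have hpos : ∀ k ∈ Finset.range (N + 1), 0 < |(k : ℝ) - ν| := fun k _ =>
    abs_pos.2 (sub_ne_zero.2 (hν k).symm)
  obtain ⟨k₀, hk₀, hmin⟩ := Finset.exists_min_image (Finset.range (N + 1))
    (fun k : ℕ => |(k : ℝ) - ν|) ⟨0, by simp⟩
  refine ⟨min 1 |(k₀ : ℝ) - ν|, lt_min one_pos (hpos _ hk₀), fun k => ?_⟩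
  by_cases hk : k ∈ Finset.range (N + 1)
  · exact (min_le_right _ _).trans (hmin k hk)
  · refine (min_le_left _ _).trans ?_
    have : (N : ℝ) ≤ k := by
      have : N ≤ k := by simp at hk; omega
      exact_mod_cast this
    exact (by linarith : (1 : ℝ) ≤ k - ν).trans (le_abs_self _)

/-- Non-resonance: for μ_1 the second factor is 2(k + 1 - ν), kept away from zero because ν is not a
natural number; for μ_2 it is at least 2. The bound, linear in k, yields the factorial decay of the
coefficients. -/
theorem exists_le_abs_indicial {ν : ℝ} (h0 : 0 < ν) (hν : ∀ n : ℕ, ν ≠ n) (j : Fin 2) :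
    ∃ δ > 0, ∀ k : ℕ, δ * (k + 1) ≤
      |2 * ((k : ℝ) + 1) * (2 * ((k : ℝ) + 1) + 2 * mu j ν - 1)| := by
  obtain ⟨δ, hδ, h⟩ := exists_le_abs_add hν
  refine ⟨min δ 1, lt_min hδ one_pos, fun k => ?_⟩
  have hk : (0 : ℝ) ≤ k := k.cast_nonneg
  rw [abs_mul, abs_of_pos (by positivity : (0 : ℝ) < 2 * (k + 1))]
  have : min δ 1 ≤ |2 * ((k : ℝ) + 1) + 2 * mu j ν - 1| := by
    unfold mu
    split_ifs
    · have h1 := h (k + 1)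
      push_cast at h1
      rw [show 2 * ((k : ℝ) + 1) + 2 * (1 / 2 - ν) - 1 = 2 * ((k : ℝ) + 1 - ν) by ring, abs_mul,
        abs_two]
      have := abs_nonneg ((k : ℝ) + 1 - ν)
      exact (min_le_left _ _).trans (by linarith)
    · refine (min_le_right _ _).trans (le_trans ?_ (le_abs_self _))
      linarith
  nlinarith [lt_min hδ one_pos]

theorem besselCoeff_succ {ν : ℝ} (h0 : 0 < ν) (hν : ∀ n : ℕ, ν ≠ n) (j : Fin 2) (c : ℂ) :
    BesselRec (mu j ν) (besselCoeff ν j c) := by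
  intro k
  obtain ⟨δ, hδ, h⟩ := exists_le_abs_indicial h0 hν j
  have hne : 2 * ((k : ℝ) + 1) * (2 * ((k : ℝ) + 1) + 2 * mu j ν - 1) ≠ 0 := by
    have := h k
    have h2 : 0 < δ * ((k : ℝ) + 1) := by positivity
    exact abs_pos.1 (h2.trans_le this)
  have hneC : (2 * ((k : ℂ) + 1) * (2 * ((k : ℂ) + 1) + 2 * (mu j ν : ℂ) - 1)) ≠ 0 := by
    exact_mod_cast hne
  unfold besselCoeff
  rw [Finset.prod_Icc_succ_top (by omega), indicial_factor]
  push_cast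
  set A : ℂ := 2 * ((k : ℂ) + 1) * (2 * ((k : ℂ) + 1) + 2 * (mu j ν : ℂ) - 1)
  rw [mul_inv, pow_succ]
  linear_combination (-((-1) ^ k * c * (∏ x ∈ Finset.Icc 1 k, ((2 * (x : ℂ) + (mu j ν : ℂ)) *
    (2 * (x : ℂ) + (mu j ν : ℂ) - 1) - (omega ν : ℂ)))⁻¹)) * (mul_inv_cancel₀ hneC)

theorem besselCoeff_expBounded {ν : ℝ} (h0 : 0 < ν) (hν : ∀ n : ℕ, ν ≠ n) (j : Fin 2) (c : ℂ) :
    ExpBounded (besselCoeff ν j c) := by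
  obtain ⟨δ, hδ, h⟩ := exists_le_abs_indicial h0 hν j
  refine ⟨‖c‖, δ⁻¹, norm_nonneg _, by positivity, fun k => ?_⟩
  induction k with
  | zero => simp [besselCoeff_zero]
  | succ k ih =>
    have hr := congrArg norm (besselCoeff_succ h0 hν j c k)
    rw [norm_mul, norm_neg] at hr
    have hn : ‖(2 * ((k : ℂ) + 1) * (2 * ((k : ℂ) + 1) + 2 * (mu j ν : ℂ) - 1))‖
        = |2 * ((k : ℝ) + 1) * (2 * ((k : ℝ) + 1) + 2 * mu j ν - 1)| := by
      rw [← Real.norm_eq_abs, ← Complex.norm_real]; push_cast; rfl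
    rw [hn] at hr
    have hk := h k
    have h2 : δ * (k + 1) * ‖besselCoeff ν j c (k + 1)‖ ≤ ‖c‖ * (δ⁻¹ ^ k / k.factorial) := by
      refine le_trans ?_ ih
      rw [← hr]
      gcongr
    have hf : (0 : ℝ) < k.factorial := by exact_mod_cast k.factorial_pos
    have h3 : ‖c‖ * (δ⁻¹ ^ (k + 1) / (k + 1).factorial)
        = (‖c‖ * (δ⁻¹ ^ k / k.factorial)) / (δ * (k + 1)) := by
      rw [Nat.factorial_succ, pow_succ]; push_cast; field_simp
    rw [h3, le_div_iff₀ (by positivity)]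
    linarith

/-! ### The Bessel solutions -/

/-- The entire factor `φ` of `besselC = z ^ μ * φ (z ^ 2)`. -/
def besselPhi (ν : ℝ) (j : Fin 2) (c : ℂ) : ℂ → ℂ := powSum (besselCoeff ν j c)

/-- The derivative of `besselPhi`. -/
def besselPhi' (ν : ℝ) (j : Fin 2) (c : ℂ) : ℂ → ℂ := powSum (derivCoeff (besselCoeff ν j c))

/-- The derivative of `besselC`. -/
def besselC' (ν : ℝ) (j : Fin 2) (c : ℂ) (z : ℂ) : ℂ :=
  z ^ ((mu j ν : ℝ) : ℂ) *
    ((mu j ν : ℝ) / z * besselPhi ν j c (z ^ 2) + 2 * z * besselPhi' ν j c (z ^ 2))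

theorem besselC_eq (ν : ℝ) (j : Fin 2) (c z : ℂ) :
    besselC ν j c z = z ^ ((mu j ν : ℝ) : ℂ) * besselPhi ν j c (z ^ 2) := by
  unfold besselC besselPhi powSum
  simp only [pow_mul]

theorem besselCLam_eq (ν : ℝ) (j : Fin 2) (c lam : ℂ) (x : ℝ) :
    besselCLam ν j c x lam
      = ((x ^ mu j ν : ℝ) : ℂ) * besselPhi ν j c (lam * (x : ℂ) ^ 2) := rfl

theorem hasDerivAt_cpow_self (μ : ℝ) {z : ℂ} (hz : z ∈ Complex.slitPlane) :
    HasDerivAt (fun z : ℂ => z ^ (μ : ℂ)) (z ^ (μ : ℂ) * (μ / z)) z := by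
  have h := (hasDerivAt_id z).cpow_const (c := (μ : ℂ)) hz
  refine h.congr_deriv ?_
  have hz0 := Complex.slitPlane_ne_zero hz
  simp only [id, Complex.cpow_sub _ _ hz0, Complex.cpow_one]
  field_simp

theorem hasDerivAt_besselPhi {ν : ℝ} (h0 : 0 < ν) (hν : ∀ n : ℕ, ν ≠ n)
    (j : Fin 2) (c u : ℂ) :
    HasDerivAt (besselPhi ν j c) (besselPhi' ν j c u) u :=
  (besselCoeff_expBounded h0 hν j c).hasDerivAt u

theorem hasDerivAt_besselPhi' {ν : ℝ} (h0 : 0 < ν) (hν : ∀ n : ℕ, ν ≠ n)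
    (j : Fin 2) (c u : ℂ) :
    ∃ d, HasDerivAt (besselPhi' ν j c) d u ∧
      4 * u * d + (4 * mu j ν + 2) * besselPhi' ν j c u + besselPhi ν j c u = 0 :=
  ⟨_, (besselCoeff_expBounded h0 hν j c).derivCoeff.hasDerivAt u,
    (besselCoeff_succ h0 hν j c).ode (besselCoeff_expBounded h0 hν j c) u⟩

theorem hasDerivAt_besselC {ν : ℝ} (h0 : 0 < ν) (hν : ∀ n : ℕ, ν ≠ n)
    (j : Fin 2) (c : ℂ) {z : ℂ} (hz : z ∈ Complex.slitPlane) :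
    HasDerivAt (besselC ν j c) (besselC' ν j c z) z := by
  have hsq : HasDerivAt (fun z : ℂ => z ^ 2) (2 * z) z := by simpa using hasDerivAt_pow 2 z
  have h2 := (hasDerivAt_besselPhi h0 hν j c (z ^ 2)).comp z hsq
  have h3 := (hasDerivAt_cpow_self (mu j ν) hz).mul h2
  have heq : besselC ν j c
      = (fun z : ℂ => z ^ ((mu j ν : ℝ) : ℂ)) * (besselPhi ν j c ∘ fun z => z ^ 2) := by
    funext z; exact besselC_eq ν j c z
  rw [heq]
  refine h3.congr_deriv ?_
  simp only [besselC', Function.comp]; ring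

theorem hasDerivAt_besselC' {ν : ℝ} (h0 : 0 < ν) (hν : ∀ n : ℕ, ν ≠ n)
    (j : Fin 2) (c : ℂ) {z : ℂ} (hz : z ∈ Complex.slitPlane) :
    HasDerivAt (besselC' ν j c) ((omega ν / z ^ 2 - 1) * besselC ν j c z) z := by
  have hz0 := Complex.slitPlane_ne_zero hz
  have hsq : HasDerivAt (fun z : ℂ => z ^ 2) (2 * z) z := by simpa using hasDerivAt_pow 2 z
  have h2 := (hasDerivAt_besselPhi h0 hν j c (z ^ 2)).comp z hsq
  obtain ⟨d, hd, hode⟩ := hasDerivAt_besselPhi' h0 hν j c (z ^ 2)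
  have h2' := hd.comp z hsq
  have hinv : HasDerivAt (fun z : ℂ => ((mu j ν : ℝ) : ℂ) / z) (-(mu j ν : ℝ) / z ^ 2) z := by
    simpa [div_eq_mul_inv] using (hasDerivAt_inv hz0).const_mul ((mu j ν : ℝ) : ℂ)
  have hlin : HasDerivAt (fun z : ℂ => 2 * z) 2 z := by
    simpa using (hasDerivAt_id z).const_mul (2 : ℂ)
  have h3 := (hasDerivAt_cpow_self (mu j ν) hz).mul ((hinv.mul h2).add (hlin.mul h2'))
  refine h3.congr_deriv ?_
  rw [besselC_eq]
  have hom : (omega ν : ℂ) = mu j ν * (mu j ν - 1) := by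
    have : omega ν = mu j ν * (mu j ν - 1) := by unfold mu omega; split_ifs <;> ring
    exact_mod_cast this
  simp only [Function.comp, Pi.mul_apply, Pi.add_apply]
  rw [hom]
  field_simp
  linear_combination (z ^ 2 * z ^ ((mu j ν : ℝ) : ℂ)) * hode

/-- This is the Wronskian of c_1, c_2 after the powers z^{μ_1} z^{μ_2} = z have been removed. It is
entire in u = z², the two second-order equations make its derivative vanish, and at u = 0 it is 2ν
c_{10} c_{20} = 1. No branch of the power enters. -/
theorem besselPhi_wronskian {ν : ℝ} (h0 : 0 < ν) (hν : ∀ n : ℕ, ν ≠ n)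
    (c₀ : Fin 2 → ℂ) (hc : c₀ 0 * c₀ 1 = ((2 * ν : ℝ) : ℂ)⁻¹) (u : ℂ) :
    2 * ν * besselPhi ν 0 (c₀ 0) u * besselPhi ν 1 (c₀ 1) u
      + 2 * u * (besselPhi ν 0 (c₀ 0) u * besselPhi' ν 1 (c₀ 1) u
        - besselPhi' ν 0 (c₀ 0) u * besselPhi ν 1 (c₀ 1) u) = 1 := by
  set P : ℂ → ℂ := fun u => 2 * ν * besselPhi ν 0 (c₀ 0) u * besselPhi ν 1 (c₀ 1) u
      + 2 * u * (besselPhi ν 0 (c₀ 0) u * besselPhi' ν 1 (c₀ 1) u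
        - besselPhi' ν 0 (c₀ 0) u * besselPhi ν 1 (c₀ 1) u) with hP
  have hd : ∀ u, HasDerivAt P 0 u := by
    intro u
    have a0 := hasDerivAt_besselPhi h0 hν 0 (c₀ 0) u
    have a1 := hasDerivAt_besselPhi h0 hν 1 (c₀ 1) u
    obtain ⟨d0, b0, o0⟩ := hasDerivAt_besselPhi' h0 hν 0 (c₀ 0) u
    obtain ⟨d1, b1, o1⟩ := hasDerivAt_besselPhi' h0 hν 1 (c₀ 1) u
    have hlin : HasDerivAt (fun z : ℂ => 2 * z) 2 u := by
      simpa using (hasDerivAt_id u).const_mul (2 : ℂ)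
    have := ((a0.const_mul (2 * (ν : ℂ))).mul a1).add (hlin.mul ((a0.mul b1).sub (b0.mul a1)))
    refine this.congr_deriv ?_
    simp only [mu, Pi.mul_apply, Pi.sub_apply, if_true, one_ne_zero, if_false] at o0 o1 ⊢
    push_cast at o0 o1
    linear_combination (besselPhi ν 0 (c₀ 0) u / 2) * o1 - (besselPhi ν 1 (c₀ 1) u / 2) * o0
  have hconst := is_const_of_deriv_eq_zero (𝕜 := ℂ) (fun u => (hd u).differentiableAt)
    (fun u => (hd u).deriv) u 0
  have hP0 : P 0 = 1 := by
    have hν0 : (ν : ℂ) ≠ 0 := by exact_mod_cast h0.ne'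
    simp only [hP, besselPhi, powSum_zero, besselCoeff_zero]
    push_cast at hc
    rw [mul_zero, zero_mul, add_zero, mul_assoc, hc]
    field_simp
  rw [hP0] at hconst
  exact hconst

theorem besselC_wronskian {ν : ℝ} (h0 : 0 < ν) (hν : ∀ n : ℕ, ν ≠ n)
    (c₀ : Fin 2 → ℂ) (hc : c₀ 0 * c₀ 1 = ((2 * ν : ℝ) : ℂ)⁻¹) {z : ℂ}
    (hz : z ≠ 0) :
    besselC ν 0 (c₀ 0) z * besselC' ν 1 (c₀ 1) z
      - besselC' ν 0 (c₀ 0) z * besselC ν 1 (c₀ 1) z = 1 := by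
  have h := besselPhi_wronskian h0 hν c₀ hc (z ^ 2)
  have hpow : z ^ ((mu 0 ν : ℝ) : ℂ) * z ^ ((mu 1 ν : ℝ) : ℂ) = z := by
    rw [← Complex.cpow_add _ _ hz]
    simp [mu]; norm_num
  have hmu : ((mu 1 ν : ℝ) : ℂ) - (mu 0 ν : ℝ) = 2 * ν := by simp [mu]; ring
  rw [besselC_eq, besselC_eq, besselC', besselC', ← h]
  set A := besselPhi ν 0 (c₀ 0) (z ^ 2)
  set B := besselPhi ν 1 (c₀ 1) (z ^ 2)
  set A' := besselPhi' ν 0 (c₀ 0) (z ^ 2)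
  set B' := besselPhi' ν 1 (c₀ 1) (z ^ 2)
  set p := z ^ ((mu 0 ν : ℝ) : ℂ)
  set q := z ^ ((mu 1 ν : ℝ) : ℂ)
  have : p * A * (q * ((mu 1 ν : ℝ) / z * B + 2 * z * B'))
      - p * ((mu 0 ν : ℝ) / z * A + 2 * z * A') * (q * B)
      = (p * q) * ((((mu 1 ν : ℝ) : ℂ) - (mu 0 ν : ℝ)) / z * A * B
        + 2 * z * (A * B' - A' * B)) := by ring
  rw [this, hpow, hmu]
  field_simp

/-! ### Absorbing a bound into itself -/

/-- Absorption in place of a Grönwall or Neumann-series argument: iterating the improvement M ↦ A +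
M/2 from any finite bound converges to 2A. The initial bound matters only by being finite, so it may
depend on all parameters. -/
theorem le_of_halving {X : Type*} {s : Set X} {u W : X → ℝ} {A : ℝ} (hA : 0 ≤ A)
    (hW : ∀ x ∈ s, 0 ≤ W x) (hM : ∃ M, ∀ x ∈ s, u x ≤ M * W x)
    (step : ∀ M, 0 ≤ M → (∀ x ∈ s, u x ≤ M * W x) → ∀ x ∈ s, u x ≤ (A + M / 2) * W x) :
    ∀ x ∈ s, u x ≤ 2 * A * W x := by
  obtain ⟨M, hM⟩ := hM
  have hiter : ∀ n : ℕ, ∀ x ∈ s, u x ≤ (2 * A + |M| * (1 / 2) ^ n) * W x := by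
    intro n
    induction n with
    | zero =>
      intro x hx
      refine (hM x hx).trans (mul_le_mul_of_nonneg_right ?_ (hW x hx))
      have := le_abs_self M
      simp only [pow_zero, mul_one]; linarith
    | succ n ih =>
      intro x hx
      refine (step _ (by positivity) ih x hx).trans_eq ?_
      rw [pow_succ]; ring
  intro x hx
  have hlim : Tendsto (fun n : ℕ => (2 * A + |M| * (1 / 2 : ℝ) ^ n) * W x) atTop
      (𝓝 ((2 * A + |M| * 0) * W x)) :=
    ((tendsto_pow_atTop_nhds_zero_of_lt_one (by norm_num) (by norm_num)).const_mul _
      |>.const_add _).mul_const _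
  have := ge_of_tendsto' hlim fun n => hiter n x hx
  simpa using this

/-! ### The unperturbed equation along a ray -/

/-- `f'' = (ω / r² - z²) f` on `(0, ∞)`, `f'` being the derivative of `f`. -/
def IsRaySol (ω : ℝ) (z : ℂ) (f f' : ℝ → ℂ) : Prop :=
  ∀ r : ℝ, 0 < r → HasDerivAt f (f' r) r ∧
    HasDerivAt f' (((ω : ℂ) / (r : ℂ) ^ 2 - z ^ 2) * f r) r

theorem isRaySol_of_hasDerivAt {ω : ℝ} {z : ℂ} (hz : z ≠ 0) {y y' : ℂ → ℂ}
    (h1 : ∀ r : ℝ, 0 < r → HasDerivAt y (y' (r * z)) (r * z))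
    (h2 : ∀ r : ℝ, 0 < r →
      HasDerivAt y' (((ω : ℂ) / ((r : ℂ) * z) ^ 2 - 1) * y (r * z)) (r * z)) :
    IsRaySol ω z (fun r => y (r * z)) (fun r => z * y' (r * z)) := by
  intro r hr
  have hr' : (r : ℂ) ≠ 0 := by exact_mod_cast hr.ne'
  have hl : HasDerivAt (fun r : ℝ => (r : ℂ) * z) z r := by
    simpa using (Complex.ofRealCLM.hasDerivAt (x := r)).mul_const z
  constructor
  · refine ((h1 r hr).comp r hl).congr_deriv (by ring)
  · refine (((h2 r hr).comp r hl).const_mul z).congr_deriv ?_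
    field_simp

theorem IsRaySol.continuousOn {ω : ℝ} {z : ℂ} {f f' : ℝ → ℂ} (h : IsRaySol ω z f f') :
    ContinuousOn f (Set.Ioi 0) :=
  fun r hr => (h r hr).1.continuousAt.continuousWithinAt

theorem uIcc_subset_Ioi_zero {R r : ℝ} (hR : 0 < R) (hr : 0 < r) :
    Set.uIcc R r ⊆ Set.Ioi 0 := fun _ hs => (lt_min hR hr).trans_le hs.1

/-- The term ω r⁻² f is treated as an inhomogeneity of f'' + z² f = 0. No order between `R` and `r`
is assumed: the formula serves for growth estimates to the right, and from infinity back to 1 in the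
proof of the Jost equation. -/
theorem IsRaySol.variation_of_constants {ω : ℝ} {z : ℂ} {f f' : ℝ → ℂ} (h : IsRaySol ω z f f')
    {R r : ℝ} (hR : 0 < R) (hr : 0 < r) :
    z * f r = f' R * Complex.sin (z * (r - R)) + z * f R * Complex.cos (z * (r - R))
      + ∫ s in R..r, (ω : ℂ) / (s : ℂ) ^ 2 * f s * Complex.sin (z * (r - s)) := by
  set W : ℝ → ℂ := fun s =>
    f' s * Complex.sin (z * (r - s)) + z * f s * Complex.cos (z * (r - s)) with hW
  have hderiv : ∀ s ∈ Set.uIcc R r,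
      HasDerivAt W ((ω : ℂ) / (s : ℂ) ^ 2 * f s * Complex.sin (z * (r - s))) s := by
    intro s hs
    obtain ⟨h1, h2⟩ := h s (uIcc_subset_Ioi_zero hR hr hs)
    have hl : HasDerivAt (fun s : ℝ => z * ((r : ℂ) - (s : ℂ))) (-z) s := by
      simpa using ((Complex.ofRealCLM.hasDerivAt (x := s)).const_sub (r : ℂ)).const_mul z
    have hs' := (Complex.hasDerivAt_sin _).comp s hl
    have hc' := (Complex.hasDerivAt_cos _).comp s hl
    refine ((h2.mul hs').add ((h1.const_mul z).mul hc')).congr_deriv ?_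
    simp only [Function.comp]
    ring
  have hcont : ContinuousOn
      (fun s : ℝ => (ω : ℂ) / (s : ℂ) ^ 2 * f s * Complex.sin (z * (r - s))) (Set.uIcc R r) := by
    have hf := h.continuousOn.mono (uIcc_subset_Ioi_zero hR hr)
    refine ContinuousOn.mul (ContinuousOn.mul ?_ hf) (by fun_prop)
    refine continuousOn_const.div (by fun_prop) fun s hs => ?_
    have : s ≠ 0 := (uIcc_subset_Ioi_zero hR hr hs).ne'
    exact pow_ne_zero 2 (by exact_mod_cast this)
  rw [intervalIntegral.integral_eq_sub_of_hasDerivAt hderiv hcont.intervalIntegrable]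
  simp [hW]

theorem norm_exp_mul_I_le (w : ℂ) : ‖Complex.exp (w * Complex.I)‖ ≤ Real.exp |w.im| := by
  rw [Complex.norm_exp]
  simpa using neg_le_abs w.im

theorem norm_sin_le (w : ℂ) : ‖Complex.sin w‖ ≤ Real.exp |w.im| := by
  have h1 := norm_exp_mul_I_le w
  have h2 := norm_exp_mul_I_le (-w)
  rw [Complex.neg_im, abs_neg] at h2
  rw [Complex.sin, norm_div, norm_mul, Complex.norm_I, mul_one, Complex.norm_two]
  have := norm_sub_le (Complex.exp (-w * Complex.I)) (Complex.exp (w * Complex.I))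
  linarith

theorem norm_cos_le (w : ℂ) : ‖Complex.cos w‖ ≤ Real.exp |w.im| := by
  have h1 := norm_exp_mul_I_le w
  have h2 := norm_exp_mul_I_le (-w)
  rw [Complex.neg_im, abs_neg] at h2
  rw [Complex.cos, norm_div, Complex.norm_two]
  have := norm_add_le (Complex.exp (w * Complex.I)) (Complex.exp (-w * Complex.I))
  linarith

theorem intervalIntegrable_inv_sq (c : ℝ) {R r : ℝ} (hR : 0 < R) (hr : 0 < r) :
    IntervalIntegrable (fun s : ℝ => c / s ^ 2) volume R r := by
  refine ContinuousOn.intervalIntegrable (continuousOn_const.div (by fun_prop) fun s hs => ?_)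
  exact pow_ne_zero 2 (uIcc_subset_Ioi_zero hR hr hs).ne'

theorem integral_inv_sq_le {c R r : ℝ} (hc : 0 ≤ c) (hR : 0 < R) (hr : R ≤ r) :
    ∫ s in R..r, c / s ^ 2 ≤ c / R := by
  have hr0 := hR.trans_le hr
  have hd : ∀ s ∈ Set.uIcc R r, HasDerivAt (fun s : ℝ => -(c / s)) (c / s ^ 2) s := by
    intro s hs
    have hs0 : s ≠ 0 := (uIcc_subset_Ioi_zero hR hr0 hs).ne'
    refine (((hasDerivAt_inv hs0).const_mul c).neg).congr_deriv ?_
    field_simp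
  rw [intervalIntegral.integral_eq_sub_of_hasDerivAt hd (intervalIntegrable_inv_sq c hR hr0)]
  have : 0 ≤ c / r := by positivity
  linarith

/-- Sine and cosine grow at most like e^{|Im z| (r - R)}, and ∫_R^r |ω| s⁻² ds ≤ |ω|/R ≤ 1/2, so the
integral term can be absorbed. -/
theorem IsRaySol.norm_le {ω : ℝ} {z : ℂ} {f f' : ℝ → ℂ} (h : IsRaySol ω z f f') (hz : ‖z‖ = 1)
    {R : ℝ} (hR : 0 < R) (hRω : 2 * |ω| ≤ R) {r : ℝ} (hr : R ≤ r) :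
    ‖f r‖ ≤ 2 * (‖f R‖ + ‖f' R‖) * Real.exp (|z.im| * (r - R)) := by
  have hsub : Set.Icc R r ⊆ Set.Ioi 0 := fun s hs => hR.trans_le hs.1
  have him : ∀ a b : ℝ, a ≤ b → |(z * ((b : ℂ) - a)).im| = |z.im| * (b - a) := by
    intro a b hab
    rw [← Complex.ofReal_sub, Complex.im_mul_ofReal, abs_mul, abs_of_nonneg (sub_nonneg.2 hab)]
  refine le_of_halving (s := Set.Icc R r) (u := fun r => ‖f r‖)
    (W := fun r => Real.exp (|z.im| * (r - R))) (by positivity) (fun _ _ => by positivity) ?_ ?_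
    r ⟨hr, le_rfl⟩
  · obtain ⟨M, hM⟩ := isCompact_Icc.exists_bound_of_continuousOn (h.continuousOn.mono hsub)
    refine ⟨M, fun x hx => (hM x hx).trans ?_⟩
    have hM0 : 0 ≤ M := (norm_nonneg _).trans (hM x hx)
    refine le_mul_of_one_le_right hM0 (Real.one_le_exp ?_)
    exact mul_nonneg (abs_nonneg _) (sub_nonneg.2 hx.1)
  · intro M hM0 hM x hx
    have hx0 : 0 < x := hsub hx
    have hv := h.variation_of_constants hR hx0
    have hn : ‖f x‖ = ‖z * f x‖ := by rw [norm_mul, hz, one_mul]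
    rw [hn, hv]
    have hs := norm_sin_le (z * ((x : ℂ) - R))
    have hc := norm_cos_le (z * ((x : ℂ) - R))
    rw [him R x hx.1] at hs hc
    set E := Real.exp (|z.im| * (x - R)) with hE
    have hInt : ‖∫ s in R..x, (ω : ℂ) / (s : ℂ) ^ 2 * f s * Complex.sin (z * (x - s))‖
        ≤ ∫ s in R..x, |ω| * M * E / s ^ 2 := by
      refine intervalIntegral.norm_integral_le_of_norm_le hx.1 ?_
        (intervalIntegrable_inv_sq _ hR hx0)
      refine Eventually.of_forall fun s hs => ?_
      have hs1 := hM s ⟨hs.1.le, hs.2.trans hx.2⟩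
      have hs2 := norm_sin_le (z * ((x : ℂ) - s))
      rw [him s x hs.2] at hs2
      rw [norm_mul, norm_mul, norm_div, norm_pow, Complex.norm_real, Complex.norm_real,
        Real.norm_eq_abs, Real.norm_eq_abs, sq_abs]
      have hs0 : 0 < s := hR.trans hs.1
      calc |ω| / s ^ 2 * ‖f s‖ * ‖Complex.sin (z * (x - s))‖
          ≤ |ω| / s ^ 2 * (M * Real.exp (|z.im| * (s - R))) * Real.exp (|z.im| * (x - s)) := by
            gcongr
        _ = |ω| * M * E / s ^ 2 := by
            rw [hE, show |z.im| * (x - R) = |z.im| * (s - R) + |z.im| * (x - s) by ring,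
              Real.exp_add]
            ring
    have hInt2 := hInt.trans (integral_inv_sq_le (by positivity) hR hx.1)
    have hhalf : |ω| * M * E / R ≤ M / 2 * E := by
      rw [div_le_iff₀ hR]
      have : 0 ≤ M * E := by positivity
      nlinarith
    calc _ ≤ ‖f' R * Complex.sin (z * (x - R))‖ + ‖z * f R * Complex.cos (z * (x - R))‖
          + |ω| * M * E / R := by
          refine (norm_add_le _ _).trans (add_le_add (norm_add_le _ _) hInt2)
      _ ≤ ‖f' R‖ * E + ‖f R‖ * E + M / 2 * E := by
          rw [norm_mul, norm_mul, norm_mul, hz, one_mul]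
          gcongr
      _ = _ := by ring

theorem besselC_isRaySol {ν : ℝ} (h0 : 0 < ν) (hν : ∀ n : ℕ, ν ≠ n) (j : Fin 2) (c : ℂ) {z : ℂ}
    (hz : z ∈ Complex.slitPlane) :
    IsRaySol (omega ν) z (fun r => besselC ν j c (r * z)) (fun r => z * besselC' ν j c (r * z)) := by
  have hs : ∀ r : ℝ, 0 < r → (r : ℂ) * z ∈ Complex.slitPlane := by
    intro r hr
    rw [Complex.mem_slitPlane_iff] at hz ⊢
    rw [Complex.re_ofReal_mul, Complex.im_ofReal_mul]
    exact hz.imp (mul_pos hr) (mul_ne_zero hr.ne')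
  exact isRaySol_of_hasDerivAt (Complex.slitPlane_ne_zero hz)
    (fun r hr => hasDerivAt_besselC h0 hν j c (hs r hr))
    (fun r hr => hasDerivAt_besselC' h0 hν j c (hs r hr))

/-! ### Bounds for the Bessel solutions -/

/-- The weight `(r / (1 + r)) ^ μ`, comparable to `r ^ μ` near zero and to `1` at infinity. -/
def wt (μ r : ℝ) : ℝ := (r / (1 + r)) ^ μ

theorem wt_pos (μ : ℝ) {r : ℝ} (hr : 0 < r) : 0 < wt μ r := by
  unfold wt; positivity

/-- The base r/(1+r) is below 1, so the smallest exponent gives the largest weight. This lets the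
single exponent μ_{11} control every diagonal entry. -/
theorem wt_anti {μ μ' r : ℝ} (hr : 0 < r) (h : μ ≤ μ') : wt μ' r ≤ wt μ r := by
  refine Real.rpow_le_rpow_of_exponent_ge (by positivity) ?_ h
  rw [div_le_one (by positivity)]; linarith

theorem rpow_le_wt (μ : ℝ) {r R : ℝ} (hr : 0 < r) (hR : r ≤ R) :
    r ^ μ ≤ (1 + R) ^ |μ| * wt μ r := by
  have h1 : 1 + r ≤ 1 + R := by linarith
  have h2 : (1 + r) ^ μ ≤ (1 + R) ^ |μ| :=
    (Real.rpow_le_rpow_of_exponent_le (by linarith) (le_abs_self μ)).trans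
      (Real.rpow_le_rpow (by linarith) h1 (abs_nonneg _))
  unfold wt
  rw [Real.div_rpow hr.le (by linarith), ← mul_div_assoc, le_div_iff₀ (by positivity)]
  have := Real.rpow_nonneg hr.le μ
  nlinarith

theorem one_le_wt (μ : ℝ) {r : ℝ} (hr : 1 ≤ r) : 1 ≤ 2 ^ |μ| * wt μ r := by
  unfold wt
  have h1 : (1 / 2 : ℝ) ≤ r / (1 + r) := by
    rw [div_le_div_iff₀ (by norm_num) (by linarith)]; linarith
  have h2 : r / (1 + r) ≤ 1 := by rw [div_le_one (by linarith)]; linarith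
  calc (1 : ℝ) = 2 ^ |μ| * (1 / 2) ^ |μ| := by
        rw [← Real.mul_rpow (by norm_num) (by norm_num)]; norm_num
    _ ≤ 2 ^ |μ| * (r / (1 + r)) ^ |μ| := by gcongr
    _ ≤ 2 ^ |μ| * (r / (1 + r)) ^ μ := by
        gcongr 2 ^ |μ| * ?_
        exact Real.rpow_le_rpow_of_exponent_ge (by linarith) h2 (le_abs_self μ)

theorem mem_slitPlane_of_re_nonneg {z : ℂ} (h : 0 ≤ z.re) (hz : z ≠ 0) :
    z ∈ Complex.slitPlane := by
  rw [Complex.mem_slitPlane_iff]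
  by_contra! hcon
  exact hz (Complex.ext (le_antisymm hcon.1 h) hcon.2)

theorem continuous_besselPhi {ν : ℝ} (h0 : 0 < ν) (hν : ∀ n : ℕ, ν ≠ n) (j : Fin 2) (c : ℂ) :
    Continuous (besselPhi ν j c) := (besselCoeff_expBounded h0 hν j c).continuous

/-- Near the origin the power series decides. Further out every ray is continued from |z| = R by
`IsRaySol.norm_le`; its initial data are bounded uniformly because the directions with Re z ≥ 0 form
a compact arc inside the slit plane. -/
theorem norm_besselC_le {ν : ℝ} (h0 : 0 < ν) (hν : ∀ n : ℕ, ν ≠ n) (j : Fin 2) (c : ℂ) :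
    ∃ C, 0 ≤ C ∧ ∀ z : ℂ, 0 ≤ z.re → z ≠ 0 →
      ‖besselC ν j c z‖ ≤ C * wt (mu j ν) ‖z‖ * Real.exp |z.im| := by
  -- At least 2|ω| for the absorption along rays, and at least 1 so that the weight is bounded below
  -- outside the disc.
  set R : ℝ := 1 + 2 * |omega ν| with hRdef
  have hR1 : 1 ≤ R := by have := abs_nonneg (omega ν); linarith
  have hR : 0 < R := by linarith
  -- near zero
  obtain ⟨M, hM⟩ := (isCompact_closedBall (0 : ℂ) (R ^ 2)).exists_bound_of_continuousOn
    (continuous_besselPhi h0 hν j c).continuousOn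
  have hM0 : 0 ≤ M := (norm_nonneg _).trans (hM 0 (by simp; positivity))
  -- on the arc
  have hK : IsCompact {z : ℂ | ‖z‖ = 1 ∧ 0 ≤ z.re} := by
    have h1 : IsClosed {z : ℂ | 0 ≤ z.re} := isClosed_le continuous_const Complex.continuous_re
    have := (isCompact_sphere (0 : ℂ) 1).inter_right h1
    convert this using 1
    ext z; simp
  have hKs : ∀ z ∈ {z : ℂ | ‖z‖ = 1 ∧ 0 ≤ z.re}, (R : ℂ) * z ∈ Complex.slitPlane := by
    rintro z ⟨hz, hz'⟩
    refine mem_slitPlane_of_re_nonneg ?_ (mul_ne_zero (by exact_mod_cast hR.ne') ?_)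
    · rw [Complex.re_ofReal_mul]; positivity
    · intro h; simp [h] at hz
  obtain ⟨M1, hM1⟩ := hK.exists_bound_of_continuousOn
    (f := fun z => besselC ν j c (R * z)) (fun z hz =>
      ((hasDerivAt_besselC h0 hν j c (hKs z hz)).continuousAt.comp
        (f := fun z : ℂ => (R : ℂ) * z) (by fun_prop)).continuousWithinAt)
  obtain ⟨M2, hM2⟩ := hK.exists_bound_of_continuousOn
    (f := fun z => z * besselC' ν j c (R * z)) (fun z hz =>
      (continuousAt_id.mul ((hasDerivAt_besselC' h0 hν j c (hKs z hz)).continuousAt.comp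
        (f := fun z : ℂ => (R : ℂ) * z) (by fun_prop))).continuousWithinAt)
  set L := 2 * (|M1| + |M2|)
  set C1 := M * (1 + R) ^ |mu j ν|
  set C2 := L * 2 ^ |mu j ν|
  have hC1 : 0 ≤ C1 := by positivity
  have hC2 : 0 ≤ C2 := by positivity
  refine ⟨C1 + C2, by positivity, fun z hre hz => ?_⟩
  have hz0 : 0 < ‖z‖ := norm_pos_iff.2 hz
  have hw := wt_pos (mu j ν) hz0
  rcases le_total ‖z‖ R with h | h
  · have h1 : ‖besselC ν j c z‖ ≤ C1 * wt (mu j ν) ‖z‖ := by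
      rw [besselC_eq, norm_mul, Complex.norm_cpow_real]
      have hb := hM (z ^ 2) (by simpa using pow_le_pow_left₀ hz0.le h 2)
      calc ‖z‖ ^ mu j ν * ‖besselPhi ν j c (z ^ 2)‖
          ≤ ((1 + R) ^ |mu j ν| * wt (mu j ν) ‖z‖) * M := by
            gcongr
            exact rpow_le_wt _ hz0 h
        _ = C1 * wt (mu j ν) ‖z‖ := by simp only [C1]; ring
    have h2 : 1 ≤ Real.exp |z.im| := Real.one_le_exp (abs_nonneg _)
    calc _ ≤ C1 * wt (mu j ν) ‖z‖ * 1 := by rwa [mul_one]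
      _ ≤ _ := by gcongr; linarith
  · set e : ℂ := z / ‖z‖ with he
    have hzn : ((‖z‖ : ℝ) : ℂ) ≠ 0 := by exact_mod_cast hz0.ne'
    have hze : ((‖z‖ : ℝ) : ℂ) * e = z := by rw [he]; field_simp
    have hen : ‖e‖ = 1 := by rw [he, norm_div, Complex.norm_real, norm_norm, div_self hz0.ne']
    have here : 0 ≤ e.re := by rw [he, Complex.div_ofReal_re]; positivity
    have heim : z.im = ‖z‖ * e.im := by
      conv_lhs => rw [← hze]
      rw [Complex.im_ofReal_mul]
    have hes : e ∈ Complex.slitPlane :=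
      mem_slitPlane_of_re_nonneg here (by intro h; simp [h] at hen)
    have hray := (besselC_isRaySol h0 hν j c hes).norm_le hen hR (by linarith) h
    simp only [hze] at hray
    have hb1 := (hM1 e ⟨hen, here⟩).trans (le_abs_self M1)
    have hb2 := (hM2 e ⟨hen, here⟩).trans (le_abs_self M2)
    have hexp : Real.exp (|e.im| * (‖z‖ - R)) ≤ Real.exp |z.im| := by
      rw [heim, abs_mul, abs_of_pos hz0]
      apply Real.exp_le_exp.2
      nlinarith [abs_nonneg e.im]
    have h1 := one_le_wt (mu j ν) (hR1.trans h)
    calc _ ≤ L * Real.exp |z.im| := by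
          refine hray.trans ?_
          gcongr
          simp only [L]
          linarith
      _ ≤ L * (2 ^ |mu j ν| * wt (mu j ν) ‖z‖) * Real.exp |z.im| := by
          gcongr
          exact le_mul_of_one_le_right (by positivity) h1
      _ = C2 * wt (mu j ν) ‖z‖ * Real.exp |z.im| := by simp only [C2]; ring
      _ ≤ _ := by gcongr; linarith

/-! ### Solutions of the Jost integral equation -/

/-- The derivative of `jostE`. -/
def jostE' (ν : ℝ) (c₀ : Fin 2 → ℂ) (b : Fin 2 → Fin 2 → ℂ) (k : Fin 2) (z : ℂ) : ℂ :=
  ∑ j : Fin 2, b k j * besselC' ν j (c₀ j) z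

theorem hasDerivAt_jostE {ν : ℝ} (h0 : 0 < ν) (hν : ∀ n : ℕ, ν ≠ n) (c₀ : Fin 2 → ℂ)
    (b : Fin 2 → Fin 2 → ℂ) (k : Fin 2) {z : ℂ} (hz : z ∈ Complex.slitPlane) :
    HasDerivAt (jostE ν c₀ b k) (jostE' ν c₀ b k z) z :=
  HasDerivAt.fun_sum fun j _ => (hasDerivAt_besselC h0 hν j (c₀ j) hz).const_mul (b k j)

theorem hasDerivAt_jostE' {ν : ℝ} (h0 : 0 < ν) (hν : ∀ n : ℕ, ν ≠ n) (c₀ : Fin 2 → ℂ)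
    (b : Fin 2 → Fin 2 → ℂ) (k : Fin 2) {z : ℂ} (hz : z ∈ Complex.slitPlane) :
    HasDerivAt (jostE' ν c₀ b k) ((omega ν / z ^ 2 - 1) * jostE ν c₀ b k z) z := by
  refine (HasDerivAt.fun_sum fun j _ =>
    (hasDerivAt_besselC' h0 hν j (c₀ j) hz).const_mul (b k j)).congr_deriv ?_
  rw [jostE, Finset.mul_sum]
  exact Finset.sum_congr rfl fun j _ => by ring

theorem ofReal_mul_mem_slitPlane {z : ℂ} (hz : z ∈ Complex.slitPlane) {r : ℝ} (hr : 0 < r) :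
    (r : ℂ) * z ∈ Complex.slitPlane := by
  rw [Complex.mem_slitPlane_iff] at hz ⊢
  rw [Complex.re_ofReal_mul, Complex.im_ofReal_mul]
  exact hz.imp (mul_pos hr) (mul_ne_zero hr.ne')

theorem mem_slitPlane_of_im_pos {z : ℂ} (hz : 0 < z.im) : z ∈ Complex.slitPlane :=
  Complex.mem_slitPlane_iff.2 (Or.inr hz.ne')

theorem jostE_isRaySol {ν : ℝ} (h0 : 0 < ν) (hν : ∀ n : ℕ, ν ≠ n) (c₀ : Fin 2 → ℂ)
    (b : Fin 2 → Fin 2 → ℂ) (k : Fin 2) {z : ℂ} (hz : z ∈ Complex.slitPlane) :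
    IsRaySol (omega ν) z (fun r => jostE ν c₀ b k (r * z)) (fun r => z * jostE' ν c₀ b k (r * z)) :=
  isRaySol_of_hasDerivAt (Complex.slitPlane_ne_zero hz)
    (fun _ hr => hasDerivAt_jostE h0 hν c₀ b k (ofReal_mul_mem_slitPlane hz hr))
    (fun _ hr => hasDerivAt_jostE' h0 hν c₀ b k (ofReal_mul_mem_slitPlane hz hr))

/-! ### Asymptotics of the Jost solution drawn from its integral equation. -/

theorem norm_exp_I_mul (z : ℂ) : ‖Complex.exp (Complex.I * z)‖ = Real.exp (-z.im) := by
  rw [Complex.norm_exp]; simp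

theorem norm_exp_neg_I_mul (z : ℂ) : ‖Complex.exp (-(Complex.I * z))‖ = Real.exp z.im := by
  rw [Complex.norm_exp]; simp

theorem norm_jostIntegrand (ν : ℝ) (c₀ : Fin 2 → ℂ) (b : Fin 2 → Fin 2 → ℂ) {z : ℂ}
    (hz : z ≠ 0) (r : ℝ) :
    ‖jostIntegrand ν c₀ b z r‖ = |omega ν| / ‖z‖ / r ^ 2 *
      (‖Complex.sin (z - r * z)‖ * ‖jostE ν c₀ b 0 (r * z)‖) := by
  have hz0 : ‖z‖ ≠ 0 := norm_ne_zero_iff.2 hz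
  unfold jostIntegrand
  simp only [norm_mul, norm_div, norm_pow, Complex.norm_real, Real.norm_eq_abs, mul_pow, sq_abs]
  by_cases hr : r = 0
  · simp [hr]
  · field_simp

/-- The sine is at most e^{(r-1) Im z}. Hence, for the normalised size g(r) = |e_1(rz)| e^{r Im z},
the Jost kernel is no worse than |ω| |z|⁻¹ r⁻². -/
theorem norm_jostIntegrand_le (ν : ℝ) (c₀ : Fin 2 → ℂ) (b : Fin 2 → Fin 2 → ℂ) {z : ℂ}
    (hz : 0 < z.im) {r : ℝ} (hr : 1 ≤ r) :
    ‖jostIntegrand ν c₀ b z r‖ * Real.exp z.im ≤ |omega ν| / ‖z‖ / r ^ 2 *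
      (‖jostE ν c₀ b 0 (r * z)‖ * Real.exp (r * z.im)) := by
  have hz0 : z ≠ 0 := by rintro rfl; simp at hz
  have hs := norm_sin_le (z - r * z)
  have him : |(z - r * z).im| = (r - 1) * z.im := by
    rw [Complex.sub_im, Complex.im_ofReal_mul, show z.im - r * z.im = -((r - 1) * z.im) by ring,
      abs_neg, abs_of_nonneg (mul_nonneg (by linarith) hz.le)]
  rw [him] at hs
  rw [norm_jostIntegrand ν c₀ b hz0, mul_assoc]
  refine mul_le_mul_of_nonneg_left ?_ (by positivity)
  calc ‖Complex.sin (z - r * z)‖ * ‖jostE ν c₀ b 0 (r * z)‖ * Real.exp z.im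
      ≤ Real.exp ((r - 1) * z.im) * ‖jostE ν c₀ b 0 (r * z)‖ * Real.exp z.im := by gcongr
    _ = ‖jostE ν c₀ b 0 (r * z)‖ * Real.exp (r * z.im) := by
      rw [show r * z.im = (r - 1) * z.im + z.im by ring, Real.exp_add]; ring

theorem le_norm_sin (w : ℂ) :
    (Real.exp (-w.im) - Real.exp w.im) / 2 ≤ ‖Complex.sin w‖ := by
  rw [Complex.sin, norm_div, norm_mul, Complex.norm_I, mul_one, Complex.norm_two]
  have h1 : ‖Complex.exp (w * Complex.I)‖ = Real.exp (-w.im) := by rw [Complex.norm_exp]; simp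
  have h2 : ‖Complex.exp (-w * Complex.I)‖ = Real.exp w.im := by rw [Complex.norm_exp]; simp
  have := norm_sub_norm_le (Complex.exp (w * Complex.I)) (Complex.exp (-w * Complex.I))
  rw [norm_sub_rev] at this
  linarith

/-- For r ≥ 2 one of the two exponentials in the sine dominates by the factor e^{2 Im z}, so no
cancellation can hide the size of e_1. This converts integrability of the Jost integrand into
integrability of g(r)/r². -/
theorem le_norm_jostIntegrand (ν : ℝ) (c₀ : Fin 2 → ℂ) (b : Fin 2 → Fin 2 → ℂ) {z : ℂ}
    (hz : 0 < z.im) {r : ℝ} (hr : 2 ≤ r) :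
    (1 - Real.exp (-(2 * z.im))) / 2 * (|omega ν| / ‖z‖) *
      (‖jostE ν c₀ b 0 (r * z)‖ * Real.exp (r * z.im) / r ^ 2) ≤
    ‖jostIntegrand ν c₀ b z r‖ * Real.exp z.im := by
  have hz0 : z ≠ 0 := by rintro rfl; simp at hz
  have him : (z - r * z).im = -((r - 1) * z.im) := by
    rw [Complex.sub_im, Complex.im_ofReal_mul]; ring
  have hpos : 0 ≤ (r - 1) * z.im := mul_nonneg (by linarith) hz.le
  have hs := le_norm_sin (z - r * z)
  rw [him, neg_neg] at hs
  have hle : Real.exp (-((r - 1) * z.im)) ≤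
      Real.exp ((r - 1) * z.im) * Real.exp (-(2 * z.im)) := by
    rw [← Real.exp_add]
    exact Real.exp_le_exp.2 (by nlinarith)
  rw [norm_jostIntegrand ν c₀ b hz0]
  have h3 : (1 - Real.exp (-(2 * z.im))) / 2 * Real.exp ((r - 1) * z.im) ≤
      ‖Complex.sin (z - r * z)‖ := by linarith
  calc _ = |omega ν| / ‖z‖ / r ^ 2 * (((1 - Real.exp (-(2 * z.im))) / 2 *
        Real.exp ((r - 1) * z.im)) * ‖jostE ν c₀ b 0 (r * z)‖) * Real.exp z.im := by
        rw [show r * z.im = (r - 1) * z.im + z.im by ring, Real.exp_add]; ring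
    _ ≤ _ := by gcongr

theorem integrableOn_inv_sq_Ioi {a : ℝ} (ha : 0 < a) (c : ℝ) :
    IntegrableOn (fun r : ℝ => c / r ^ 2) (Set.Ioi a) := by
  have := (integrableOn_Ioi_rpow_of_lt (a := -2) (by norm_num) ha).const_mul c
  refine IntegrableOn.congr_fun this (fun r hr => ?_) measurableSet_Ioi
  have hr0 : 0 < r := ha.trans hr
  simp only [Real.rpow_neg hr0.le, div_eq_mul_inv]
  norm_num

theorem integral_inv_sq_Ioi_one (c : ℝ) : ∫ r in Set.Ioi (1 : ℝ), c / r ^ 2 = c := by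
  have := integral_Ioi_rpow_of_lt (a := -2) (by norm_num) (zero_lt_one' ℝ)
  have h2 : ∫ r in Set.Ioi (1 : ℝ), c / r ^ 2 = ∫ r in Set.Ioi (1 : ℝ), c * r ^ (-2 : ℝ) := by
    refine setIntegral_congr_fun measurableSet_Ioi fun r hr => ?_
    have hr0 : (0 : ℝ) < r := zero_lt_one.trans hr
    simp only [Real.rpow_neg hr0.le, div_eq_mul_inv]
    norm_num
  rw [h2, integral_const_mul, this]; norm_num

theorem norm_jost_sub_one_mul_exp {e z : ℂ} :
    ‖e * Complex.exp (-(Complex.I * z)) - 1‖ = ‖e - Complex.exp (Complex.I * z)‖ * Real.exp z.im := by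
  rw [← norm_exp_neg_I_mul, ← norm_mul, sub_mul, ← Complex.exp_add]; simp

theorem IsJostConnection.norm_sub_one_le {ν : ℝ} {c₀ : Fin 2 → ℂ} {b : Fin 2 → Fin 2 → ℂ}
    (h : IsJostConnection ν c₀ b) {z : ℂ} (hz : 0 < z.im) {F : ℝ → ℝ}
    (hF : IntegrableOn F (Set.Ioi 1))
    (hle : ∀ r : ℝ, 1 < r → |omega ν| / ‖z‖ / r ^ 2 *
      (‖jostE ν c₀ b 0 (r * z)‖ * Real.exp (r * z.im)) ≤ F r) :
    ‖jostE ν c₀ b 0 z * Complex.exp (-(Complex.I * z)) - 1‖ ≤ ∫ r in Set.Ioi (1 : ℝ), F r := by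
  rw [norm_jost_sub_one_mul_exp, h.eq z hz]
  simp only [sub_sub_cancel_left, norm_neg]
  rw [← le_div_iff₀ (Real.exp_pos _)]
  rw [← integral_div]
  refine norm_integral_le_of_norm_le (hF.div_const _) ?_
  refine (ae_restrict_iff' measurableSet_Ioi).2 (Eventually.of_forall fun r hr => ?_)
  rw [le_div_iff₀ (Real.exp_pos _)]
  exact (norm_jostIntegrand_le ν c₀ b hz (le_of_lt hr)).trans (hle r hr)

theorem norm_eq_of_mul_exp (e z : ℂ) :
    ‖e‖ * Real.exp z.im = ‖e * Complex.exp (-(Complex.I * z))‖ := by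
  rw [norm_mul, norm_exp_neg_I_mul]

/-- Absorption needs a finite bound to start from, while the definition of the connection constants
supplies only integrability of the integrand. That gives g(r)/r² ∈ L¹(2, ∞), and the equation at rz
then yields g(r) ≤ 1 + |ω| |z|⁻¹ ∫_r^∞ g(x) x⁻² dx. For ω = 0 the lower bound is void, but then g =
1. -/
theorem IsJostConnection.exists_bound {ν : ℝ} (h0 : 0 < ν) (hν : ∀ n : ℕ, ν ≠ n)
    {c₀ : Fin 2 → ℂ} {b : Fin 2 → Fin 2 → ℂ}
    (h : IsJostConnection ν c₀ b) {z : ℂ} (hz : 0 < z.im) :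
    ∃ M, ∀ r ∈ Set.Ici (1 : ℝ), ‖jostE ν c₀ b 0 (r * z)‖ * Real.exp (r * z.im) ≤ M := by
  have hz0 : z ≠ 0 := by rintro rfl; simp at hz
  have hzn : 0 < ‖z‖ := norm_pos_iff.2 hz0
  set g : ℝ → ℝ := fun r => ‖jostE ν c₀ b 0 (r * z)‖ * Real.exp (r * z.im) with hg
  have hg0 : ∀ r, 0 ≤ g r := fun r => by positivity
  have hcont : ContinuousOn g (Set.Ioi 0) :=
    ((jostE_isRaySol h0 hν c₀ b 0 (mem_slitPlane_of_im_pos hz)).continuousOn.norm).mul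
      (by fun_prop)
  have himr : ∀ r : ℝ, ((r : ℂ) * z).im = r * z.im := fun r => by rw [Complex.im_ofReal_mul]
  rcases eq_or_ne (omega ν) 0 with hω | hω
  · refine ⟨1, fun r hr => ?_⟩
    have hr0 : (0 : ℝ) < r := zero_lt_one.trans_le hr
    have := h.norm_sub_one_le (z := r * z) (F := fun _ => 0) (by rw [himr]; positivity)
      (integrableOn_zero) (fun s _ => by simp [hω])
    simp only [integral_zero] at this
    have h2 : jostE ν c₀ b 0 (r * z) * Complex.exp (-(Complex.I * (r * z))) = 1 :=
      sub_eq_zero.1 (norm_le_zero_iff.1 this)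
    rw [← himr, norm_eq_of_mul_exp, h2, norm_one]
  · set κ := (1 - Real.exp (-(2 * z.im))) / 2 * (|omega ν| / ‖z‖) with hκ
    have hκ0 : 0 < κ := by
      have : Real.exp (-(2 * z.im)) < 1 := by
        rw [Real.exp_lt_one_iff]; linarith
      have h1 : 0 < 1 - Real.exp (-(2 * z.im)) := by linarith
      have h2 : 0 < |omega ν| := abs_pos.2 hω
      positivity
    have hH : IntegrableOn (fun r => g r / r ^ 2) (Set.Ioi 2) := by
      have hmaj := (((h.integrable z hz).norm.mul_const (Real.exp z.im)).div_const κ)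
      have hmaj2 := IntegrableOn.mono_set hmaj (Set.Ioi_subset_Ioi (by norm_num : (1 : ℝ) ≤ 2))
      refine Integrable.mono' hmaj2 ?_ ?_
      · refine ContinuousOn.aestronglyMeasurable ?_ measurableSet_Ioi
        have hsub : Set.Ioi (2 : ℝ) ⊆ Set.Ioi 0 := Set.Ioi_subset_Ioi (by norm_num)
        exact (hcont.mono hsub).div (by fun_prop) fun r hr => pow_ne_zero 2 (hsub hr).ne'
      · refine (ae_restrict_iff' measurableSet_Ioi).2 (Eventually.of_forall fun r hr => ?_)
        rw [Real.norm_eq_abs, abs_of_nonneg (div_nonneg (hg0 r) (sq_nonneg r)), le_div_iff₀ hκ0,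
          mul_comm]
        exact le_norm_jostIntegrand ν c₀ b hz (le_of_lt hr)
    obtain ⟨M, hM⟩ := isCompact_Icc.exists_bound_of_continuousOn
      (hcont.mono (fun r (hr : r ∈ Set.Icc (1 : ℝ) 2) => zero_lt_one.trans_le hr.1))
    set I := ∫ r in Set.Ioi (2 : ℝ), g r / r ^ 2
    refine ⟨max M (1 + |omega ν| / ‖z‖ * I), fun r hr => ?_⟩
    rcases le_or_gt r 2 with h2 | h2
    · exact (le_abs_self _).trans ((hM r ⟨hr, h2⟩).trans (le_max_left _ _))
    · refine le_trans ?_ (le_max_right _ _)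
      have hr0 : 0 < r := by linarith
      have hHr : IntegrableOn (fun r => g r / r ^ 2) (Set.Ioi r) :=
        hH.mono_set (Set.Ioi_subset_Ioi h2.le)
      -- The substitution x = r s in the equation at the point rz; its Jacobian 1/r cancels the
      -- factor r below, so the resulting bound does not depend on r.
      have hscale : IntegrableOn (fun s => g (r * s) / (r * s) ^ 2) (Set.Ioi 1) := by
        have := (integrableOn_Ioi_comp_mul_left_iff (fun r => g r / r ^ 2) 1 hr0).2
          (by simpa using hHr)
        exact this
      have hbd := h.norm_sub_one_le (z := r * z)
        (F := fun s => |omega ν| / ‖z‖ * r * (g (r * s) / (r * s) ^ 2))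
        (by rw [himr]; positivity) (hscale.const_mul _) (fun s hs => le_of_eq ?_)
      · rw [integral_const_mul, integral_comp_mul_left_Ioi (fun r => g r / r ^ 2) 1 hr0, mul_one,
          smul_eq_mul] at hbd
        have hI : ∫ x in Set.Ioi r, g x / x ^ 2 ≤ I :=
          setIntegral_mono_set hH
            (Eventually.of_forall fun x => div_nonneg (hg0 x) (sq_nonneg x))
            (Set.Ioi_subset_Ioi h2.le).eventuallyLE
        have h3 : |omega ν| / ‖z‖ * r * (r⁻¹ * ∫ x in Set.Ioi r, g x / x ^ 2)
            ≤ |omega ν| / ‖z‖ * I := by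
          rw [mul_assoc, mul_inv_cancel_left₀ hr0.ne']
          gcongr
        have h4 : g r = ‖jostE ν c₀ b 0 (r * z) * Complex.exp (-(Complex.I * (r * z)))‖ := by
          rw [← norm_eq_of_mul_exp, himr]
        refine h4.trans_le ?_
        have := norm_le_norm_add_norm_sub' (jostE ν c₀ b 0 (r * z) *
          Complex.exp (-(Complex.I * (r * z)))) 1
        rw [norm_one] at this
        linarith
      · have e1 : ((s : ℂ) * ((r : ℂ) * z)) = ((r * s : ℝ) : ℂ) * z := by push_cast; ring
        have hs0 : (0 : ℝ) < s := zero_lt_one.trans hs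
        rw [himr, e1, norm_mul, Complex.norm_real, Real.norm_eq_abs, abs_of_pos hr0, hg]
        simp only
        rw [show s * (r * z.im) = r * s * z.im by ring]
        field_simp

/-- For |z| ≥ 2|ω| the kernel has total mass at most 1/2 at every point of the ray beyond z.
Absorption gives g ≤ 2, and one more use of the equation gives the rate 2|ω|/|z|. -/
theorem IsJostConnection.asymptotics {ν : ℝ} (h0 : 0 < ν) (hν : ∀ n : ℕ, ν ≠ n)
    {c₀ : Fin 2 → ℂ} {b : Fin 2 → Fin 2 → ℂ}
    (h : IsJostConnection ν c₀ b) {z : ℂ} (hz : 0 < z.im) (hzω : 2 * |omega ν| ≤ ‖z‖) :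
    ‖jostE ν c₀ b 0 z * Complex.exp (-(Complex.I * z)) - 1‖ ≤ 2 * |omega ν| / ‖z‖ := by
  have hz0 : z ≠ 0 := by rintro rfl; simp at hz
  have hzn : 0 < ‖z‖ := norm_pos_iff.2 hz0
  have himr : ∀ r : ℝ, ((r : ℂ) * z).im = r * z.im := fun r => by rw [Complex.im_ofReal_mul]
  have main : ∀ M : ℝ, (∀ r ∈ Set.Ici (1 : ℝ),
        ‖jostE ν c₀ b 0 (r * z)‖ * Real.exp (r * z.im) ≤ M * 1) →
      ∀ r ∈ Set.Ici (1 : ℝ), ‖jostE ν c₀ b 0 (r * z) * Complex.exp (-(Complex.I * (r * z))) - 1‖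
        ≤ M * |omega ν| / (r * ‖z‖) := by
    intro M hM r hr
    have hr0 : (0 : ℝ) < r := zero_lt_one.trans_le hr
    have := h.norm_sub_one_le (z := r * z) (F := fun s => (M * |omega ν| / (r * ‖z‖)) / s ^ 2)
      (by rw [himr]; positivity) (integrableOn_inv_sq_Ioi one_pos _) (fun s hs => ?_)
    · rwa [integral_inv_sq_Ioi_one] at this
    · have hs1 : (1 : ℝ) ≤ r * s := one_le_mul_of_one_le_of_one_le hr (le_of_lt hs)
      have e1 : ((s : ℂ) * ((r : ℂ) * z)) = ((r * s : ℝ) : ℂ) * z := by push_cast; ring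
      have := hM (r * s) hs1
      rw [mul_one] at this
      rw [himr, e1, norm_mul, Complex.norm_real, Real.norm_eq_abs, abs_of_pos hr0,
        show s * (r * z.im) = r * s * z.im by ring]
      calc _ ≤ |omega ν| / (r * ‖z‖) / s ^ 2 * M := by gcongr
        _ = _ := by ring
  have hbound := le_of_halving (s := Set.Ici (1 : ℝ))
    (u := fun r : ℝ => ‖jostE ν c₀ b 0 (r * z)‖ * Real.exp (r * z.im)) (W := fun _ => 1)
    zero_le_one (fun _ _ => zero_le_one)
    (by simpa using h.exists_bound h0 hν hz) (fun M hM0 hM r hr => by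
      have h1 := main M hM r hr
      have hr0 : (0 : ℝ) < r := zero_lt_one.trans_le hr
      have h2 : M * |omega ν| / (r * ‖z‖) ≤ M / 2 := by
        rw [div_le_div_iff₀ (by positivity) two_pos]
        have : 2 * |omega ν| ≤ r * ‖z‖ := hzω.trans (le_mul_of_one_le_left hzn.le hr)
        nlinarith
      have := norm_le_norm_add_norm_sub' (jostE ν c₀ b 0 (r * z) *
          Complex.exp (-(Complex.I * (r * z)))) 1
      rw [norm_one, ← norm_eq_of_mul_exp, himr] at this
      rw [mul_one]
      linarith)
  have := main (2 * 1) hbound 1 (Set.mem_Ici.2 le_rfl)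
  simpa using this

/-! ### Independence, reflection and the determinant of the connection constants. -/

theorem eq_zero_of_besselC_dependent {ν : ℝ} (h0 : 0 < ν) (hν : ∀ n : ℕ, ν ≠ n) {c₀ : Fin 2 → ℂ}
    (hc : c₀ 0 * c₀ 1 = ((2 * ν : ℝ) : ℂ)⁻¹) {z : ℂ} (hz : z ∈ Complex.slitPlane) {T : ℝ}
    (hT : 0 < T) {α β : ℂ}
    (h : ∀ r ∈ Set.Ioo 0 T,
      α * besselC ν 0 (c₀ 0) (r * z) + β * besselC ν 1 (c₀ 1) (r * z) = 0) :
    α = 0 ∧ β = 0 := by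
  have hr0 : 0 < T / 2 := by linarith
  have hmem : T / 2 ∈ Set.Ioo 0 T := ⟨hr0, by linarith⟩
  have hz0 := Complex.slitPlane_ne_zero hz
  have d0 := ((besselC_isRaySol h0 hν 0 (c₀ 0) hz) _ hr0).1.const_mul α
  have d1 := ((besselC_isRaySol h0 hν 1 (c₀ 1) hz) _ hr0).1.const_mul β
  have hzero : (fun r : ℝ =>
      α * besselC ν 0 (c₀ 0) (r * z) + β * besselC ν 1 (c₀ 1) (r * z)) =ᶠ[𝓝 (T / 2)] fun _ => 0 :=
    eventually_of_mem (isOpen_Ioo.mem_nhds hmem) h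
  have hd := (d0.add d1).unique ((hasDerivAt_const (T / 2) (0 : ℂ)).congr_of_eventuallyEq hzero)
  have he := h _ hmem
  have hw := besselC_wronskian h0 hν c₀ hc
    (Complex.slitPlane_ne_zero (ofReal_mul_mem_slitPlane hz hr0))
  set w : ℂ := ((T / 2 : ℝ) : ℂ) * z
  have hd' : α * besselC' ν 0 (c₀ 0) w + β * besselC' ν 1 (c₀ 1) w = 0 := by
    apply mul_left_cancel₀ hz0
    linear_combination hd
  constructor
  · linear_combination besselC' ν 1 (c₀ 1) w * he - besselC ν 1 (c₀ 1) w * hd' - α * hw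
  · linear_combination besselC ν 0 (c₀ 0) w * hd' - besselC' ν 0 (c₀ 0) w * he - β * hw

/-- The series is even, so only the power changes; for Im z < 0 the principal argument satisfies
arg(-z) = arg z + π without crossing the cut. -/
theorem besselC_neg (ν : ℝ) (j : Fin 2) (c : ℂ) {z : ℂ} (hz : z.im < 0) :
    besselC ν j c (-z) = Complex.exp (Real.pi * Complex.I * mu j ν) * besselC ν j c z := by
  have hz0 : z ≠ 0 := by rintro rfl; simp at hz
  rw [besselC_eq, besselC_eq, neg_sq, Complex.cpow_def_of_ne_zero (neg_ne_zero.2 hz0),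
    Complex.cpow_def_of_ne_zero hz0]
  have : Complex.log (-z) = Complex.log z + Real.pi * Complex.I := by
    rw [Complex.log, Complex.log, Complex.arg_neg_eq_arg_add_pi_of_im_neg hz, norm_neg]
    push_cast; ring
  rw [this, add_mul, Complex.exp_add]; ring

/-- The reflection e_2(z) = e_1(-z), read on the ray through -i, becomes a relation between c_1 and
c_2, whose coefficients must agree. -/
theorem IsJostConnection.coeff_one {ν : ℝ} (h0 : 0 < ν) (hν : ∀ n : ℕ, ν ≠ n) {c₀ : Fin 2 → ℂ}
    (hc : c₀ 0 * c₀ 1 = ((2 * ν : ℝ) : ℂ)⁻¹) {b : Fin 2 → Fin 2 → ℂ}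
    (h : IsJostConnection ν c₀ b) (j : Fin 2) :
    b 1 j = Complex.exp (Real.pi * Complex.I * mu j ν) * b 0 j := by
  have hI : -Complex.I ∈ Complex.slitPlane := Complex.mem_slitPlane_iff.2 (Or.inr (by simp))
  have key := eq_zero_of_besselC_dependent h0 hν hc hI one_pos
    (α := b 1 0 - Complex.exp (Real.pi * Complex.I * mu 0 ν) * b 0 0)
    (β := b 1 1 - Complex.exp (Real.pi * Complex.I * mu 1 ν) * b 0 1) (by
      intro r hr
      have him : ((r : ℂ) * -Complex.I).im < 0 := by simpa using hr.1
      have := h.refl _ him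
      simp only [jostE, Fin.sum_univ_two, besselC_neg ν _ _ him] at this
      linear_combination this)
  fin_cases j
  · exact sub_eq_zero.1 key.1
  · exact sub_eq_zero.1 key.2

/-- The integral equation holds only for Im z > 0, but the estimate is needed on the positive axis
too. Both sides are continuous on the slit plane, so the estimate passes to the limit along z + iε,
where the modulus is not smaller than |z|. -/
theorem IsJostConnection.upper {ν : ℝ} (h0 : 0 < ν) (hν : ∀ n : ℕ, ν ≠ n)
    {c₀ : Fin 2 → ℂ} {b : Fin 2 → Fin 2 → ℂ} (h : IsJostConnection ν c₀ b) {z : ℂ}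
    (hz : z ∈ Complex.slitPlane) (him : 0 ≤ z.im) (hzω : 2 * |omega ν| ≤ ‖z‖) :
    ‖jostE ν c₀ b 0 z - Complex.exp (Complex.I * z)‖ * Real.exp z.im ≤ 2 * |omega ν| / ‖z‖ := by
  have hz0 := Complex.slitPlane_ne_zero hz
  have hzn : 0 < ‖z‖ := norm_pos_iff.2 hz0
  set y : ℝ → ℂ := fun ε => z + ε * Complex.I with hy
  have hyc : Tendsto y (𝓝[>] 0) (𝓝 z) := by
    have : Continuous y := by fun_prop
    have := (this.tendsto 0).mono_left (nhdsWithin_le_nhds (s := Set.Ioi 0))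
    simpa [hy] using this
  have hcont : ContinuousAt (fun z => ‖jostE ν c₀ b 0 z - Complex.exp (Complex.I * z)‖
      * Real.exp z.im) z := by
    have h1 := (hasDerivAt_jostE h0 hν c₀ b 0 hz).continuousAt
    have h2 : ContinuousAt (fun z : ℂ => Complex.exp (Complex.I * z)) z := by fun_prop
    have h3 : ContinuousAt (fun z : ℂ => Real.exp z.im) z :=
      (Real.continuous_exp.comp Complex.continuous_im).continuousAt
    exact (h1.sub h2).norm.mul h3
  have hcont2 : ContinuousAt (fun z : ℂ => 2 * |omega ν| / ‖z‖) z :=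
    continuousAt_const.div continuous_norm.continuousAt hzn.ne'
  refine le_of_tendsto_of_tendsto (hcont.tendsto.comp hyc) (hcont2.tendsto.comp hyc) ?_
  filter_upwards [self_mem_nhdsWithin] with ε hε
  have hε0 : (0 : ℝ) < ε := hε
  have hyim : (y ε).im = z.im + ε := by simp [hy]
  have hyre : (y ε).re = z.re := by simp [hy]
  simp only [Function.comp]
  rw [← norm_jost_sub_one_mul_exp]
  refine h.asymptotics h0 hν (by rw [hyim]; linarith) (hzω.trans ?_)
  rw [Complex.norm_def, Complex.norm_def]
  apply Real.sqrt_le_sqrt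
  rw [Complex.normSq_apply, Complex.normSq_apply, hyim, hyre]
  nlinarith

/-- Mirror image of `IsJostConnection.upper`: the asymptotics of e_1 at -z, with approach along z -
iε. -/
theorem IsJostConnection.lower {ν : ℝ} (h0 : 0 < ν) (hν : ∀ n : ℕ, ν ≠ n)
    {c₀ : Fin 2 → ℂ} {b : Fin 2 → Fin 2 → ℂ} (h : IsJostConnection ν c₀ b) {z : ℂ}
    (hz : z ∈ Complex.slitPlane) (him : z.im ≤ 0) (hzω : 2 * |omega ν| ≤ ‖z‖) :
    ‖jostE ν c₀ b 1 z - Complex.exp (-(Complex.I * z))‖ * Real.exp (-z.im)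
      ≤ 2 * |omega ν| / ‖z‖ := by
  have hz0 := Complex.slitPlane_ne_zero hz
  have hzn : 0 < ‖z‖ := norm_pos_iff.2 hz0
  set y : ℝ → ℂ := fun ε => z - ε * Complex.I with hy
  have hyc : Tendsto y (𝓝[>] 0) (𝓝 z) := by
    have : Continuous y := by fun_prop
    have := (this.tendsto 0).mono_left (nhdsWithin_le_nhds (s := Set.Ioi 0))
    simpa [hy] using this
  have hcont : ContinuousAt (fun z => ‖jostE ν c₀ b 1 z - Complex.exp (-(Complex.I * z))‖
      * Real.exp (-z.im)) z := by
    have h1 := (hasDerivAt_jostE h0 hν c₀ b 1 hz).continuousAt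
    have h2 : ContinuousAt (fun z : ℂ => Complex.exp (-(Complex.I * z))) z := by fun_prop
    have h3 : ContinuousAt (fun z : ℂ => Real.exp (-z.im)) z :=
      (Real.continuous_exp.comp Complex.continuous_im.neg).continuousAt
    exact (h1.sub h2).norm.mul h3
  have hcont2 : ContinuousAt (fun z : ℂ => 2 * |omega ν| / ‖z‖) z :=
    continuousAt_const.div continuous_norm.continuousAt hzn.ne'
  refine le_of_tendsto_of_tendsto (hcont.tendsto.comp hyc) (hcont2.tendsto.comp hyc) ?_
  filter_upwards [self_mem_nhdsWithin] with ε hε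
  have hε0 : (0 : ℝ) < ε := hε
  have hyim : (y ε).im = z.im - ε := by simp [hy]
  have hyre : (y ε).re = z.re := by simp [hy]
  have hyneg : (y ε).im < 0 := by rw [hyim]; linarith
  simp only [Function.comp]
  have := h.asymptotics h0 hν (z := -y ε) (by rw [Complex.neg_im]; linarith) (hzω.trans ?_)
  · rw [norm_jost_sub_one_mul_exp, ← h.refl _ hyneg, norm_neg, Complex.neg_im, mul_neg] at this
    exact this
  · rw [norm_neg, Complex.norm_def, Complex.norm_def]
    apply Real.sqrt_le_sqrt
    rw [Complex.normSq_apply, Complex.normSq_apply, hyim, hyre]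
    nlinarith

/-- A solution asymptotic to `exp (± i r)` has the expected derivative at infinity. -/
theorem IsRaySol.tendsto_deriv {ω : ℝ} {f f' : ℝ → ℂ} (h : IsRaySol ω 1 f f') {ε : ℂ}
    (hε : ε = Complex.I ∨ ε = -Complex.I) {K R₀ : ℝ} (hR₀ : 0 < R₀)
    (hf : ∀ r, R₀ ≤ r → ‖f r - Complex.exp (ε * r)‖ ≤ K / r) :
    Tendsto (fun r : ℝ => f' r - ε * Complex.exp (ε * r)) atTop (𝓝 0) := by
  have hexp : ∀ r : ℝ, ‖Complex.exp (ε * r)‖ = 1 := by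
    intro r; rw [Complex.norm_exp]; rcases hε with rfl | rfl <;> simp
  have hshift : ∀ r : ℝ, Complex.exp (ε * (r + Real.pi / 2 : ℝ)) = ε * Complex.exp (ε * r) := by
    intro r
    push_cast
    rw [mul_add, Complex.exp_add, mul_comm]
    congr 1
    rcases hε with rfl | rfl
    · rw [mul_comm, Complex.exp_mul_I, Complex.cos_pi_div_two, Complex.sin_pi_div_two]; simp
    · rw [show -Complex.I * (Real.pi / 2 : ℂ) = (-(Real.pi / 2 : ℂ)) * Complex.I by ring,
        Complex.exp_mul_I, Complex.cos_neg, Complex.sin_neg, Complex.cos_pi_div_two,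
        Complex.sin_pi_div_two]; simp
  have hK : 0 ≤ K := by
    have := (norm_nonneg _).trans (hf R₀ le_rfl)
    by_contra! hneg
    exact absurd this (not_le.2 (div_neg_of_neg_of_pos hneg hR₀))
  have hpi := Real.pi_pos
  set L : ℝ := 1 + K / R₀
  have hL : 0 ≤ L := by positivity
  refine squeeze_zero_norm' (a := fun r : ℝ => (K + |ω| * L) / r) ?_
    (tendsto_const_nhds.div_atTop tendsto_id)
  filter_upwards [eventually_ge_atTop R₀] with r hr
  have hr0 : 0 < r := hR₀.trans_le hr
  have hr2 : r ≤ r + Real.pi / 2 := by linarith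
  -- Over a quarter period the cosine vanishes and the sine is 1, so f'(r) equals f(r + π/2) minus
  -- an integral of size O(1/r). The asymptotics of f thus determine those of f'.
  have hv := h.variation_of_constants hr0 (hr0.trans_le hr2)
  have e1 : (1 : ℂ) * (((r + Real.pi / 2 : ℝ) : ℂ) - r) = Real.pi / 2 := by push_cast; ring
  rw [e1, Complex.cos_pi_div_two, Complex.sin_pi_div_two, one_mul, mul_one, mul_zero, add_zero]
    at hv
  have hInt : ‖∫ s in r..(r + Real.pi / 2), (ω : ℂ) / (s : ℂ) ^ 2 * f s *
      Complex.sin (1 * (((r + Real.pi / 2 : ℝ) : ℂ) - s))‖ ≤ |ω| * L / r := by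
    refine le_trans (intervalIntegral.norm_integral_le_of_norm_le hr2 ?_
      (intervalIntegrable_inv_sq (|ω| * L) hr0 (hr0.trans_le hr2)))
      (integral_inv_sq_le (by positivity) hr0 hr2)
    refine Eventually.of_forall fun s hs => ?_
    have hs0 : R₀ ≤ s := hr.trans hs.1.le
    have hsin : ‖Complex.sin (1 * (((r + Real.pi / 2 : ℝ) : ℂ) - s))‖ ≤ 1 := by
      have := norm_sin_le (1 * (((r + Real.pi / 2 : ℝ) : ℂ) - s))
      rw [one_mul, ← Complex.ofReal_sub, Complex.ofReal_im, abs_zero, Real.exp_zero] at this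
      rwa [one_mul, ← Complex.ofReal_sub]
    have hfs : ‖f s‖ ≤ L := by
      have h1 := hf s hs0
      have h2 := norm_le_norm_add_norm_sub' (f s) (Complex.exp (ε * s))
      rw [hexp] at h2
      have h3 : K / s ≤ K / R₀ := by gcongr
      linarith
    rw [norm_mul, norm_mul, norm_div, norm_pow, Complex.norm_real, Complex.norm_real,
        Real.norm_eq_abs, Real.norm_eq_abs, sq_abs]
    calc |ω| / s ^ 2 * ‖f s‖ * _ ≤ |ω| / s ^ 2 * L * 1 := by gcongr
      _ = |ω| * L / s ^ 2 := by ring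
  have hf2 := hf (r + Real.pi / 2) (hr.trans hr2)
  rw [hshift] at hf2
  have hK2 : K / (r + Real.pi / 2) ≤ K / r := by gcongr
  have e2 : f' r - ε * Complex.exp (ε * r) = (f (r + Real.pi / 2) - ε * Complex.exp (ε * r))
      - ∫ s in r..(r + Real.pi / 2), (ω : ℂ) / (s : ℂ) ^ 2 * f s *
      Complex.sin (1 * (((r + Real.pi / 2 : ℝ) : ℂ) - s)) := by rw [hv]; ring
  rw [e2, add_div]
  exact (norm_sub_le _ _).trans (add_le_add (hf2.trans hK2) hInt)

theorem jostE_wronskian {ν : ℝ} (h0 : 0 < ν) (hν : ∀ n : ℕ, ν ≠ n) {c₀ : Fin 2 → ℂ}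
    (hc : c₀ 0 * c₀ 1 = ((2 * ν : ℝ) : ℂ)⁻¹) (b : Fin 2 → Fin 2 → ℂ) {z : ℂ} (hz : z ≠ 0) :
    jostE ν c₀ b 0 z * jostE' ν c₀ b 1 z - jostE' ν c₀ b 0 z * jostE ν c₀ b 1 z
      = b 0 0 * b 1 1 - b 0 1 * b 1 0 := by
  have hw := besselC_wronskian h0 hν c₀ hc hz
  simp only [jostE, jostE', Fin.sum_univ_two]
  linear_combination (b 0 0 * b 1 1 - b 0 1 * b 1 0) * hw

/-- The determinant is the constant Wronskian of e_1, e_2. On the positive axis these behave,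
together with their derivatives, like e^{ir} and e^{-ir}, whose Wronskian is -2i. -/
theorem IsJostConnection.det_eq {ν : ℝ} (h0 : 0 < ν) (hν : ∀ n : ℕ, ν ≠ n) {c₀ : Fin 2 → ℂ}
    (hc : c₀ 0 * c₀ 1 = ((2 * ν : ℝ) : ℂ)⁻¹) {b : Fin 2 → Fin 2 → ℂ}
    (h : IsJostConnection ν c₀ b) : b 0 0 * b 1 1 - b 0 1 * b 1 0 = -2 * Complex.I := by
  have h1s : (1 : ℂ) ∈ Complex.slitPlane := Complex.one_mem_slitPlane
  have hr0 := jostE_isRaySol h0 hν c₀ b 0 h1s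
  have hr1 := jostE_isRaySol h0 hν c₀ b 1 h1s
  set f0 : ℝ → ℂ := fun r => jostE ν c₀ b 0 (r * 1)
  set f1 : ℝ → ℂ := fun r => jostE ν c₀ b 1 (r * 1)
  set f0' : ℝ → ℂ := fun r => 1 * jostE' ν c₀ b 0 (r * 1)
  set f1' : ℝ → ℂ := fun r => 1 * jostE' ν c₀ b 1 (r * 1)
  set R₀ : ℝ := 1 + 2 * |omega ν|
  have hR₀ : 0 < R₀ := by positivity
  have hslit : ∀ r : ℝ, R₀ ≤ r → ((r : ℂ) * 1) ∈ Complex.slitPlane := fun r hr =>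
    ofReal_mul_mem_slitPlane h1s (hR₀.trans_le hr)
  have hnorm : ∀ r : ℝ, R₀ ≤ r → ‖(r : ℂ) * 1‖ = r := fun r hr => by
    rw [mul_one, Complex.norm_real, Real.norm_eq_abs, abs_of_pos (hR₀.trans_le hr)]
  have b0 : ∀ r : ℝ, R₀ ≤ r → ‖f0 r - Complex.exp (Complex.I * r)‖ ≤ 2 * |omega ν| / r := by
    intro r hr
    have := h.upper h0 hν (hslit r hr) (by simp)
      (by rw [hnorm r hr]; exact le_trans (by simp [R₀]) hr)
    rw [hnorm r hr] at this
    simpa [f0] using this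
  have b1 : ∀ r : ℝ, R₀ ≤ r → ‖f1 r - Complex.exp (-Complex.I * r)‖ ≤ 2 * |omega ν| / r := by
    intro r hr
    have := h.lower h0 hν (hslit r hr) (by simp)
      (by rw [hnorm r hr]; exact le_trans (by simp [R₀]) hr)
    rw [hnorm r hr] at this
    simpa [f1] using this
  have t0' := hr0.tendsto_deriv (Or.inl rfl) hR₀ b0
  have t1' := hr1.tendsto_deriv (Or.inr rfl) hR₀ b1
  have hlim0 : Tendsto (fun r : ℝ => 2 * |omega ν| / r) atTop (𝓝 0) :=
    tendsto_const_nhds.div_atTop tendsto_id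
  have t0 : Tendsto (fun r : ℝ => f0 r - Complex.exp (Complex.I * r)) atTop (𝓝 0) :=
    squeeze_zero_norm' (eventually_atTop.2 ⟨R₀, b0⟩) hlim0
  have t1 : Tendsto (fun r : ℝ => f1 r - Complex.exp (-Complex.I * r)) atTop (𝓝 0) :=
    squeeze_zero_norm' (eventually_atTop.2 ⟨R₀, b1⟩) hlim0
  have bdd : ∀ (ε : ℂ) (u : ℝ → ℂ), (ε = Complex.I ∨ ε = -Complex.I) →
      Tendsto u atTop (𝓝 0) → Tendsto (fun r : ℝ => Complex.exp (ε * r) * u r) atTop (𝓝 0) := by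
    intro ε u hε hu
    refine squeeze_zero_norm (a := fun r => ‖u r‖) (fun r => ?_) (by simpa using hu.norm)
    rw [norm_mul, Complex.norm_exp]
    rcases hε with rfl | rfl <;> simp
  -- All terms left over when each function in the Wronskian is written as its exponential plus an
  -- error; each is a bounded factor times a null one.
  have hsum := ((((bdd _ _ (Or.inl rfl) t1').sub
    ((bdd _ _ (Or.inr rfl) t0).const_mul Complex.I)).add (t0.mul t1')).sub
    ((bdd _ _ (Or.inl rfl) t1).const_mul Complex.I)).sub (bdd _ _ (Or.inr rfl) t0')
    |>.sub (t0'.mul t1)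
  simp only [mul_zero, sub_zero, add_zero] at hsum
  have hconst : ∀ᶠ r : ℝ in atTop, b 0 0 * b 1 1 - b 0 1 * b 1 0 + 2 * Complex.I =
      Complex.exp (Complex.I * r) * (f1' r - -Complex.I * Complex.exp (-Complex.I * r))
      - Complex.I * (Complex.exp (-Complex.I * r) * (f0 r - Complex.exp (Complex.I * r)))
      + (f0 r - Complex.exp (Complex.I * r)) * (f1' r - -Complex.I * Complex.exp (-Complex.I * r))
      - Complex.I * (Complex.exp (Complex.I * r) * (f1 r - Complex.exp (-Complex.I * r)))
      - Complex.exp (-Complex.I * r) * (f0' r - Complex.I * Complex.exp (Complex.I * r))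
      - (f0' r - Complex.I * Complex.exp (Complex.I * r))
        * (f1 r - Complex.exp (-Complex.I * r)) := by
    filter_upwards [eventually_ge_atTop R₀] with r hr
    have hw := jostE_wronskian h0 hν hc b (Complex.slitPlane_ne_zero (hslit r hr))
    have hE : Complex.exp (Complex.I * r) * Complex.exp (-Complex.I * r) = 1 := by
      rw [← Complex.exp_add]; simp
    have hw' : f0 r * f1' r - f0' r * f1 r = b 0 0 * b 1 1 - b 0 1 * b 1 0 := by
      rw [← hw]; simp only [f0, f1, f0', f1', one_mul]
    rw [← hw']
    linear_combination (-2 * Complex.I) * hE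
  have := tendsto_nhds_unique (hsum.congr' (hconst.mono fun r hr => hr.symm)) tendsto_const_nhds
  linear_combination -this

/-- By `IsJostConnection.coeff_one` one zero entry would annihilate a whole column, contradicting
the determinant. This permits division by β⁰_{sj} when the remainder P is formed. -/
theorem IsJostConnection.ne_zero {ν : ℝ} (h0 : 0 < ν) (hν : ∀ n : ℕ, ν ≠ n) {c₀ : Fin 2 → ℂ}
    (hc : c₀ 0 * c₀ 1 = ((2 * ν : ℝ) : ℂ)⁻¹) {b : Fin 2 → Fin 2 → ℂ}
    (h : IsJostConnection ν c₀ b) (k j : Fin 2) : b k j ≠ 0 := by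
  have hdet := h.det_eq h0 hν hc
  have h1 := h.coeff_one h0 hν hc
  have hb0 : ∀ j, b 0 j ≠ 0 := by
    intro j hj
    have : b 0 0 * b 1 1 - b 0 1 * b 1 0 = 0 := by
      rw [h1 0, h1 1]
      fin_cases j <;> simp only [Fin.zero_eta, Fin.mk_one] at hj <;> rw [hj] <;> ring
    rw [hdet] at this
    simp at this
  fin_cases k
  · exact hb0 j
  · simp only [Fin.mk_one, h1 j]
    exact mul_ne_zero (Complex.exp_ne_zero _) (hb0 j)

theorem norm_jostE_le {ν : ℝ} (h0 : 0 < ν) (hν : ∀ n : ℕ, ν ≠ n) (c₀ : Fin 2 → ℂ)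
    (b : Fin 2 → Fin 2 → ℂ) :
    ∃ C, 0 ≤ C ∧ ∀ k, ∀ z : ℂ, 0 ≤ z.re → z ≠ 0 →
      ‖jostE ν c₀ b k z‖ ≤ C * wt (mu 0 ν) ‖z‖ * Real.exp |z.im| := by
  obtain ⟨C0, hC0, h0'⟩ := norm_besselC_le h0 hν 0 (c₀ 0)
  obtain ⟨C1, hC1, h1'⟩ := norm_besselC_le h0 hν 1 (c₀ 1)
  refine ⟨(‖b 0 0‖ + ‖b 1 0‖) * C0 + (‖b 0 1‖ + ‖b 1 1‖) * C1, by positivity,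
    fun k z hre hz => ?_⟩
  have hz0 := norm_pos_iff.2 hz
  have hw : wt (mu 1 ν) ‖z‖ ≤ wt (mu 0 ν) ‖z‖ := wt_anti hz0 (by simp [mu]; linarith)
  have hb : ∀ j, ‖b k j‖ ≤ ‖b 0 j‖ + ‖b 1 j‖ := by
    intro j; fin_cases k <;> simp
  have hwp := (wt_pos (mu 0 ν) hz0).le
  rw [jostE, Fin.sum_univ_two]
  calc _ ≤ ‖b k 0‖ * ‖besselC ν 0 (c₀ 0) z‖ + ‖b k 1‖ * ‖besselC ν 1 (c₀ 1) z‖ := by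
        refine (norm_add_le _ _).trans_eq ?_
        rw [norm_mul, norm_mul]
    _ ≤ (‖b 0 0‖ + ‖b 1 0‖) * (C0 * wt (mu 0 ν) ‖z‖ * Real.exp |z.im|)
        + (‖b 0 1‖ + ‖b 1 1‖) * (C1 * wt (mu 0 ν) ‖z‖ * Real.exp |z.im|) := by
        gcongr
        · exact hb 0
        · exact h0' z hre hz
        · exact hb 1
        · exact (h1' z hre hz).trans (by gcongr)
    _ = _ := by ring

/-- In its closed quadrant the recessive solution has the decaying exponential. For large |z| this
is the asymptotic formula; in a bounded region it costs only a constant. -/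
theorem IsJostConnection.norm_recessive_le {ν : ℝ} (h0 : 0 < ν) (hν : ∀ n : ℕ, ν ≠ n)
    {c₀ : Fin 2 → ℂ} {b : Fin 2 → Fin 2 → ℂ} (h : IsJostConnection ν c₀ b) :
    ∃ C, 0 ≤ C ∧ ∀ s, ∀ z : ℂ, InSector s z → z ≠ 0 →
      ‖jostE ν c₀ b s z‖ ≤ C * wt (mu 0 ν) ‖z‖ * Real.exp (-|z.im|) := by
  obtain ⟨C, hC, hle⟩ := norm_jostE_le h0 hν c₀ b
  set R : ℝ := 1 + 2 * |omega ν|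
  have hω := abs_nonneg (omega ν)
  -- For |z| ≤ R one has e^{|Im z|} ≤ e^{2R} e^{-|Im z|}.
  set C1 := C * Real.exp (2 * R)
  set C2 : ℝ := 2 * 2 ^ |mu 0 ν|
  have hC1 : 0 ≤ C1 := by positivity
  have hC2 : 0 ≤ C2 := by positivity
  refine ⟨C1 + C2, by positivity, fun s z hs hz => ?_⟩
  have hz0 := norm_pos_iff.2 hz
  have hwp := (wt_pos (mu 0 ν) hz0).le
  rcases le_total ‖z‖ R with hR | hR
  · have h1 := hle s z hs.1 hz
    have h2 : Real.exp |z.im| ≤ Real.exp (2 * R) * Real.exp (-|z.im|) := by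
      rw [← Real.exp_add]
      apply Real.exp_le_exp.2
      have := Complex.abs_im_le_norm z
      linarith
    calc _ ≤ C * wt (mu 0 ν) ‖z‖ * (Real.exp (2 * R) * Real.exp (-|z.im|)) := by
          refine h1.trans ?_; gcongr
      _ = C1 * wt (mu 0 ν) ‖z‖ * Real.exp (-|z.im|) := by simp only [C1]; ring
      _ ≤ _ := by gcongr; linarith
  · have hslit := mem_slitPlane_of_re_nonneg hs.1 hz
    have hω' : 2 * |omega ν| ≤ ‖z‖ := le_trans (by simp [R]) hR
    have hq : 2 * |omega ν| / ‖z‖ ≤ 1 := by rw [div_le_one hz0]; exact hω'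
    have hmain : ‖jostE ν c₀ b s z‖ * Real.exp |z.im| ≤ 2 := by
      rcases Fin.exists_fin_two.1 ⟨s, rfl⟩ with hs0 | hs1
      · subst hs0
        have him : 0 ≤ z.im := by simpa using hs.2
        have h1 := h.upper h0 hν hslit him hω'
        have h2 := norm_le_norm_add_norm_sub' (jostE ν c₀ b 0 z) (Complex.exp (Complex.I * z))
        rw [norm_exp_I_mul] at h2
        rw [abs_of_nonneg him]
        have h3 : Real.exp (-z.im) * Real.exp z.im = 1 := by rw [← Real.exp_add]; simp
        have := mul_le_mul_of_nonneg_right h2 (Real.exp_pos z.im).le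
        rw [add_mul, h3] at this
        linarith
      · subst hs1
        have him : z.im ≤ 0 := by simpa using hs.2
        have h1 := h.lower h0 hν hslit him hω'
        have h2 := norm_le_norm_add_norm_sub' (jostE ν c₀ b 1 z) (Complex.exp (-(Complex.I * z)))
        rw [norm_exp_neg_I_mul] at h2
        rw [abs_of_nonpos him]
        have h3 : Real.exp z.im * Real.exp (-z.im) = 1 := by rw [← Real.exp_add]; simp
        have := mul_le_mul_of_nonneg_right h2 (Real.exp_pos (-z.im)).le
        rw [add_mul, h3] at this
        linarith
    have h1 : 1 ≤ 2 ^ |mu 0 ν| * wt (mu 0 ν) ‖z‖ := one_le_wt _ (le_trans (by simp [R]) hR)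
    have h2 : ‖jostE ν c₀ b s z‖ ≤ 2 * Real.exp (-|z.im|) := by
      rw [Real.exp_neg, ← div_eq_mul_inv, le_div_iff₀ (Real.exp_pos _)]
      exact hmain
    calc _ ≤ 2 * (2 ^ |mu 0 ν| * wt (mu 0 ν) ‖z‖) * Real.exp (-|z.im|) := by
          refine h2.trans ?_
          gcongr
          linarith
      _ = C2 * wt (mu 0 ν) ‖z‖ * Real.exp (-|z.im|) := by simp only [C2]; ring
      _ ≤ _ := by gcongr; linarith

/-! ### Hankel's integral -/

/-- The integrand of `lapI`. -/
def lapF (α β : ℝ) (v : ℂ) (u : ℝ) : ℂ :=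
  ((Real.exp (-u) * u ^ α : ℝ) : ℂ) * (1 + u * v) ^ (β : ℂ)

/-- `∫_0^∞ exp(-u) u^α (1 + u v)^β du`, for `Re v ≥ 0`. -/
def lapI (α β : ℝ) (v : ℂ) : ℂ := ∫ u in Set.Ioi (0 : ℝ), lapF α β v u

theorem one_add_mul_re {v : ℂ} (hv : 0 ≤ v.re) {u : ℝ} (hu : 0 ≤ u) :
    1 ≤ (1 + (u : ℂ) * v).re := by
  rw [Complex.add_re, Complex.one_re, Complex.re_ofReal_mul]
  have := mul_nonneg hu hv
  linarith

theorem one_add_mul_mem_slitPlane {v : ℂ} (hv : 0 ≤ v.re) {u : ℝ} (hu : 0 ≤ u) :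
    1 + (u : ℂ) * v ∈ Complex.slitPlane :=
  Complex.mem_slitPlane_iff.2 (Or.inl (zero_lt_one.trans_le (one_add_mul_re hv hu)))

/-- Half of the decay of e^{-u} is spent on the power: the growth of |1 + uv| is charged to
e^{u/(2(p+1))}, and its p-th power stays below e^{u/2}. The constant is uniform for v in a bounded
part of the right half-plane, which all later dominations use. -/
theorem exists_norm_cpow_le (β V : ℝ) :
    ∃ K, 0 ≤ K ∧ ∀ v : ℂ, 0 ≤ v.re → ‖v‖ ≤ V → ∀ u : ℝ, 0 ≤ u →
      ‖(1 + (u : ℂ) * v) ^ (β : ℂ)‖ ≤ K * Real.exp (u / 2) := by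
  set p := |β|
  have hp : 0 ≤ p := abs_nonneg β
  set A := max 1 (2 * (p + 1) * V)
  have hA : 1 ≤ A := le_max_left _ _
  refine ⟨A ^ p, by positivity, fun v hv hvV u hu => ?_⟩
  rw [Complex.norm_cpow_real]
  have h1 : 1 ≤ ‖1 + (u : ℂ) * v‖ := (one_add_mul_re hv hu).trans (Complex.re_le_norm _)
  have h2 : ‖1 + (u : ℂ) * v‖ ≤ A * Real.exp (u / (2 * (p + 1))) := by
    have h3 : ‖1 + (u : ℂ) * v‖ ≤ 1 + u * V := by
      refine (norm_add_le _ _).trans ?_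
      rw [norm_one, norm_mul, Complex.norm_real, Real.norm_eq_abs, abs_of_nonneg hu]
      gcongr
    have h4 := Real.add_one_le_exp (u / (2 * (p + 1)))
    have h5 : u * V ≤ A * (u / (2 * (p + 1))) := by
      rw [← mul_div_assoc, le_div_iff₀ (by positivity)]
      have : 2 * (p + 1) * V ≤ A := le_max_right _ _
      nlinarith
    nlinarith
  calc ‖1 + (u : ℂ) * v‖ ^ β ≤ ‖1 + (u : ℂ) * v‖ ^ p :=
        Real.rpow_le_rpow_of_exponent_le h1 (le_abs_self β)
    _ ≤ (A * Real.exp (u / (2 * (p + 1)))) ^ p := by gcongr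
    _ = A ^ p * Real.exp (u / (2 * (p + 1)) * p) := by
        rw [Real.mul_rpow (by positivity) (by positivity), ← Real.exp_mul]
    _ ≤ A ^ p * Real.exp (u / 2) := by
        gcongr
        rw [div_mul_eq_mul_div, div_le_div_iff₀ (by positivity) two_pos]
        nlinarith

theorem integrableOn_exp_half_rpow {α : ℝ} (hα : -1 < α) (K : ℝ) :
    IntegrableOn (fun u : ℝ => K * (Real.exp (-u / 2) * u ^ α)) (Set.Ioi 0) := by
  have := (integrableOn_rpow_mul_exp_neg_mul_rpow hα one_pos
    (by norm_num : (0 : ℝ) < 1 / 2)).const_mul K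
  refine IntegrableOn.congr_fun this (fun u _ => ?_) measurableSet_Ioi
  simp only [Real.rpow_one]
  rw [show -(1 / 2) * u = -u / 2 by ring]; ring

theorem exists_norm_lapF_le (α β V : ℝ) :
    ∃ K, 0 ≤ K ∧ ∀ v : ℂ, 0 ≤ v.re → ‖v‖ ≤ V → ∀ u : ℝ, 0 < u →
      ‖lapF α β v u‖ ≤ K * (Real.exp (-u / 2) * u ^ α) := by
  obtain ⟨K, hK, h⟩ := exists_norm_cpow_le β V
  refine ⟨K, hK, fun v hv hvV u hu => ?_⟩
  rw [lapF, norm_mul, Complex.norm_real, Real.norm_eq_abs, abs_of_nonneg (by positivity)]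
  calc _ ≤ Real.exp (-u) * u ^ α * (K * Real.exp (u / 2)) := by
        gcongr; exact h v hv hvV u hu.le
    _ = _ := by
        rw [show -u / 2 = -u + u / 2 by ring, Real.exp_add]; ring

theorem continuousOn_lapF (α β : ℝ) {v : ℂ} (hv : 0 ≤ v.re) :
    ContinuousOn (lapF α β v) (Set.Ioi 0) := by
  refine ContinuousOn.mul ?_ ?_
  · refine Complex.continuous_ofReal.comp_continuousOn (ContinuousOn.mul (by fun_prop) ?_)
    exact continuousOn_id.rpow_const fun u hu => Or.inl (ne_of_gt hu)
  · exact ContinuousOn.cpow_const (by fun_prop)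
      fun u hu => one_add_mul_mem_slitPlane hv (le_of_lt hu)

theorem integrableOn_lapF {α : ℝ} (hα : -1 < α) (β : ℝ) {v : ℂ} (hv : 0 ≤ v.re) :
    IntegrableOn (lapF α β v) (Set.Ioi 0) := by
  obtain ⟨K, _, h⟩ := exists_norm_lapF_le α β ‖v‖
  refine Integrable.mono' (integrableOn_exp_half_rpow hα K)
    ((continuousOn_lapF α β hv).aestronglyMeasurable measurableSet_Ioi) ?_
  exact (ae_restrict_iff' measurableSet_Ioi).2 (Eventually.of_forall fun u hu => h v hv le_rfl u hu)

theorem exists_norm_lapI_le {α : ℝ} (hα : -1 < α) (β V : ℝ) :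
    ∃ K, ∀ v : ℂ, 0 ≤ v.re → ‖v‖ ≤ V → ‖lapI α β v‖ ≤ K := by
  obtain ⟨K, _, h⟩ := exists_norm_lapF_le α β V
  refine ⟨_, fun v hv hvV => norm_integral_le_of_norm_le (integrableOn_exp_half_rpow hα K) ?_⟩
  exact (ae_restrict_iff' measurableSet_Ioi).2 (Eventually.of_forall fun u hu => h v hv hvV u hu)

/-- Differentiation under the integral. The ball of radius Re v about v lies in the right
half-plane, which is why Re v must be positive here. -/
theorem hasDerivAt_lapI {α : ℝ} (hα : -1 < α) (β : ℝ) {v : ℂ} (hv : 0 < v.re) :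
    HasDerivAt (lapI α β) (β * lapI (α + 1) (β - 1) v) v := by
  obtain ⟨K, hK, h⟩ := exists_norm_lapF_le (α + 1) (β - 1) (‖v‖ + v.re)
  have hball : ∀ y ∈ Metric.ball v v.re, 0 ≤ y.re ∧ ‖y‖ ≤ ‖v‖ + v.re := by
    intro y hy
    rw [Metric.mem_ball, dist_eq_norm] at hy
    constructor
    · have := (Complex.abs_re_le_norm (y - v)).trans_lt hy
      rw [Complex.sub_re, abs_lt] at this
      linarith [this.1]
    · have := norm_le_norm_add_norm_sub' y v
      linarith
  have key := hasDerivAt_integral_of_dominated_loc_of_deriv_le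
    (μ := volume.restrict (Set.Ioi (0 : ℝ))) (F := lapF α β) (x₀ := v)
    (F' := fun v u => β * lapF (α + 1) (β - 1) v u) (s := Metric.ball v v.re)
    (bound := fun u => |β| * (K * (Real.exp (-u / 2) * u ^ (α + 1))))
    (Metric.ball_mem_nhds v hv)
    (by
      filter_upwards [Metric.ball_mem_nhds v hv] with y hy
      exact (continuousOn_lapF α β (hball y hy).1).aestronglyMeasurable measurableSet_Ioi)
    (integrableOn_lapF hα β hv.le)
    (((continuousOn_lapF _ _ hv.le).aestronglyMeasurable measurableSet_Ioi).const_mul _)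
    ((ae_restrict_iff' measurableSet_Ioi).2 (Eventually.of_forall fun u hu y hy => by
      rw [norm_mul, Complex.norm_real, Real.norm_eq_abs]
      gcongr
      exact h y (hball y hy).1 (hball y hy).2 u hu))
    ((integrableOn_exp_half_rpow (by linarith) K).const_mul _)
    ((ae_restrict_iff' measurableSet_Ioi).2 (Eventually.of_forall fun u hu y hy => by
      have hu0 : (0 : ℝ) < u := hu
      have hl : HasDerivAt (fun y : ℂ => 1 + (u : ℂ) * y) u y := by
        simpa using ((hasDerivAt_id y).const_mul (u : ℂ)).const_add 1
      have := (hl.cpow_const (c := (β : ℂ))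
        (one_add_mul_mem_slitPlane (hball y hy).1 hu0.le)).const_mul
        ((Real.exp (-u) * u ^ α : ℝ) : ℂ)
      refine this.congr_deriv ?_
      simp only [lapF]
      rw [Real.rpow_add_one hu0.ne']
      push_cast
      ring))
  have := key.2
  rw [integral_const_mul] at this
  exact this

/-- The integral of the derivative of e^{-u} u^{α+1} (1+uv)^β vanishes: α + 1 > 0 removes the
boundary term at 0, the exponential the one at infinity. -/
theorem lapI_integration_by_parts {α : ℝ} (hα : -1 < α) (β : ℝ) {v : ℂ} (hv : 0 ≤ v.re) :
    -lapI (α + 1) β v + (α + 1) * lapI α β v + β * v * lapI (α + 1) (β - 1) v = 0 := by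
  have hα1 : 0 < α + 1 := by linarith
  obtain ⟨K, hK, hb⟩ := exists_norm_lapF_le (α + 1) β ‖v‖
  have i1 := integrableOn_lapF (α := α + 1) (by linarith) β hv
  have i2 := integrableOn_lapF hα β hv
  have i3 := integrableOn_lapF (α := α + 1) (by linarith) (β - 1) hv
  have hcont : ContinuousWithinAt (lapF (α + 1) β v) (Set.Ici 0) 0 := by
    refine ContinuousWithinAt.mul ?_ ?_
    · refine (Complex.continuous_ofReal.comp (Continuous.mul (by fun_prop)
        (Real.continuous_rpow_const hα1.le))).continuousWithinAt
    · exact ContinuousWithinAt.cpow (by fun_prop) continuousWithinAt_const (one_add_mul_mem_slitPlane hv le_rfl)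
  have hlim : Tendsto (lapF (α + 1) β v) atTop (𝓝 0) := by
    have h1 := (tendsto_rpow_mul_exp_neg_mul_atTop_nhds_zero (α + 1) (1 / 2)
      (by norm_num)).const_mul K
    rw [mul_zero] at h1
    refine squeeze_zero_norm' ?_ h1
    filter_upwards [eventually_gt_atTop 0] with u hu
    refine (hb v hv le_rfl u hu).trans_eq ?_
    rw [show -(1 / 2) * u = -u / 2 by ring]; ring
  have hder : ∀ u ∈ Set.Ioi (0 : ℝ), HasDerivAt (lapF (α + 1) β v)
      (-lapF (α + 1) β v u + (α + 1) * lapF α β v u + β * v * lapF (α + 1) (β - 1) v u) u := by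
    intro u hu
    have hu0 : (0 : ℝ) < u := hu
    have d1 : HasDerivAt (fun u : ℝ => Real.exp (-u)) (-Real.exp (-u)) u := by
      simpa using (hasDerivAt_neg u).exp
    have d2 := Real.hasDerivAt_rpow_const (x := u) (p := α + 1) (Or.inl hu0.ne')
    have d12 := (d1.mul d2).ofReal_comp
    have hl : HasDerivAt (fun u : ℝ => 1 + (u : ℂ) * v) v u := by
      simpa using ((Complex.ofRealCLM.hasDerivAt (x := u)).mul_const v).const_add 1
    have hl2 : HasDerivAt (fun y : ℂ => y ^ (β : ℂ))
        (β * (1 + (u : ℂ) * v) ^ ((β : ℂ) - 1)) (1 + (u : ℂ) * v) := by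
      simpa using (hasDerivAt_id (1 + (u : ℂ) * v)).cpow_const (c := (β : ℂ))
        (one_add_mul_mem_slitPlane hv hu0.le)
    have d3 := hl2.comp u hl
    refine (d12.mul d3).congr_deriv ?_
    simp only [lapF, Function.comp, Pi.mul_apply]
    rw [show α + 1 - 1 = α by ring]
    push_cast
    ring
  have j1 : IntegrableOn (fun u => -lapF (α + 1) β v u) (Set.Ioi 0) := i1.neg
  have j2 : IntegrableOn (fun u => (α + 1) * lapF α β v u) (Set.Ioi 0) := i2.const_mul _
  have j3 : IntegrableOn (fun u => β * v * lapF (α + 1) (β - 1) v u) (Set.Ioi 0) :=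
    i3.const_mul _
  have j12 : IntegrableOn (fun u => -lapF (α + 1) β v u + (α + 1) * lapF α β v u) (Set.Ioi 0) :=
    j1.add j2
  have hInt := j12.add j3
  have := integral_Ioi_of_hasDerivAt_of_tendsto hcont hder hInt hlim
  have e0 : lapF (α + 1) β v 0 = 0 := by simp [lapF, Real.zero_rpow hα1.ne']
  rw [e0, sub_zero] at this
  rw [integral_add j12 j3, integral_add j1 j2, integral_neg, integral_const_mul,
    integral_const_mul] at this
  exact this

theorem lapI_eq_add {α : ℝ} (hα : -1 < α) (β : ℝ) {v : ℂ} (hv : 0 ≤ v.re) :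
    lapI α β v = lapI α (β - 1) v + v * lapI (α + 1) (β - 1) v := by
  have i2 := integrableOn_lapF hα (β - 1) hv
  have i3 := integrableOn_lapF (α := α + 1) (by linarith) (β - 1) hv
  unfold lapI
  rw [← integral_const_mul, ← integral_add i2 (i3.const_mul v)]
  refine setIntegral_congr_fun measurableSet_Ioi fun u hu => ?_
  have hu0 : (0 : ℝ) < u := hu
  have hp : (1 + (u : ℂ) * v) ≠ 0 :=
    Complex.slitPlane_ne_zero (one_add_mul_mem_slitPlane hv hu0.le)
  have hpow : (1 + (u : ℂ) * v) ^ (β : ℂ)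
      = (1 + (u : ℂ) * v) ^ ((β : ℂ) - 1) * (1 + (u : ℂ) * v) := by
    rw [Complex.cpow_sub _ _ hp, Complex.cpow_one]; field_simp
  simp only [lapF]
  rw [hpow, Real.rpow_add_one hu0.ne']
  push_cast
  ring

/-- For I = `lapI a a` this is the equation v² I'' + (2v+1) I' = a(a+1) I, with derivatives
expressed as in `hasDerivAt_lapI`. It follows by eliminating between the integration by parts and
the contiguity relation (1+uv)^β = (1+uv)^{β-1} (1+uv). -/
theorem lapI_ode {a : ℝ} (ha : -1 < a) {v : ℂ} (hv : 0 ≤ v.re) :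
    v ^ 2 * (a * ((a - 1) * lapI (a + 2) (a - 2) v)) + (2 * v + 1) * (a * lapI (a + 1) (a - 1) v)
      = a * (a + 1) * lapI a a v := by
  have h1 := lapI_integration_by_parts ha (a - 1) hv
  have h2 := lapI_eq_add ha a hv
  have h3 := lapI_eq_add (α := a + 1) (by linarith) (a - 1) hv
  rw [show a - 1 - 1 = a - 2 by ring] at h1 h3
  rw [show a + 1 + 1 = a + 2 by ring] at h3
  push_cast at h1
  linear_combination (-(a : ℂ) * (a + 1)) * h2 - (a : ℂ) * h1 - (a : ℂ) * (a - 1) * v * h3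

theorem tendsto_lapI_div {α : ℝ} (hα : -1 < α) (β : ℝ) {v : ℂ} (hv : 0 ≤ v.re) :
    Tendsto (fun r : ℝ => lapI α β (v / r)) atTop (𝓝 (lapI α β 0)) := by
  obtain ⟨K, hK, hb⟩ := exists_norm_lapF_le α β ‖v‖
  have hre : ∀ r : ℝ, 1 ≤ r → 0 ≤ (v / r).re := fun r hr => by
    rw [Complex.div_ofReal_re]; exact div_nonneg hv (by linarith)
  have hvr : Tendsto (fun r : ℝ => v / (r : ℂ)) atTop (𝓝 0) := by
    rw [tendsto_zero_iff_norm_tendsto_zero]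
    refine ((tendsto_const_nhds (x := ‖v‖)).div_atTop tendsto_id).congr' ?_
    filter_upwards [eventually_ge_atTop 1] with r hr
    rw [norm_div, Complex.norm_real, Real.norm_eq_abs, abs_of_pos (by linarith), id]
  refine tendsto_integral_filter_of_dominated_convergence
    (fun u => K * (Real.exp (-u / 2) * u ^ α)) ?_ ?_ (integrableOn_exp_half_rpow hα K) ?_
  · filter_upwards [eventually_ge_atTop 1] with r hr
    exact (continuousOn_lapF α β (hre r hr)).aestronglyMeasurable measurableSet_Ioi
  · filter_upwards [eventually_ge_atTop 1] with r hr
    refine (ae_restrict_iff' measurableSet_Ioi).2 (Eventually.of_forall fun u hu => ?_)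
    refine hb _ (hre r hr) ?_ u hu
    rw [norm_div, Complex.norm_real, Real.norm_eq_abs, abs_of_pos (by linarith)]
    exact div_le_self (norm_nonneg _) hr
  · refine (ae_restrict_iff' measurableSet_Ioi).2 (Eventually.of_forall fun u hu => ?_)
    have hu0 : (0 : ℝ) < u := hu
    have hc : ContinuousAt (fun y : ℂ => lapF α β y u) 0 := by
      refine ContinuousAt.mul continuousAt_const (ContinuousAt.cpow (by fun_prop) continuousAt_const ?_)
      simp
    exact hc.tendsto.comp hvr

theorem lapI_zero {α : ℝ} (hα : -1 < α) (β : ℝ) : lapI α β 0 = (Real.Gamma (α + 1) : ℂ) := by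
  rw [Real.Gamma_eq_integral (by linarith), ← integral_complex_ofReal]
  unfold lapI lapF
  simp

/-! ### Existence of the Jost solution -/

/-- Hankel's integral for the Jost solution, up to a constant factor; `a = ν - 1 / 2`. -/
def hankel (a : ℝ) (z : ℂ) : ℂ :=
  Complex.exp (Complex.I * z) * lapI a a (Complex.I / (2 * z))

/-- The derivative of `hankel`. -/
def hankel' (a : ℝ) (z : ℂ) : ℂ :=
  Complex.I * Complex.exp (Complex.I * z) * (lapI a a (Complex.I / (2 * z))
    + 2 * (Complex.I / (2 * z)) ^ 2 * (a * lapI (a + 1) (a - 1) (Complex.I / (2 * z))))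

theorem I_div_re_pos {z : ℂ} (hz : 0 < z.im) : 0 < (Complex.I / (2 * z)).re := by
  have hz0 : z ≠ 0 := by rintro rfl; simp at hz
  rw [Complex.div_re]
  have : 0 < Complex.normSq (2 * z) := Complex.normSq_pos.2 (mul_ne_zero two_ne_zero hz0)
  simp only [Complex.I_re, zero_mul, zero_div, Complex.I_im, one_mul, zero_add]
  have h2 : (2 * z).im = 2 * z.im := by simp
  rw [h2]
  positivity

theorem hasDerivAt_I_div {z : ℂ} (hz : z ≠ 0) :
    HasDerivAt (fun z : ℂ => Complex.I / (2 * z)) (2 * Complex.I * (Complex.I / (2 * z)) ^ 2) z := by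
  have h1 : HasDerivAt (fun z : ℂ => 2 * z) 2 z := by
    simpa using (hasDerivAt_id z).const_mul (2 : ℂ)
  have h2 : HasDerivAt (fun z : ℂ => Complex.I * (2 * z)⁻¹) (Complex.I * (-2 / (2 * z) ^ 2)) z :=
    (h1.inv (mul_ne_zero two_ne_zero hz)).const_mul Complex.I
  have h3 : Complex.I * (-2 / (2 * z) ^ 2) = 2 * Complex.I * (Complex.I / (2 * z)) ^ 2 := by
    rw [div_pow, Complex.I_sq]; ring
  rw [← h3]
  exact h2

theorem hasDerivAt_exp_I_mul (z : ℂ) : HasDerivAt (fun z : ℂ => Complex.exp (Complex.I * z))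
    (Complex.I * Complex.exp (Complex.I * z)) z := by
  have h1 : HasDerivAt (fun z : ℂ => Complex.I * z) Complex.I z := by
    simpa using (hasDerivAt_id z).const_mul Complex.I
  refine h1.cexp.congr_deriv (by ring)

theorem hasDerivAt_hankel {a : ℝ} (ha : -1 < a) {z : ℂ} (hz : 0 < z.im) :
    HasDerivAt (hankel a) (hankel' a z) z := by
  have hz0 : z ≠ 0 := by rintro rfl; simp at hz
  have h1 := (hasDerivAt_lapI ha a (I_div_re_pos hz)).comp z (hasDerivAt_I_div hz0)
  refine ((hasDerivAt_exp_I_mul z).mul h1).congr_deriv ?_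
  simp only [hankel', Function.comp]
  ring

/-- The substitution v = i/(2z), for which z⁻² = -4v², turns `lapI_ode` into the unperturbed
equation; a = ν - 1/2 gives a(a+1) = ω. -/
theorem hasDerivAt_hankel' {a : ℝ} (ha : -1 < a) {z : ℂ} (hz : 0 < z.im) :
    HasDerivAt (hankel' a) (((a * (a + 1) : ℝ) / z ^ 2 - 1) * hankel a z) z := by
  have hz0 : z ≠ 0 := by rintro rfl; simp at hz
  have hv := I_div_re_pos hz
  have dv := hasDerivAt_I_div hz0
  have h1 := (hasDerivAt_lapI ha a hv).comp z dv
  have h2 := ((hasDerivAt_lapI (α := a + 1) (by linarith) (a - 1) hv).comp z dv).const_mul (a : ℂ)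
  have h3 := ((dv.pow 2).const_mul 2).mul h2
  have h4 := ((hasDerivAt_exp_I_mul z).const_mul Complex.I).mul (h1.add h3)
  have hode := lapI_ode ha hv.le
  refine h4.congr_deriv ?_
  have hzv : ((a * (a + 1) : ℝ) : ℂ) / z ^ 2 = -4 * (a * (a + 1)) * (Complex.I / (2 * z)) ^ 2 := by
    rw [div_pow, Complex.I_sq]; push_cast; field_simp; ring
  rw [hzv, show a + 2 = a + 1 + 1 by ring, show a - 2 = a - 1 - 1 by ring] at *
  simp only [hankel, Function.comp, Pi.mul_apply, Pi.add_apply, Pi.pow_apply]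
  set v := Complex.I / (2 * z)
  have hI := Complex.I_sq
  push_cast
  set E := Complex.exp (Complex.I * z)
  set J0 := lapI a a v
  set J1 := lapI (a + 1) (a - 1) v
  set J2 := lapI (a + 1 + 1) (a - 1 - 1) v
  linear_combination (-4 * v ^ 2 * E) * hode + (E * (J0 + 4 * v ^ 2 * a * J1 + 8 * v ^ 3 * a * J1
    + 4 * v ^ 4 * a * (a - 1) * J2)) * hI

theorem I_div_ofReal_mul (z : ℂ) (r : ℝ) :
    Complex.I / (2 * ((r : ℂ) * z)) = Complex.I / (2 * z) / r := by
  rw [div_div]; congr 1; ring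

theorem tendsto_hankel {a : ℝ} (ha : -1 < a) {z : ℂ} (hz : 0 < z.im) :
    Tendsto (fun r : ℝ => lapI a a (Complex.I / (2 * (r * z)))) atTop
      (𝓝 (Real.Gamma (a + 1) : ℂ)) := by
  simp only [I_div_ofReal_mul]
  rw [← lapI_zero ha a]
  exact tendsto_lapI_div ha a (I_div_re_pos hz).le

theorem tendsto_hankel' {a : ℝ} (ha : -1 < a) {z : ℂ} (hz : 0 < z.im) :
    Tendsto (fun r : ℝ => lapI a a (Complex.I / (2 * (r * z)))
      + 2 * (Complex.I / (2 * (r * z))) ^ 2 * (a * lapI (a + 1) (a - 1) (Complex.I / (2 * (r * z)))))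
      atTop (𝓝 (Real.Gamma (a + 1) : ℂ)) := by
  have h1 := tendsto_hankel ha hz
  have h2 := tendsto_lapI_div (α := a + 1) (by linarith) (a - 1) (I_div_re_pos hz).le
  have hvr : Tendsto (fun r : ℝ => Complex.I / (2 * z) / (r : ℂ)) atTop (𝓝 0) := by
    have := (Complex.continuous_ofReal.tendsto 0).comp tendsto_inv_atTop_zero
    have := this.const_mul (Complex.I / (2 * z))
    simpa [Function.comp_def, div_eq_mul_inv] using this
  have h3 := h1.add (((hvr.pow 2).const_mul 2).mul (h2.const_mul (a : ℂ)))
  simp only [I_div_ofReal_mul] at h3 ⊢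
  simpa using h3

theorem wronskian_const {U : Set ℂ} (hU : IsOpen U) (hU' : IsPreconnected U) {p : ℂ → ℂ}
    {f f' g g' : ℂ → ℂ}
    (hf : ∀ z ∈ U, HasDerivAt f (f' z) z) (hf' : ∀ z ∈ U, HasDerivAt f' (p z * f z) z)
    (hg : ∀ z ∈ U, HasDerivAt g (g' z) z) (hg' : ∀ z ∈ U, HasDerivAt g' (p z * g z) z) :
    ∃ c, ∀ z ∈ U, f z * g' z - f' z * g z = c := by
  have hd : ∀ z ∈ U, HasDerivAt (fun z => f z * g' z - f' z * g z) 0 z := fun z hz => by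
    refine (((hf z hz).mul (hg' z hz)).sub ((hf' z hz).mul (hg z hz))).congr_deriv ?_
    ring
  exact hU.exists_is_const_of_deriv_eq_zero hU'
    (fun z hz => (hd z hz).differentiableAt.differentiableWithinAt) fun z hz => (hd z hz).deriv

/-- Cramer's rule: the coefficients are the Wronskians of the Hankel function with c_2 and of c_1
with it. They are constant on the connected upper half-plane, and the Wronskian of c_1, c_2 in the
denominator is 1. -/
theorem exists_besselC_eq_hankel {ν : ℝ} (h0 : 0 < ν) (hν : ∀ n : ℕ, ν ≠ n) {c₀ : Fin 2 → ℂ}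
    (hc : c₀ 0 * c₀ 1 = ((2 * ν : ℝ) : ℂ)⁻¹) :
    ∃ β : Fin 2 → ℂ, ∀ z : ℂ, 0 < z.im →
      ∑ j : Fin 2, β j * besselC ν j (c₀ j) z = hankel (ν - 1 / 2) z := by
  have ha : -1 < ν - 1 / 2 := by linarith
  have hω : (ν - 1 / 2) * (ν - 1 / 2 + 1) = omega ν := by unfold omega; ring
  set U : Set ℂ := {z | 0 < z.im}
  have hU : IsOpen U := isOpen_lt continuous_const Complex.continuous_im
  have hU' : IsPreconnected U := (convex_halfSpace_im_gt 0).isPreconnected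
  have he := fun z (hz : z ∈ U) => hasDerivAt_hankel ha hz
  have he' := fun z (hz : z ∈ U) => hasDerivAt_hankel' ha hz
  rw [hω] at he'
  have hC := fun j z (hz : z ∈ U) => hasDerivAt_besselC h0 hν j (c₀ j) (mem_slitPlane_of_im_pos hz)
  have hC' := fun j z (hz : z ∈ U) =>
    hasDerivAt_besselC' h0 hν j (c₀ j) (mem_slitPlane_of_im_pos hz)
  obtain ⟨β0, hβ0⟩ := wronskian_const hU hU' he he' (hC 1) (hC' 1)
  obtain ⟨β1, hβ1⟩ := wronskian_const hU hU' (hC 0) (hC' 0) he he'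
  refine ⟨![β0, β1], fun z hz => ?_⟩
  have hw := besselC_wronskian h0 hν c₀ hc
    (Complex.slitPlane_ne_zero (mem_slitPlane_of_im_pos hz))
  simp only [Fin.sum_univ_two, Matrix.cons_val_zero, Matrix.cons_val_one]
  rw [← hβ0 z hz, ← hβ1 z hz]
  linear_combination hankel (ν - 1 / 2) z * hw

/-- Splits the boundary term at R into a part with e^{2iRz}, which dies as R → ∞, and a part
independent of R. -/
theorem exp_mul_sin (z : ℂ) (R : ℝ) :
    Complex.exp (Complex.I * (R * z)) * Complex.sin (z * ((1 : ℝ) - R)) =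
      (Complex.exp (2 * R * (Complex.I * z)) * Complex.exp (-(Complex.I * z))
        - Complex.exp (Complex.I * z)) * Complex.I / 2 := by
  rw [Complex.sin]
  have h1 : Complex.exp (Complex.I * (R * z)) * Complex.exp (-(z * ((1 : ℝ) - R)) * Complex.I)
      = Complex.exp (2 * R * (Complex.I * z)) * Complex.exp (-(Complex.I * z)) := by
    rw [← Complex.exp_add, ← Complex.exp_add]; congr 1; push_cast; ring
  have h2 : Complex.exp (Complex.I * (R * z)) * Complex.exp (z * ((1 : ℝ) - R) * Complex.I)
      = Complex.exp (Complex.I * z) := by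
    rw [← Complex.exp_add]; congr 1; push_cast; ring
  rw [← h1, ← h2]; ring

theorem exp_mul_cos (z : ℂ) (R : ℝ) :
    Complex.exp (Complex.I * (R * z)) * Complex.cos (z * ((1 : ℝ) - R)) =
      (Complex.exp (2 * R * (Complex.I * z)) * Complex.exp (-(Complex.I * z))
        + Complex.exp (Complex.I * z)) / 2 := by
  rw [Complex.cos]
  have h1 : Complex.exp (Complex.I * (R * z)) * Complex.exp (-(z * ((1 : ℝ) - R)) * Complex.I)
      = Complex.exp (2 * R * (Complex.I * z)) * Complex.exp (-(Complex.I * z)) := by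
    rw [← Complex.exp_add, ← Complex.exp_add]; congr 1; push_cast; ring
  have h2 : Complex.exp (Complex.I * (R * z)) * Complex.exp (z * ((1 : ℝ) - R) * Complex.I)
      = Complex.exp (Complex.I * z) := by
    rw [← Complex.exp_add]; congr 1; push_cast; ring
  rw [← h1, ← h2]; ring

theorem tendsto_exp_mul_atTop {z : ℂ} (hz : 0 < z.im) :
    Tendsto (fun R : ℝ => Complex.exp (2 * R * (Complex.I * z))) atTop (𝓝 0) := by
  rw [tendsto_zero_iff_norm_tendsto_zero]
  have : ∀ R : ℝ, ‖Complex.exp (2 * R * (Complex.I * z))‖ = Real.exp (-(2 * z.im * R)) := by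
    intro R
    rw [Complex.norm_exp]
    congr 1
    simp
    ring
  simp only [this]
  exact Real.tendsto_exp_neg_atTop_nhds_zero.comp
    (tendsto_id.const_mul_atTop (by positivity : 0 < 2 * z.im))

/-- The connection constants exist. -/
theorem exists_isJostConnection {ν : ℝ} (h0 : 0 < ν) (hν : ∀ n : ℕ, ν ≠ n) {c₀ : Fin 2 → ℂ}
    (hc : c₀ 0 * c₀ 1 = ((2 * ν : ℝ) : ℂ)⁻¹) : ∃ b, IsJostConnection ν c₀ b := by
  obtain ⟨β, hβ⟩ := exists_besselC_eq_hankel h0 hν hc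
  have ha : -1 < ν - 1 / 2 := by linarith
  have hω : (ν - 1 / 2) * (ν - 1 / 2 + 1) = omega ν := by unfold omega; ring
  set a := ν - 1 / 2 with ha_def
  set Γ : ℂ := (Real.Gamma (a + 1) : ℂ) with hΓ
  have hΓ0 : Γ ≠ 0 := by
    rw [hΓ]; exact_mod_cast (Real.Gamma_pos_of_pos (by linarith)).ne'
  -- Division by Γ(a+1) normalises e_1 so that e_1(rz) e^{-irz} → 1 as r → ∞; the second row is
  -- dictated by the reflection formula `besselC_neg`.
  set b : Fin 2 → Fin 2 → ℂ := fun k j =>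
    (if k = 0 then 1 else Complex.exp (Real.pi * Complex.I * mu j ν)) * (Γ⁻¹ * β j) with hb
  have hE : ∀ z : ℂ, 0 < z.im → jostE ν c₀ b 0 z = Γ⁻¹ * hankel a z := by
    intro z hz
    rw [← hβ z hz, jostE, Finset.mul_sum]
    exact Finset.sum_congr rfl fun j _ => by simp [hb]; ring
  have himr : ∀ (z : ℂ) (r : ℝ), ((r : ℂ) * z).im = r * z.im :=
    fun z r => by rw [Complex.im_ofReal_mul]
  have hInt : ∀ z : ℂ, 0 < z.im → IntegrableOn (jostIntegrand ν c₀ b z) (Set.Ioi 1) := by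
    intro z hz
    have hz0 : z ≠ 0 := by rintro rfl; simp at hz
    obtain ⟨K, hK⟩ := exists_norm_lapI_le ha a ‖Complex.I / (2 * z)‖
    have hcont : ContinuousOn (jostIntegrand ν c₀ b z) (Set.Ioi 1) := by
      have hsub : Set.Ioi (1 : ℝ) ⊆ Set.Ioi 0 := Set.Ioi_subset_Ioi zero_le_one
      have h1 := (jostE_isRaySol h0 hν c₀ b 0 (mem_slitPlane_of_im_pos hz)).continuousOn.mono hsub
      unfold jostIntegrand
      refine ContinuousOn.mul (ContinuousOn.mul (ContinuousOn.div (by fun_prop) (by fun_prop) ?_)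
        h1) continuousOn_const
      intro r hr
      have : (r : ℂ) ≠ 0 := by exact_mod_cast (hsub hr).ne'
      exact pow_ne_zero 2 (mul_ne_zero this hz0)
    refine Integrable.mono' (integrableOn_inv_sq_Ioi one_pos
      (|omega ν| / ‖z‖ * (‖Γ⁻¹‖ * K) / Real.exp z.im))
      (hcont.aestronglyMeasurable measurableSet_Ioi) ?_
    refine (ae_restrict_iff' measurableSet_Ioi).2 (Eventually.of_forall fun r hr => ?_)
    have hr0 : (0 : ℝ) < r := zero_lt_one.trans hr
    have h1 := norm_jostIntegrand_le ν c₀ b hz (le_of_lt hr)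
    have h2 : ‖jostE ν c₀ b 0 (r * z)‖ * Real.exp (r * z.im) ≤ ‖Γ⁻¹‖ * K := by
      have hrz : 0 < ((r : ℂ) * z).im := by rw [himr]; positivity
      rw [hE _ hrz, hankel, norm_mul, norm_mul, norm_exp_I_mul, himr]
      have h3 : ‖lapI a a (Complex.I / (2 * (r * z)))‖ ≤ K := by
        refine hK _ (I_div_re_pos hrz).le ?_
        rw [I_div_ofReal_mul, norm_div, Complex.norm_real, Real.norm_eq_abs, abs_of_pos hr0]
        exact div_le_self (norm_nonneg _) (le_of_lt hr)
      have h4 : Real.exp (-(r * z.im)) * Real.exp (r * z.im) = 1 := by rw [← Real.exp_add]; simp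
      calc _ = ‖Γ⁻¹‖ * ‖lapI a a (Complex.I / (2 * (r * z)))‖
            * (Real.exp (-(r * z.im)) * Real.exp (r * z.im)) := by ring
        _ ≤ _ := by rw [h4, mul_one]; gcongr
    rw [div_right_comm, le_div_iff₀ (Real.exp_pos _)]
    refine h1.trans ?_
    calc _ ≤ |omega ν| / ‖z‖ / r ^ 2 * (‖Γ⁻¹‖ * K) := by gcongr
      _ = _ := by ring
  refine ⟨b, hInt, fun z hz => ?_, fun z hz => ?_⟩
  · have hz0 : z ≠ 0 := by rintro rfl; simp at hz
    have hray := jostE_isRaySol h0 hν c₀ b 0 (mem_slitPlane_of_im_pos hz)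
    have hE' : ∀ z : ℂ, 0 < z.im → jostE' ν c₀ b 0 z = Γ⁻¹ * hankel' a z := by
      intro z hz
      have hU : {z : ℂ | 0 < z.im} ∈ 𝓝 z :=
        (isOpen_lt continuous_const Complex.continuous_im).mem_nhds hz
      refine (hasDerivAt_jostE h0 hν c₀ b 0 (mem_slitPlane_of_im_pos hz)).unique ?_
      exact ((hasDerivAt_hankel ha hz).const_mul Γ⁻¹).congr_of_eventuallyEq
        (eventually_of_mem hU hE)
    have hlimI := intervalIntegral_tendsto_integral_Ioi 1 (hInt z hz) tendsto_id
    -- the boundary term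
    have hE1 := tendsto_exp_mul_atTop hz
    have hs := ((hE1.mul_const (Complex.exp (-(Complex.I * z)))).sub_const
      (Complex.exp (Complex.I * z))).mul_const Complex.I |>.div_const 2
    have hcs := ((hE1.mul_const (Complex.exp (-(Complex.I * z)))).add_const
      (Complex.exp (Complex.I * z))).div_const 2
    have hW := (((tendsto_hankel' ha hz).const_mul (Complex.I * z * Γ⁻¹)).mul hs).add
      (((tendsto_hankel ha hz).const_mul (z * Γ⁻¹)).mul hcs)
    have hval : Complex.I * z * Γ⁻¹ * Γ *
        ((0 * Complex.exp (-(Complex.I * z)) - Complex.exp (Complex.I * z)) * Complex.I / 2)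
        + z * Γ⁻¹ * Γ * ((0 * Complex.exp (-(Complex.I * z)) + Complex.exp (Complex.I * z)) / 2)
        = z * Complex.exp (Complex.I * z) := by
      rw [mul_assoc (Complex.I * z), mul_assoc z, inv_mul_cancel₀ hΓ0]
      linear_combination (-z * Complex.exp (Complex.I * z) / 2) * Complex.I_sq
    rw [hval] at hW
    -- Variation of constants along the ray from R back to 1. As R → ∞ the boundary terms tend to z
    -- e^{iz}, leaving z times the Jost equation.
    have hev : ∀ᶠ R : ℝ in atTop, z * jostE ν c₀ b 0 z
        + z * ∫ r in (1 : ℝ)..R, jostIntegrand ν c₀ b z r =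
        Complex.I * z * Γ⁻¹ * (lapI a a (Complex.I / (2 * (R * z)))
      + 2 * (Complex.I / (2 * (R * z))) ^ 2 * (a * lapI (a + 1) (a - 1) (Complex.I / (2 * (R * z)))))
        * ((Complex.exp (2 * R * (Complex.I * z)) * Complex.exp (-(Complex.I * z))
        - Complex.exp (Complex.I * z)) * Complex.I / 2)
        + z * Γ⁻¹ * lapI a a (Complex.I / (2 * (R * z))) *
        ((Complex.exp (2 * R * (Complex.I * z)) * Complex.exp (-(Complex.I * z))
        + Complex.exp (Complex.I * z)) / 2) := by
      filter_upwards [eventually_ge_atTop 1] with R hR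
      have hR0 : 0 < R := by linarith
      have hRz : 0 < ((R : ℂ) * z).im := by rw [himr]; positivity
      have hv := hray.variation_of_constants hR0 one_pos
      rw [hE _ hRz, hE' _ hRz, intervalIntegral.integral_symm] at hv
      have hi : z * ∫ r in (1 : ℝ)..R, jostIntegrand ν c₀ b z r = ∫ s in (1 : ℝ)..R,
          (omega ν : ℂ) / (s : ℂ) ^ 2 * jostE ν c₀ b 0 (s * z) *
            Complex.sin (z * ((1 : ℝ) - s)) := by
        rw [← intervalIntegral.integral_const_mul]
        refine intervalIntegral.integral_congr fun s hs => ?_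
        have hs0 : (s : ℂ) ≠ 0 := by
          exact_mod_cast (uIcc_subset_Ioi_zero one_pos hR0 hs).ne'
        simp only [jostIntegrand]
        rw [show z * (((1 : ℝ) : ℂ) - s) = z - s * z by push_cast; ring]
        field_simp
      rw [hi, ← exp_mul_sin, ← exp_mul_cos]
      simp only [hankel, hankel', Complex.ofReal_one, one_mul] at hv ⊢
      linear_combination hv
    have hlim2 := (hlimI.const_mul z).const_add (z * jostE ν c₀ b 0 z)
    have := tendsto_nhds_unique (hlim2.congr' hev) hW
    apply mul_left_cancel₀ hz0
    linear_combination this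
  · simp only [jostE]
    refine Finset.sum_congr rfl fun j _ => ?_
    rw [besselC_neg ν j _ hz]
    simp [hb]
    ring

/-! ### Volterra equations with a separated kernel -/

/-- An exponential weight makes any integrable Volterra majorant have norm at most 1/2. Near the
diagonal the mass of k is at most 1/4 by uniform continuity of its primitive; at distance δ' or more
the factor e^{-τδ'} does the rest. -/
theorem exists_exp_weight {T : ℝ} (hT : 0 < T) {k : ℝ → ℝ} (hk : IntegrableOn k (Set.Ioc 0 T))
    (hk0 : ∀ t ∈ Set.Ioc 0 T, 0 ≤ k t) :
    ∃ τ : ℝ, ∀ x ∈ Set.Ioc 0 T, ∫ t in (0 : ℝ)..x, k t * Real.exp (-(τ * (x - t))) ≤ 1 / 2 := by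
  have hkT : IntervalIntegrable k volume 0 T :=
    (intervalIntegrable_iff_integrableOn_Ioc_of_le hT.le).2 hk
  have hI : ∀ a b, 0 ≤ a → a ≤ b → b ≤ T → IntervalIntegrable k volume a b := by
    intro a b h1 h2 h3
    refine hkT.mono_set ?_
    rw [Set.uIcc_of_le h2, Set.uIcc_of_le hT.le]
    exact Set.Icc_subset_Icc h1 h3
  have hnn : ∀ a b, 0 ≤ a → a ≤ b → b ≤ T → 0 ≤ ∫ t in a..b, k t := fun a b h1 h2 h3 =>
    intervalIntegral.integral_nonneg_of_ae_restrict h2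
      ((ae_restrict_iff' measurableSet_Icc).2 (by
        have : ∀ᵐ t : ℝ, t ≠ a := by simp [ae_iff, measure_singleton]
        filter_upwards [this] with t ht hm
        exact hk0 t ⟨h1.trans_lt (lt_of_le_of_ne hm.1 ht.symm), hm.2.trans h3⟩))
  have hcont : ContinuousOn (fun x => ∫ t in (0 : ℝ)..x, k t) (Set.Icc 0 T) := by
    have := intervalIntegral.continuousOn_primitive_interval (μ := volume) (f := k) (a := 0) (b := T)
      (by rw [Set.uIcc_of_le hT.le]; exact (integrableOn_Icc_iff_integrableOn_Ioc (by simp)).2 hk)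
    rwa [Set.uIcc_of_le hT.le] at this
  have huc := isCompact_Icc.uniformContinuousOn_of_continuous hcont
  rw [Metric.uniformContinuousOn_iff] at huc
  obtain ⟨δ, hδ, huc⟩ := huc (1 / 4) (by norm_num)
  set L := ∫ t in (0 : ℝ)..T, k t
  have hL : 0 ≤ L := hnn 0 T le_rfl hT.le le_rfl
  set δ' := δ / 2
  have hδ' : 0 < δ' := by positivity
  -- Then e^{-τδ'} L = L e^{-4L} ≤ 1/4, because e^{4L} ≥ 4L.
  refine ⟨4 * L / δ', fun x hx => ?_⟩
  set τ := 4 * L / δ'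
  have hτ : 0 ≤ τ := by positivity
  have hexp : Real.exp (-(τ * δ')) * L ≤ 1 / 4 := by
    have h1 : τ * δ' = 4 * L := by simp only [τ]; field_simp
    rw [h1, Real.exp_neg, inv_mul_le_iff₀ (Real.exp_pos _)]
    have := Real.add_one_le_exp (4 * L)
    linarith
  set a := max 0 (x - δ')
  have ha0 : 0 ≤ a := le_max_left _ _
  have hax : a ≤ x := max_le hx.1.le (by linarith)
  have hce : ∀ s : Set ℝ, ContinuousOn (fun t => Real.exp (-(τ * (x - t)))) s :=
    fun s => by fun_prop
  have i1 := (hI 0 a le_rfl ha0 (hax.trans hx.2)).mul_continuousOn (hce _)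
  have i2 := (hI a x ha0 hax hx.2).mul_continuousOn (hce _)
  rw [← intervalIntegral.integral_add_adjacent_intervals i1 i2]
  have b1 : ∫ t in (0 : ℝ)..a, k t * Real.exp (-(τ * (x - t))) ≤ 1 / 4 := by
    rcases le_total x δ' with h | h
    · have : a = 0 := max_eq_left (by linarith)
      rw [this, intervalIntegral.integral_same]; norm_num
    · have haeq : a = x - δ' := max_eq_right (by linarith)
      calc _ ≤ ∫ t in (0 : ℝ)..a, Real.exp (-(τ * δ')) * k t := by
            refine intervalIntegral.integral_mono_on_of_le_Ioo ha0 i1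
              ((hI 0 a le_rfl ha0 (hax.trans hx.2)).const_mul _) fun t ht => ?_
            have hkt := hk0 t ⟨ht.1, ht.2.le.trans (hax.trans hx.2)⟩
            rw [mul_comm]
            refine mul_le_mul_of_nonneg_right (Real.exp_le_exp.2 ?_) hkt
            have : δ' ≤ x - t := by have := ht.2; linarith
            nlinarith
        _ = Real.exp (-(τ * δ')) * ∫ t in (0 : ℝ)..a, k t := by
            rw [intervalIntegral.integral_const_mul]
        _ ≤ Real.exp (-(τ * δ')) * L := by
            gcongr
            have h1 := hnn a T ha0 (hax.trans hx.2) le_rfl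
            have h2 := intervalIntegral.integral_add_adjacent_intervals
              (hI 0 a le_rfl ha0 (hax.trans hx.2)) (hI a T ha0 (hax.trans hx.2) le_rfl)
            linarith
        _ ≤ 1 / 4 := hexp
  have b2 : ∫ t in a..x, k t * Real.exp (-(τ * (x - t))) ≤ 1 / 4 := by
    have hd := huc x ⟨hx.1.le, hx.2⟩ a ⟨ha0, hax.trans hx.2⟩ (by
      rw [Real.dist_eq, abs_of_nonneg (by linarith)]
      have : x - δ' ≤ a := le_max_right _ _
      simp only [δ'] at this
      linarith)
    have h2 := intervalIntegral.integral_add_adjacent_intervals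
      (hI 0 a le_rfl ha0 (hax.trans hx.2)) (hI a x ha0 hax hx.2)
    rw [← h2, Real.dist_eq, add_sub_cancel_left] at hd
    refine le_trans ?_ (le_of_lt ((le_abs_self _).trans_lt hd))
    refine intervalIntegral.integral_mono_on_of_le_Ioo hax i2 (hI a x ha0 hax hx.2) fun t ht => ?_
    have hkt := hk0 t ⟨ha0.trans_lt ht.1, ht.2.le.trans hx.2⟩
    refine mul_le_of_le_one_right hkt (Real.exp_le_one_iff.2 ?_)
    have : 0 ≤ x - t := by have := ht.2; linarith
    nlinarith
  linarith

/-- `y` is continuous on `(0, T]` and bounded by a multiple of `w`. -/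
def InWeighted (T : ℝ) (w : ℝ → ℝ) (y : ℝ → ℂ) : Prop :=
  ContinuousOn y (Set.Ioc 0 T) ∧ ∃ M, ∀ t ∈ Set.Ioc 0 T, ‖y t‖ ≤ M * w t

/-- Contraction for the quotient of y by w e^{τt} in the space of bounded continuous functions on
(0, T]. The two product kernels are integrated separately, so that continuity in x is that of
primitives, whereas the size estimate uses only their difference: the products alone need not
satisfy the majorant. -/
theorem exists_volterra_solution {ι : Type*} [Fintype ι] {T : ℝ} (hT : 0 < T)
    {g₀ g₁ : ι → ℝ → ℂ} (hg₀ : ∀ p, ContinuousOn (g₀ p) (Set.Ioc 0 T))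
    (hg₁ : ∀ p, ContinuousOn (g₁ p) (Set.Ioc 0 T)) {Q : ℝ → Matrix ι ι ℂ} {w : ℝ → ℝ}
    (hw : ContinuousOn w (Set.Ioc 0 T)) (hw0 : ∀ t ∈ Set.Ioc 0 T, 0 < w t) {k : ℝ → ℝ}
    (hk : IntegrableOn k (Set.Ioc 0 T)) (hk0 : ∀ t ∈ Set.Ioc 0 T, 0 ≤ k t)
    (hker : ∀ p x t, 0 < t → t ≤ x → x ≤ T →
      ‖g₁ p x * g₀ p t - g₀ p x * g₁ p t‖ * (∑ r, ‖Q t p r‖) * w t ≤ k t * w x)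
    (hi₀ : ∀ y : ℝ → ι → ℂ, (∀ p, InWeighted T w fun t => y t p) →
      ∀ p, IntegrableOn (fun t => g₀ p t * ∑ r, Q t p r * y t r) (Set.Ioc 0 T))
    (hi₁ : ∀ y : ℝ → ι → ℂ, (∀ p, InWeighted T w fun t => y t p) →
      ∀ p, IntegrableOn (fun t => g₁ p t * ∑ r, Q t p r * y t r) (Set.Ioc 0 T))
    {f : ℝ → ι → ℂ} (hf : ∀ p, InWeighted T w fun t => f t p) :
    ∃ y : ℝ → ι → ℂ, (∀ p, InWeighted T w fun t => y t p) ∧ ∀ x ∈ Set.Ioc 0 T, ∀ p,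
      y x p = f x p + ∫ t in (0 : ℝ)..x,
        (g₁ p x * g₀ p t - g₀ p x * g₁ p t) * ∑ r, Q t p r * y t r := by
  classical
  obtain ⟨τ, hτ⟩ := exists_exp_weight hT hk hk0
  set W : ℝ → ℝ := fun t => w t * Real.exp (τ * t) with hW
  have hW0 : ∀ t ∈ Set.Ioc 0 T, 0 < W t := fun t ht => mul_pos (hw0 t ht) (Real.exp_pos _)
  have hWc : ContinuousOn W (Set.Ioc 0 T) := hw.mul (by fun_prop)
  have hWw : ∃ K, 0 ≤ K ∧ ∀ t ∈ Set.Ioc 0 T, W t ≤ K * w t := by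
    refine ⟨Real.exp (|τ| * T), (Real.exp_pos _).le, fun t ht => ?_⟩
    simp only [hW]
    rw [mul_comm]
    refine mul_le_mul_of_nonneg_right (Real.exp_le_exp.2 ?_) (hw0 t ht).le
    exact mul_le_mul (le_abs_self _) ht.2 ht.1.le (abs_nonneg _)
  have hwW : ∃ K, 0 ≤ K ∧ ∀ t ∈ Set.Ioc 0 T, w t ≤ K * W t := by
    refine ⟨Real.exp (|τ| * T), (Real.exp_pos _).le, fun t ht => ?_⟩
    have h1 : 1 ≤ Real.exp (|τ| * T) * Real.exp (τ * t) := by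
      rw [← Real.exp_add]
      refine Real.one_le_exp ?_
      have h2 : -(|τ| * T) ≤ τ * t := by
        have := neg_abs_le (τ * t)
        rw [abs_mul, abs_of_pos ht.1] at this
        nlinarith [abs_nonneg τ, ht.2]
      linarith
    have := (hw0 t ht).le
    simp only [hW]
    nlinarith
  obtain ⟨K₁, hK₁, hWw⟩ := hWw
  obtain ⟨K₂, hK₂, hwW⟩ := hwW
  -- extension of a bounded continuous function, multiplied by the weight
  let ext : BoundedContinuousFunction (Set.Ioc (0 : ℝ) T) (ι → ℂ) → ℝ → ι → ℂ := fun z t p =>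
    if h : t ∈ Set.Ioc (0 : ℝ) T then (W t : ℂ) * z ⟨t, h⟩ p else 0
  have hext : ∀ z t (h : t ∈ Set.Ioc (0 : ℝ) T) p, ext z t p = (W t : ℂ) * z ⟨t, h⟩ p := by
    intro z t h p; simp only [ext, dif_pos h]
  have hextW : ∀ z p, InWeighted T w fun t => ext z t p := by
    intro z p
    constructor
    · rw [continuousOn_iff_continuous_domRestrict]
      have h1 : Continuous fun t : Set.Ioc (0 : ℝ) T => ((W t : ℝ) : ℂ) * z t p := by
        refine Continuous.mul ?_ ?_
        · exact Complex.continuous_ofReal.comp (continuousOn_iff_continuous_domRestrict.1 hWc)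
        · exact (continuous_apply p).comp z.continuous
      refine h1.congr fun t => ?_
      simp only [Set.domRestrict_apply]
      rw [hext z t t.2 p]
    · refine ⟨‖z‖ * K₁, fun t ht => ?_⟩
      simp only
      rw [hext z t ht p, norm_mul, Complex.norm_real, Real.norm_eq_abs, abs_of_pos (hW0 t ht),
        mul_comm]
      calc _ ≤ ‖z‖ * (K₁ * w t) := mul_le_mul
            ((norm_le_pi_norm _ p).trans (z.norm_coe_le_norm _)) (hWw t ht) (hW0 t ht).le
            (norm_nonneg _)
        _ = _ := by ring
  let op : (ℝ → ι → ℂ) → ℝ → ι → ℂ := fun y x p =>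
    g₁ p x * (∫ t in (0 : ℝ)..x, g₀ p t * ∑ r, Q t p r * y t r)
      - g₀ p x * ∫ t in (0 : ℝ)..x, g₁ p t * ∑ r, Q t p r * y t r
  have hsub : ∀ {x : ℝ}, x ∈ Set.Ioc 0 T → ∀ {F : ℝ → ℂ}, IntegrableOn F (Set.Ioc 0 T) →
      IntervalIntegrable F volume 0 x := by
    intro x hx F hF
    rw [intervalIntegrable_iff_integrableOn_Ioc_of_le hx.1.le]
    exact hF.mono_set (Set.Ioc_subset_Ioc_right hx.2)
  have hop : ∀ y : ℝ → ι → ℂ, (∀ p, InWeighted T w fun t => y t p) → ∀ x ∈ Set.Ioc 0 T, ∀ p,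
      op y x p = ∫ t in (0 : ℝ)..x,
        (g₁ p x * g₀ p t - g₀ p x * g₁ p t) * ∑ r, Q t p r * y t r := by
    intro y hy x hx p
    simp only [op]
    rw [← intervalIntegral.integral_const_mul, ← intervalIntegral.integral_const_mul,
      ← intervalIntegral.integral_sub ((hsub hx (hi₀ y hy p)).const_mul _)
        ((hsub hx (hi₁ y hy p)).const_mul _)]
    exact intervalIntegral.integral_congr fun t _ => by ring
  have hopbound : ∀ y : ℝ → ι → ℂ, (∀ p, InWeighted T w fun t => y t p) → ∀ D, 0 ≤ D →
      (∀ t ∈ Set.Ioc 0 T, ∀ p, ‖y t p‖ ≤ D * W t) →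
      ∀ x ∈ Set.Ioc 0 T, ∀ p, ‖op y x p‖ ≤ D / 2 * W x := by
    intro y hy D hD hyD x hx p
    rw [hop y hy x hx p]
    have hcex : ContinuousOn (fun t => Real.exp (-(τ * (x - t)))) (Set.uIcc 0 x) := by fun_prop
    have hik : IntervalIntegrable (fun t => k t * Real.exp (-(τ * (x - t)))) volume 0 x := by
      refine IntervalIntegrable.mul_continuousOn ?_ hcex
      rw [intervalIntegrable_iff_integrableOn_Ioc_of_le hx.1.le]
      exact hk.mono_set (Set.Ioc_subset_Ioc_right hx.2)
    refine le_trans (intervalIntegral.norm_integral_le_of_norm_le hx.1.le ?_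
      (hik.const_mul (D * W x))) ?_
    · refine Eventually.of_forall fun t ht => ?_
      have htT : t ∈ Set.Ioc 0 T := ⟨ht.1, ht.2.trans hx.2⟩
      have h1 : ‖∑ r, Q t p r * y t r‖ ≤ (∑ r, ‖Q t p r‖) * (D * W t) := by
        rw [Finset.sum_mul]
        refine norm_sum_le_of_le _ fun r _ => ?_
        rw [norm_mul]
        gcongr
        exact hyD t htT r
      rw [norm_mul]
      calc _ ≤ ‖g₁ p x * g₀ p t - g₀ p x * g₁ p t‖ * ((∑ r, ‖Q t p r‖) * (D * W t)) := by gcongr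
        _ = D * Real.exp (τ * t) *
            (‖g₁ p x * g₀ p t - g₀ p x * g₁ p t‖ * (∑ r, ‖Q t p r‖) * w t) := by
            simp only [hW]; ring
        _ ≤ D * Real.exp (τ * t) * (k t * w x) :=
            mul_le_mul_of_nonneg_left (hker p x t ht.1 ht.2 hx.2) (by positivity)
        _ = _ := by
            simp only [hW]
            rw [show τ * t = τ * x + -(τ * (x - t)) by ring, Real.exp_add]; ring
    · rw [intervalIntegral.integral_const_mul]
      have := mul_le_mul_of_nonneg_left (hτ x hx) (mul_nonneg hD (hW0 x hx).le)
      linarith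
  have hopcont : ∀ y : ℝ → ι → ℂ, (∀ p, InWeighted T w fun t => y t p) → ∀ p,
      ContinuousOn (fun x => op y x p) (Set.Ioc 0 T) := by
    intro y hy p
    have hprim : ∀ {F : ℝ → ℂ}, IntegrableOn F (Set.Ioc 0 T) →
        ContinuousOn (fun x => ∫ t in (0 : ℝ)..x, F t) (Set.Ioc 0 T) := by
      intro F hF
      have := intervalIntegral.continuousOn_primitive_interval (μ := volume) (f := F) (a := 0)
        (b := T) (by rw [Set.uIcc_of_le hT.le]; exact (integrableOn_Icc_iff_integrableOn_Ioc (by simp)).2 hF)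
      rw [Set.uIcc_of_le hT.le] at this
      exact this.mono Set.Ioc_subset_Icc_self
    exact ((hg₁ p).mul (hprim (hi₀ y hy p))).sub ((hg₀ p).mul (hprim (hi₁ y hy p)))
  have hopsub : ∀ y y' : ℝ → ι → ℂ, (∀ p, InWeighted T w fun t => y t p) →
      (∀ p, InWeighted T w fun t => y' t p) → ∀ x ∈ Set.Ioc 0 T, ∀ p,
      op y x p - op y' x p = op (fun t p => y t p - y' t p) x p := by
    intro y y' hy hy' x hx p
    simp only [op, mul_sub, Finset.sum_sub_distrib]
    rw [intervalIntegral.integral_sub (hsub hx (hi₀ y hy p)) (hsub hx (hi₀ y' hy' p)),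
      intervalIntegral.integral_sub (hsub hx (hi₁ y hy p)) (hsub hx (hi₁ y' hy' p))]
    ring
  choose hfc Mf hMf using hf
  have hMf' : ∀ t ∈ Set.Ioc 0 T, ∀ p, ‖f t p‖ ≤ (∑ p, |Mf p|) * K₂ * W t := by
    intro t ht p
    calc ‖f t p‖ ≤ Mf p * w t := hMf p t ht
      _ ≤ (∑ p, |Mf p|) * (K₂ * W t) := by
          refine mul_le_mul ?_ (hwW t ht) (hw0 t ht).le (by positivity)
          exact (le_abs_self _).trans
            (Finset.single_le_sum (fun p _ => abs_nonneg (Mf p)) (Finset.mem_univ p))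
      _ = _ := by ring
  have hextle : ∀ z, ∀ t ∈ Set.Ioc 0 T, ∀ p, ‖ext z t p‖ ≤ ‖z‖ * W t := by
    intro z t ht p
    rw [hext z t ht p, norm_mul, Complex.norm_real, Real.norm_eq_abs, abs_of_pos (hW0 t ht),
      mul_comm]
    exact mul_le_mul_of_nonneg_right ((norm_le_pi_norm _ p).trans (z.norm_coe_le_norm _))
      (hW0 t ht).le
  let Φ : BoundedContinuousFunction (Set.Ioc (0 : ℝ) T) (ι → ℂ) →
      BoundedContinuousFunction (Set.Ioc (0 : ℝ) T) (ι → ℂ) := fun z =>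
    BoundedContinuousFunction.ofNormedAddCommGroup
      (fun x p => ((W x : ℝ) : ℂ)⁻¹ * (f x p + op (ext z) x p))
      (by
        refine continuous_pi fun p => Continuous.mul ?_ ?_
        · refine Continuous.inv₀ (Complex.continuous_ofReal.comp
            (continuousOn_iff_continuous_domRestrict.1 hWc)) fun x => ?_
          exact_mod_cast (hW0 x x.2).ne'
        · exact continuousOn_iff_continuous_domRestrict.1
            ((hfc p).add (hopcont _ (hextW z) p)))
      ((∑ p, |Mf p|) * K₂ + ‖z‖ / 2)
      (by
        intro x
        refine (pi_norm_le_iff_of_nonneg (by positivity)).2 fun p => ?_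
        have hWx := hW0 x x.2
        rw [norm_mul, norm_inv, Complex.norm_real, Real.norm_eq_abs, abs_of_pos hWx,
          inv_mul_le_iff₀ hWx, mul_comm, add_mul]
        exact (norm_add_le _ _).trans (add_le_add (hMf' x x.2 p)
          (hopbound _ (hextW z) _ (norm_nonneg z) (hextle z) x x.2 p)))
  have hΦ : ∀ z (x : Set.Ioc (0 : ℝ) T) p,
      Φ z x p = ((W x : ℝ) : ℂ)⁻¹ * (f x p + op (ext z) x p) := fun _ _ _ => rfl
  have hcontr : ContractingWith (1 / 2) Φ := by
    refine ⟨by norm_num, LipschitzWith.of_dist_le_mul fun z z' => ?_⟩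
    rw [BoundedContinuousFunction.dist_le (by positivity)]
    intro x
    rw [dist_pi_le_iff (by positivity)]
    intro p
    have hWx := hW0 x x.2
    rw [hΦ, hΦ, dist_eq_norm, ← mul_sub, add_sub_add_left_eq_sub,
      hopsub _ _ (hextW z) (hextW z') x x.2 p, norm_mul, norm_inv, Complex.norm_real,
      Real.norm_eq_abs, abs_of_pos hWx, inv_mul_le_iff₀ hWx]
    have hsubext : ∀ t p, ext z t p - ext z' t p = ext (z - z') t p := by
      intro t p
      by_cases h : t ∈ Set.Ioc (0 : ℝ) T
      · rw [hext z t h, hext z' t h, hext (z - z') t h]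
        simp; ring
      · simp only [ext, dif_neg h, sub_zero]
    simp only [hsubext]
    refine (hopbound _ (hextW (z - z')) _ (norm_nonneg _) (hextle (z - z')) x x.2 p).trans_eq ?_
    rw [dist_eq_norm]
    simp; ring
  set z := ContractingWith.fixedPoint Φ hcontr
  have hz : Φ z = z := hcontr.fixedPoint_isFixedPt
  refine ⟨ext z, hextW z, fun x hx p => ?_⟩
  rw [← hop _ (hextW z) x hx p]
  have h1 := hΦ z ⟨x, hx⟩ p
  rw [hz] at h1
  have hWx : ((W x : ℝ) : ℂ) ≠ 0 := by exact_mod_cast (hW0 x hx).ne'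
  rw [hext z x hx p, h1, mul_inv_cancel_left₀ hWx]

/-! ### Weighted classes and integrability -/

theorem InWeighted.add {T : ℝ} {w : ℝ → ℝ} {y z : ℝ → ℂ} (hy : InWeighted T w y)
    (hz : InWeighted T w z) : InWeighted T w fun t => y t + z t := by
  obtain ⟨cy, M, hM⟩ := hy
  obtain ⟨cz, N, hN⟩ := hz
  refine ⟨cy.add cz, M + N, fun t ht => (norm_add_le _ _).trans ?_⟩
  rw [add_mul]
  exact add_le_add (hM t ht) (hN t ht)

theorem InWeighted.const_mul {T : ℝ} {w : ℝ → ℝ} {y : ℝ → ℂ} (hy : InWeighted T w y) (c : ℂ) :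
    InWeighted T w fun t => c * y t := by
  obtain ⟨cy, M, hM⟩ := hy
  refine ⟨continuousOn_const.mul cy, ‖c‖ * M, fun t ht => ?_⟩
  rw [norm_mul, mul_assoc]
  exact mul_le_mul_of_nonneg_left (hM t ht) (norm_nonneg _)

theorem InWeighted.mul_const {T : ℝ} {w : ℝ → ℝ} {y : ℝ → ℂ} (hy : InWeighted T w y) (c : ℂ) :
    InWeighted T w fun t => y t * c := by
  simpa only [mul_comm] using hy.const_mul c

theorem InWeighted.sum {ι : Type*} {T : ℝ} {w : ℝ → ℝ} (s : Finset ι) {y : ι → ℝ → ℂ}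
    (hy : ∀ i, InWeighted T w (y i)) : InWeighted T w fun t => ∑ i ∈ s, y i t := by
  choose cy M hM using hy
  refine ⟨continuousOn_finsetSum _ fun i _ => cy i, ∑ i ∈ s, M i, fun t ht => ?_⟩
  rw [Finset.sum_mul]
  exact norm_sum_le_of_le _ fun i _ => hM i t ht

theorem rpow_le_mul_rpow {d e t T : ℝ} (hde : d ≤ e) (ht : 0 < t) (htT : t ≤ T) :
    t ^ e ≤ T ^ (e - d) * t ^ d := by
  rw [show t ^ e = t ^ (e - d) * t ^ d by rw [← Real.rpow_add ht]; congr 1; ring]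
  gcongr

theorem InWeighted.rpow_mono {T d e : ℝ} {y : ℝ → ℂ} (hy : InWeighted T (fun t => t ^ e) y)
    (hde : d ≤ e) : InWeighted T (fun t => t ^ d) y := by
  obtain ⟨cy, M, hM⟩ := hy
  refine ⟨cy, |M| * T ^ (e - d), fun t ht => ?_⟩
  calc ‖y t‖ ≤ M * t ^ e := hM t ht
    _ ≤ |M| * (T ^ (e - d) * t ^ d) := by
        refine mul_le_mul (le_abs_self M) (rpow_le_mul_rpow hde ht.1 ht.2)
          (Real.rpow_nonneg ht.1.le _) (abs_nonneg M)
    _ = _ := by ring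

/-- The integrability condition on the potential. -/
def QIntegrable {m : ℕ} (T ν₀ : ℝ) (Q : ℝ → Matrix (Fin m) (Fin m) ℂ) : Prop :=
  ∀ p q, IntegrableOn (fun x : ℝ => ((x ^ (1 - 2 * ν₀) : ℝ) : ℂ) * Q x p q) (Set.Ioo 0 T)

/-- The weighted size of the potential. -/
def potWeight {m : ℕ} (ν₀ : ℝ) (Q : ℝ → Matrix (Fin m) (Fin m) ℂ) (t : ℝ) : ℝ :=
  t ^ (1 - 2 * ν₀) * ∑ p, ∑ r, ‖Q t p r‖

theorem QIntegrable.integrableOn_potWeight {m : ℕ} {T ν₀ : ℝ}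
    {Q : ℝ → Matrix (Fin m) (Fin m) ℂ} (hQ : QIntegrable T ν₀ Q) :
    IntegrableOn (potWeight ν₀ Q) (Set.Ioc 0 T) := by
  rw [integrableOn_Ioc_iff_integrableOn_Ioo enorm_ne_top]
  have h1 : IntegrableOn (fun t => ∑ p, ∑ r, ‖((t ^ (1 - 2 * ν₀) : ℝ) : ℂ) * Q t p r‖)
      (Set.Ioo 0 T) :=
    integrable_finsetSum _ fun p _ => integrable_finsetSum _ fun r _ => (hQ p r).norm
  refine IntegrableOn.congr_fun h1 (fun t ht => ?_) measurableSet_Ioo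
  simp only [potWeight, norm_mul, Complex.norm_real, Real.norm_eq_abs,
    abs_of_nonneg (Real.rpow_nonneg ht.1.le _), Finset.mul_sum]

theorem potWeight_nonneg {m : ℕ} (ν₀ : ℝ) (Q : ℝ → Matrix (Fin m) (Fin m) ℂ) {t : ℝ}
    (ht : 0 < t) : 0 ≤ potWeight ν₀ Q t := by
  unfold potWeight; positivity

theorem rpow_mul_row_le_potWeight {m : ℕ} (ν₀ : ℝ) (Q : ℝ → Matrix (Fin m) (Fin m) ℂ) {t : ℝ}
    (ht : 0 < t) (p : Fin m) : t ^ (1 - 2 * ν₀) * ∑ r, ‖Q t p r‖ ≤ potWeight ν₀ Q t := by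
  unfold potWeight
  refine mul_le_mul_of_nonneg_left ?_ (Real.rpow_nonneg ht.le _)
  exact Finset.single_le_sum (f := fun p => ∑ r, ‖Q t p r‖) (fun p _ => by positivity)
    (Finset.mem_univ p)

/-- Two factors of order t^{μ_{11}} have product of order t^{1-2ν_1}, exactly the weight for which Q
is integrable. -/
theorem QIntegrable.integrableOn_mul {m : ℕ} {T ν₀ : ℝ} {Q : ℝ → Matrix (Fin m) (Fin m) ℂ}
    (hQ : QIntegrable T ν₀ Q) {g y : ℝ → ℂ} (hg : InWeighted T (fun t => t ^ mu 0 ν₀) g)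
    (hy : InWeighted T (fun t => t ^ mu 0 ν₀) y) (p r : Fin m) :
    IntegrableOn (fun t => g t * (Q t p r * y t)) (Set.Ioc 0 T) := by
  obtain ⟨cg, M, hM⟩ := hg
  obtain ⟨cy, N, hN⟩ := hy
  rw [integrableOn_Ioc_iff_integrableOn_Ioo enorm_ne_top]
  have hsub : Set.Ioo 0 T ⊆ Set.Ioc 0 T := Set.Ioo_subset_Ioc_self
  set h : ℝ → ℂ := fun t => g t * y t * ((t ^ (1 - 2 * ν₀) : ℝ) : ℂ)⁻¹
  have hpos : ∀ t ∈ Set.Ioo 0 T, 0 < t ^ (1 - 2 * ν₀) := fun t ht => Real.rpow_pos_of_pos ht.1 _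
  have hc : ContinuousOn h (Set.Ioo 0 T) := by
    refine ((cg.mono hsub).mul (cy.mono hsub)).mul (ContinuousOn.inv₀ ?_ ?_)
    · exact Complex.continuous_ofReal.comp_continuousOn
        (continuousOn_id.rpow_const fun t ht => Or.inl ht.1.ne')
    · intro t ht
      exact_mod_cast (hpos t ht).ne'
  have hb : ∀ t ∈ Set.Ioo 0 T, ‖h t‖ ≤ |M| * |N| := by
    intro t ht
    have h1 := hM t (hsub ht)
    have h2 := hN t (hsub ht)
    have hd : t ^ mu 0 ν₀ * t ^ mu 0 ν₀ = t ^ (1 - 2 * ν₀) := by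
      rw [← Real.rpow_add ht.1]; congr 1; simp [mu]; ring
    have hd0 := Real.rpow_nonneg ht.1.le (mu 0 ν₀)
    simp only [h]
    rw [norm_mul, norm_mul, norm_inv, Complex.norm_real, Real.norm_eq_abs,
      abs_of_pos (hpos t ht), ← div_eq_mul_inv, div_le_iff₀ (hpos t ht), ← hd]
    calc ‖g t‖ * ‖y t‖ ≤ (|M| * t ^ mu 0 ν₀) * (|N| * t ^ mu 0 ν₀) := by
          refine mul_le_mul (h1.trans ?_) (h2.trans ?_) (norm_nonneg _) (by positivity)
          · exact mul_le_mul_of_nonneg_right (le_abs_self _) hd0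
          · exact mul_le_mul_of_nonneg_right (le_abs_self _) hd0
      _ = _ := by ring
  have key := Integrable.bdd_mul (c := |M| * |N|) (hQ p r)
    (hc.aestronglyMeasurable measurableSet_Ioo)
    ((ae_restrict_iff' measurableSet_Ioo).2 (Eventually.of_forall hb))
  refine IntegrableOn.congr_fun key (fun t ht => ?_) measurableSet_Ioo
  have : ((t ^ (1 - 2 * ν₀) : ℝ) : ℂ) ≠ 0 := by exact_mod_cast (hpos t ht).ne'
  simp only [h]
  field_simp

theorem QIntegrable.integrableOn_mul_sum {m : ℕ} {T ν₀ : ℝ} {Q : ℝ → Matrix (Fin m) (Fin m) ℂ}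
    (hQ : QIntegrable T ν₀ Q) {g : ℝ → ℂ} (hg : InWeighted T (fun t => t ^ mu 0 ν₀) g)
    {y : ℝ → Fin m → ℂ} (hy : ∀ r, InWeighted T (fun t => t ^ mu 0 ν₀) fun t => y t r)
    (p : Fin m) :
    IntegrableOn (fun t => g t * ∑ r, Q t p r * y t r) (Set.Ioc 0 T) := by
  simp only [Finset.mul_sum]
  exact integrable_finsetSum _ fun r _ => hQ.integrableOn_mul hg (hy r) p r

/-! ### Existence of the Bessel-type solutions -/

theorem besselCLam_inWeighted {ν : ℝ} (h0 : 0 < ν) (hν : ∀ n : ℕ, ν ≠ n) (j : Fin 2) (c lam : ℂ)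
    (T : ℝ) : InWeighted T (fun t => t ^ mu j ν) fun t => besselCLam ν j c t lam := by
  have hc : Continuous fun t : ℝ => besselPhi ν j c (lam * (t : ℂ) ^ 2) :=
    (continuous_besselPhi h0 hν j c).comp (by fun_prop)
  obtain ⟨M, hM⟩ := isCompact_Icc.exists_bound_of_continuousOn (s := Set.Icc 0 T) hc.continuousOn
  simp only [besselCLam_eq]
  refine ⟨ContinuousOn.mul ?_ hc.continuousOn, M, fun t ht => ?_⟩
  · exact Complex.continuous_ofReal.comp_continuousOn
      (continuousOn_id.rpow_const fun t ht => Or.inl ht.1.ne')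
  · have := Real.rpow_nonneg ht.1.le (mu j ν)
    rw [norm_mul, Complex.norm_real, Real.norm_eq_abs, abs_of_nonneg this, mul_comm]
    exact mul_le_mul_of_nonneg_right (hM t ⟨ht.1.le, ht.2⟩) this

theorem mu_ge {ν ν₀ : ℝ} (h0 : 0 < ν) (h : ν ≤ ν₀) (j : Fin 2) : mu 0 ν₀ ≤ mu j ν := by
  unfold mu; split_ifs <;> simp at * <;> linarith

/-- After x^μ is factored out, the kernel is t (x/t)^{1/2+ν-μ}. As 1 ≤ x/t ≤ T/t, the exponent may
be raised to b; for b = 2ν_1 the remaining power of t is the weight of Q. -/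
theorem bessel_kernel_rpow_le {ν μ b t x T : ℝ} (hb : 0 ≤ b) (hμ : 1 / 2 + ν - μ ≤ b) (ht : 0 < t)
    (htx : t ≤ x) (hxT : x ≤ T) :
    x ^ (1 / 2 + ν) * t ^ (1 / 2 - ν) * t ^ μ ≤ T ^ b * t ^ (1 - b) * x ^ μ := by
  have hx : 0 < x := ht.trans_le htx
  have hT : 0 < T := hx.trans_le hxT
  have h1 : x ^ (1 / 2 + ν) * t ^ (1 / 2 - ν) * t ^ μ
      = (x / t) ^ (1 / 2 + ν - μ) * t * x ^ μ := by
    rw [Real.div_rpow hx.le ht.le, mul_assoc, ← Real.rpow_add ht,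
      show x ^ (1 / 2 + ν) = x ^ (1 / 2 + ν - μ) * x ^ μ by
        rw [← Real.rpow_add hx]; congr 1; ring,
      show t ^ (1 / 2 - ν + μ) = t / t ^ (1 / 2 + ν - μ) by
        nth_rw 2 [← Real.rpow_one t]
        rw [← Real.rpow_sub ht]; congr 1; ring]
    ring
  have h2 : T ^ b * t ^ (1 - b) = (T / t) ^ b * t := by
    rw [Real.div_rpow hT.le ht.le, Real.rpow_sub ht, Real.rpow_one]; ring
  rw [h1, h2]
  have h3 : (x / t) ^ (1 / 2 + ν - μ) ≤ (T / t) ^ b :=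
    (Real.rpow_le_rpow_of_exponent_le ((one_le_div ht).2 htx) hμ).trans
      (Real.rpow_le_rpow (by positivity) (by gcongr) hb)
  gcongr

/-- For t ≤ x the product with the larger exponent at x dominates the other one. -/
theorem besselCLam_kernel_le {ν : ℝ} (h0 : 0 < ν) (hν : ∀ n : ℕ, ν ≠ n) (c₀ : Fin 2 → ℂ)
    (lam : ℂ) (T : ℝ) : ∃ K, 0 ≤ K ∧ ∀ x t, 0 < t → t ≤ x → x ≤ T →
      ‖besselCLam ν 1 (c₀ 1) x lam * besselCLam ν 0 (c₀ 0) t lam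
        - besselCLam ν 0 (c₀ 0) x lam * besselCLam ν 1 (c₀ 1) t lam‖
      ≤ K * (x ^ (1 / 2 + ν) * t ^ (1 / 2 - ν)) := by
  obtain ⟨-, M₀, hM₀⟩ := besselCLam_inWeighted h0 hν 0 (c₀ 0) lam T
  obtain ⟨-, M₁, hM₁⟩ := besselCLam_inWeighted h0 hν 1 (c₀ 1) lam T
  have e0 : mu 0 ν = 1 / 2 - ν := by simp [mu]
  have e1 : mu 1 ν = 1 / 2 + ν := by simp [mu]
  simp only [e0, e1] at hM₀ hM₁
  refine ⟨2 * (|M₀| * |M₁|), by positivity, fun x t ht htx hxT => ?_⟩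
  have hx : 0 < x := ht.trans_le htx
  have b0 : ∀ s, 0 < s → s ≤ T → ‖besselCLam ν 0 (c₀ 0) s lam‖ ≤ |M₀| * s ^ (1 / 2 - ν) :=
    fun s h1 h2 => (hM₀ s ⟨h1, h2⟩).trans
      (mul_le_mul_of_nonneg_right (le_abs_self _) (Real.rpow_nonneg h1.le _))
  have b1 : ∀ s, 0 < s → s ≤ T → ‖besselCLam ν 1 (c₀ 1) s lam‖ ≤ |M₁| * s ^ (1 / 2 + ν) :=
    fun s h1 h2 => (hM₁ s ⟨h1, h2⟩).trans
      (mul_le_mul_of_nonneg_right (le_abs_self _) (Real.rpow_nonneg h1.le _))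
  have hsw : x ^ (1 / 2 - ν) * t ^ (1 / 2 + ν) ≤ x ^ (1 / 2 + ν) * t ^ (1 / 2 - ν) := by
    have hx2 : x ^ (1 / 2 + ν) = x ^ (1 / 2 - ν) * x ^ (2 * ν) := by
      rw [← Real.rpow_add hx]; congr 1; ring
    have ht2 : t ^ (1 / 2 + ν) = t ^ (1 / 2 - ν) * t ^ (2 * ν) := by
      rw [← Real.rpow_add ht]; congr 1; ring
    rw [hx2, ht2]
    have : t ^ (2 * ν) ≤ x ^ (2 * ν) := by gcongr
    calc _ = x ^ (1 / 2 - ν) * t ^ (1 / 2 - ν) * t ^ (2 * ν) := by ring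
      _ ≤ x ^ (1 / 2 - ν) * t ^ (1 / 2 - ν) * x ^ (2 * ν) := by gcongr
      _ = _ := by ring
  have htT := htx.trans hxT
  calc _ ≤ (|M₁| * x ^ (1 / 2 + ν)) * (|M₀| * t ^ (1 / 2 - ν))
        + (|M₀| * x ^ (1 / 2 - ν)) * (|M₁| * t ^ (1 / 2 + ν)) := by
        refine (norm_sub_le _ _).trans ?_
        rw [norm_mul, norm_mul]
        gcongr
        · exact b1 x hx hxT
        · exact b0 t ht htT
        · exact b0 x hx hxT
        · exact b1 t ht htT
    _ = |M₀| * |M₁| * (x ^ (1 / 2 + ν) * t ^ (1 / 2 - ν))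
        + |M₀| * |M₁| * (x ^ (1 / 2 - ν) * t ^ (1 / 2 + ν)) := by ring
    _ ≤ |M₀| * |M₁| * (x ^ (1 / 2 + ν) * t ^ (1 / 2 - ν))
        + |M₀| * |M₁| * (x ^ (1 / 2 + ν) * t ^ (1 / 2 - ν)) := by gcongr
    _ = _ := by ring

theorem GMat_mul_apply {m : ℕ} (ν : Fin m → ℝ) (c₀ : Fin 2 → Fin m → ℂ) (x t : ℝ) (lam : ℂ)
    (A Y : Matrix (Fin m) (Fin m) ℂ) (p q : Fin m) :
    (GMat ν c₀ x t lam * A * Y) p q =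
      (besselCLam (ν p) 1 (c₀ 1 p) x lam * besselCLam (ν p) 0 (c₀ 0 p) t lam
        - besselCLam (ν p) 0 (c₀ 0 p) x lam * besselCLam (ν p) 1 (c₀ 1 p) t lam)
      * ∑ r, A p r * Y r q := by
  have : GMat ν c₀ x t lam = Matrix.diagonal fun p =>
      besselCLam (ν p) 1 (c₀ 1 p) x lam * besselCLam (ν p) 0 (c₀ 0 p) t lam
        - besselCLam (ν p) 0 (c₀ 0 p) x lam * besselCLam (ν p) 1 (c₀ 1 p) t lam := by
    simp only [GMat, CMat, Matrix.diagonal_mul_diagonal, Matrix.diagonal_sub]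
  rw [this, Matrix.mul_assoc, Matrix.diagonal_mul, Matrix.mul_apply]

/-- Each column is a separate Volterra problem, because the prescribed order x^{μ_{jq}} depends on
the column. -/
theorem exists_isBesselType {m : ℕ} [NeZero m] {T : ℝ} (hT : 0 < T) {ν : Fin m → ℝ}
    (hν_anti : Antitone ν) (hν_pos : ∀ q, 0 < ν q) (hν_nat : ∀ q, ∀ n : ℕ, ν q ≠ n)
    {Q : ℝ → Matrix (Fin m) (Fin m) ℂ} (hQ : QIntegrable T (ν 0) Q) (c₀ : Fin 2 → Fin m → ℂ)
    (j : Fin 2) (lam : ℂ) : ∃ S, IsBesselType T ν Q c₀ j lam S := by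
  have hν0 : ∀ p, ν p ≤ ν 0 := fun p => hν_anti (Fin.zero_le p)
  choose K hK0 hK using fun p =>
    besselCLam_kernel_le (hν_pos p) (hν_nat p) (fun j => c₀ j p) lam T
  have hgw : ∀ i p, InWeighted T (fun t => t ^ mu i (ν p))
      fun t => besselCLam (ν p) i (c₀ i p) t lam :=
    fun i p => besselCLam_inWeighted (hν_pos p) (hν_nat p) i (c₀ i p) lam T
  have hcol : ∀ q, ∃ y : ℝ → Fin m → ℂ,
      (∀ p, InWeighted T (fun t => t ^ mu j (ν q)) fun t => y t p) ∧ ∀ x ∈ Set.Ioc 0 T, ∀ p,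
      y x p = CMat ν c₀ j x lam p q + ∫ t in (0 : ℝ)..x,
        (besselCLam (ν p) 1 (c₀ 1 p) x lam * besselCLam (ν p) 0 (c₀ 0 p) t lam
        - besselCLam (ν p) 0 (c₀ 0 p) x lam * besselCLam (ν p) 1 (c₀ 1 p) t lam)
          * ∑ r, Q t p r * y t r := by
    intro q
    have hInt : ∀ i, ∀ y : ℝ → Fin m → ℂ,
        (∀ p, InWeighted T (fun t => t ^ mu j (ν q)) fun t => y t p) → ∀ p,
        IntegrableOn (fun t => besselCLam (ν p) i (c₀ i p) t lam * ∑ r, Q t p r * y t r)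
          (Set.Ioc 0 T) := fun i y hy p =>
      hQ.integrableOn_mul_sum ((hgw i p).rpow_mono (mu_ge (hν_pos p) (hν0 p) i))
        (fun r => (hy r).rpow_mono (mu_ge (hν_pos q) (hν0 q) j)) p
    refine exists_volterra_solution hT
      (g₀ := fun p t => besselCLam (ν p) 0 (c₀ 0 p) t lam)
      (g₁ := fun p t => besselCLam (ν p) 1 (c₀ 1 p) t lam)
      (f := fun x p => CMat ν c₀ j x lam p q)
      (w := fun t => t ^ mu j (ν q))
      -- The exponent b = 2ν_1 serves all rows and columns, since 1/2 + ν_p - μ_{jq} ≤ ν_p + ν_1 ≤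
      -- 2ν_1.
      (k := fun t => (∑ p, K p) * T ^ (2 * ν 0) * potWeight (ν 0) Q t)
      (fun p => (hgw 0 p).1) (fun p => (hgw 1 p).1)
      (continuousOn_id.rpow_const fun t ht => Or.inl ht.1.ne')
      (fun t ht => Real.rpow_pos_of_pos ht.1 _)
      (hQ.integrableOn_potWeight.const_mul _)
      (fun t ht => ?_) (fun p x t ht htx hxT => ?_) (hInt 0) (hInt 1) (fun p => ?_)
    · have := potWeight_nonneg (ν 0) Q ht.1
      have := Finset.sum_nonneg fun p (_ : p ∈ Finset.univ) => hK0 p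
      positivity
    · have hx : 0 < x := ht.trans_le htx
      have h1 := hK p x t ht htx hxT
      have hKp : K p ≤ ∑ p, K p :=
        Finset.single_le_sum (fun p _ => hK0 p) (Finset.mem_univ p)
      have hS0 := (hK0 p).trans hKp
      have h2 := bessel_kernel_rpow_le (ν := ν p) (μ := mu j (ν q)) (b := 2 * ν 0)
        (by have := hν_pos 0; linarith)
        (by
          have := mu_ge (hν_pos q) (hν0 q) j
          have h3 := hν0 p
          simp only [mu, if_true] at this
          unfold mu
          linarith) ht htx hxT
      have h3 := rpow_mul_row_le_potWeight (ν 0) Q ht p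
      have hw := Real.rpow_nonneg ht.le (mu j (ν q))
      have hxw := Real.rpow_nonneg hx.le (mu j (ν q))
      have hTb := Real.rpow_nonneg (hx.le.trans hxT) (2 * ν 0)
      calc _ ≤ (∑ p, K p) * (x ^ (1 / 2 + ν p) * t ^ (1 / 2 - ν p)) * (∑ r, ‖Q t p r‖)
            * t ^ mu j (ν q) := by
            gcongr
            exact h1.trans (by gcongr)
        _ = (∑ p, K p) * (∑ r, ‖Q t p r‖)
            * (x ^ (1 / 2 + ν p) * t ^ (1 / 2 - ν p) * t ^ mu j (ν q)) := by ring
        _ ≤ (∑ p, K p) * (∑ r, ‖Q t p r‖)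
            * (T ^ (2 * ν 0) * t ^ (1 - 2 * ν 0) * x ^ mu j (ν q)) := by gcongr
        _ = (∑ p, K p) * T ^ (2 * ν 0) * (t ^ (1 - 2 * ν 0) * (∑ r, ‖Q t p r‖))
            * x ^ mu j (ν q) := by ring
        _ ≤ _ := by gcongr
    · by_cases hpq : p = q
      · subst hpq
        simpa [CMat] using hgw j p
      · simp only [CMat, Matrix.diagonal_apply_ne _ hpq]
        exact ⟨continuousOn_const, 0, fun t _ => by simp⟩
  choose y hyw hye using hcol
  refine ⟨fun x => Matrix.of fun p q => y q x p, ?_, ?_, ?_⟩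
  · exact continuousOn_pi.2 fun p => continuousOn_pi.2 fun q => (hyw q p).1
  · choose cy M hM using hyw
    refine ⟨∑ q, ∑ p, |M q p|, fun x hx p q => ?_⟩
    refine (hM q p x hx).trans
      (mul_le_mul_of_nonneg_right ?_ (Real.rpow_nonneg hx.1.le _))
    refine (le_abs_self _).trans ?_
    refine (Finset.single_le_sum (f := fun p => |M q p|) (fun _ _ => abs_nonneg _)
      (Finset.mem_univ p)).trans ?_
    exact Finset.single_le_sum (f := fun q => ∑ p, |M q p|) (fun _ _ => by positivity)
      (Finset.mem_univ q)
  · intro x hx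
    ext p q
    simp only [Matrix.add_apply, matInt, Matrix.of_apply, GMat_mul_apply]
    exact hye q x hx p

/-! ### The integral operators of the theorem, entry by entry -/

/-- The standing assumptions on the equation and its unperturbed solutions. -/
structure Setting {m : ℕ} [NeZero m] (T : ℝ) (ν : Fin m → ℝ) (Q : ℝ → Matrix (Fin m) (Fin m) ℂ)
    (c₀ : Fin 2 → Fin m → ℂ) (b : Fin 2 → Fin 2 → Fin m → ℂ) : Prop where
  T_pos : 0 < T
  anti : Antitone ν
  pos : ∀ q, 0 < ν q
  nat : ∀ q, ∀ n : ℕ, ν q ≠ n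
  integrable : QIntegrable T (ν 0) Q
  coeff : ∀ q, c₀ 0 q * c₀ 1 q = ((2 * ν q : ℝ) : ℂ)⁻¹
  jost : ∀ q, IsJostConnection (ν q) (fun j => c₀ j q) (fun k j => b k j q)

/-- The diagonal entries of `CMat`. -/
def cFun {m : ℕ} (ν : Fin m → ℝ) (c₀ : Fin 2 → Fin m → ℂ) (lam : ℂ) (j : Fin 2) (p : Fin m)
    (x : ℝ) : ℂ := besselCLam (ν p) j (c₀ j p) x lam

/-- The diagonal entries of `EMat`. -/
def eFun {m : ℕ} (ν : Fin m → ℝ) (c₀ : Fin 2 → Fin m → ℂ) (b : Fin 2 → Fin 2 → Fin m → ℂ)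
    (ρ : ℂ) (k : Fin 2) (p : Fin m) (x : ℝ) : ℂ :=
  jostE (ν p) (fun j => c₀ j p) (fun k j => b k j p) k (ρ * (x : ℂ))

/-- The diagonal entries of `GMat`. -/
def gFun {m : ℕ} (ν : Fin m → ℝ) (c₀ : Fin 2 → Fin m → ℂ) (lam : ℂ) (x : ℝ) (p : Fin m)
    (t : ℝ) : ℂ :=
  cFun ν c₀ lam 1 p x * cFun ν c₀ lam 0 p t - cFun ν c₀ lam 0 p x * cFun ν c₀ lam 1 p t

/-- The integral of `diag(g) Q Y`. -/
def kerInt {m : ℕ} (Q : ℝ → Matrix (Fin m) (Fin m) ℂ) (g : Fin m → ℝ → ℂ)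
    (Y : ℝ → Matrix (Fin m) (Fin m) ℂ) (x₁ x₂ : ℝ) : Matrix (Fin m) (Fin m) ℂ :=
  Matrix.of fun p q => ∫ t in x₁..x₂, g p t * ∑ r, Q t p r * Y t r q

theorem CMat_eq {m : ℕ} (ν : Fin m → ℝ) (c₀ : Fin 2 → Fin m → ℂ) (j : Fin 2) (x : ℝ) (lam : ℂ) :
    CMat ν c₀ j x lam = Matrix.diagonal fun p => cFun ν c₀ lam j p x := rfl

theorem EMat_eq {m : ℕ} (ν : Fin m → ℝ) (c₀ : Fin 2 → Fin m → ℂ) (b : Fin 2 → Fin 2 → Fin m → ℂ)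
    (k : Fin 2) (x : ℝ) (ρ : ℂ) :
    EMat ν c₀ b k x ρ = Matrix.diagonal fun p => eFun ν c₀ b ρ k p x := rfl

theorem matInt_diagonal_mul {m : ℕ} (Q Y : ℝ → Matrix (Fin m) (Fin m) ℂ) (g : Fin m → ℝ → ℂ)
    (x₁ x₂ : ℝ) : matInt x₁ x₂ (fun t => Matrix.diagonal (fun p => g p t) * Q t * Y t)
      = kerInt Q g Y x₁ x₂ := by
  ext p q
  simp only [matInt, kerInt, Matrix.of_apply]
  refine intervalIntegral.integral_congr fun t _ => ?_
  rw [Matrix.mul_assoc, Matrix.diagonal_mul, Matrix.mul_apply]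

theorem matInt_GMat {m : ℕ} (ν : Fin m → ℝ) (c₀ : Fin 2 → Fin m → ℂ) (lam : ℂ)
    (Q Y : ℝ → Matrix (Fin m) (Fin m) ℂ) (x x₁ x₂ : ℝ) :
    matInt x₁ x₂ (fun t => GMat ν c₀ x t lam * Q t * Y t)
      = kerInt Q (gFun ν c₀ lam x) Y x₁ x₂ := by
  rw [← matInt_diagonal_mul]
  simp only [GMat, CMat_eq, Matrix.diagonal_mul_diagonal, Matrix.diagonal_sub, gFun]

theorem matInt_EMat_mul {m : ℕ} (ν : Fin m → ℝ) (c₀ : Fin 2 → Fin m → ℂ)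
    (b : Fin 2 → Fin 2 → Fin m → ℂ) (ρ : ℂ) (Q Y : ℝ → Matrix (Fin m) (Fin m) ℂ) (k l : Fin 2)
    (x x₁ x₂ : ℝ) :
    matInt x₁ x₂ (fun t => EMat ν c₀ b k x ρ * EMat ν c₀ b l t ρ * Q t * Y t)
      = EMat ν c₀ b k x ρ * kerInt Q (eFun ν c₀ b ρ l) Y x₁ x₂ := by
  simp only [EMat_eq, Matrix.diagonal_mul_diagonal]
  rw [matInt_diagonal_mul Q Y (fun p t => eFun ν c₀ b ρ k p x * eFun ν c₀ b ρ l p t)]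
  ext p q
  simp only [kerInt, Matrix.of_apply, Matrix.diagonal_mul]
  rw [← intervalIntegral.integral_const_mul]
  exact intervalIntegral.integral_congr fun t _ => by ring

theorem matInt_EMat_sub {m : ℕ} (ν : Fin m → ℝ) (c₀ : Fin 2 → Fin m → ℂ)
    (b : Fin 2 → Fin 2 → Fin m → ℂ) (ρ : ℂ) (Q Y : ℝ → Matrix (Fin m) (Fin m) ℂ)
    (x x₁ x₂ : ℝ) :
    matInt x₁ x₂ (fun t => (EMat ν c₀ b 0 x ρ * EMat ν c₀ b 1 t ρ
        - EMat ν c₀ b 1 x ρ * EMat ν c₀ b 0 t ρ) * Q t * Y t)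
      = kerInt Q (fun p t => eFun ν c₀ b ρ 0 p x * eFun ν c₀ b ρ 1 p t
          - eFun ν c₀ b ρ 1 p x * eFun ν c₀ b ρ 0 p t) Y x₁ x₂ := by
  rw [← matInt_diagonal_mul]
  simp only [EMat_eq, Matrix.diagonal_mul_diagonal, Matrix.diagonal_sub]

theorem inBirkhoffClass_iff {m : ℕ} [NeZero m] {T : ℝ} {ν : Fin m → ℝ}
    {Y : ℝ → Matrix (Fin m) (Fin m) ℂ} : InBirkhoffClass T ν Y ↔
      ∀ p q, InWeighted T (fun t => t ^ mu 0 (ν 0)) fun t => Y t p q := by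
  constructor
  · rintro ⟨hc, M, hM⟩ p q
    exact ⟨continuousOn_pi.1 (continuousOn_pi.1 hc p) q, M, fun t ht => hM t ht p q⟩
  · intro h
    choose hc M hM using h
    refine ⟨continuousOn_pi.2 fun p => continuousOn_pi.2 fun q => hc p q, ∑ p, ∑ q, |M p q|,
      fun x hx p q => ?_⟩
    refine (hM p q x hx).trans (mul_le_mul_of_nonneg_right ?_ (Real.rpow_nonneg hx.1.le _))
    refine (le_abs_self _).trans ?_
    refine (Finset.single_le_sum (f := fun q => |M p q|) (fun _ _ => abs_nonneg _)
      (Finset.mem_univ q)).trans ?_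
    exact Finset.single_le_sum (f := fun p => ∑ q, |M p q|) (fun _ _ => by positivity)
      (Finset.mem_univ p)

theorem InBirkhoffClass.mul_add_mul {m : ℕ} [NeZero m] {T : ℝ} {ν : Fin m → ℝ}
    {Y Z : ℝ → Matrix (Fin m) (Fin m) ℂ} (hY : InBirkhoffClass T ν Y)
    (hZ : InBirkhoffClass T ν Z) (A B : Matrix (Fin m) (Fin m) ℂ) :
    InBirkhoffClass T ν fun t => Y t * A + Z t * B := by
  rw [inBirkhoffClass_iff] at *
  intro p q
  simp only [Matrix.add_apply, Matrix.mul_apply]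
  exact (InWeighted.sum _ fun r => (hY p r).mul_const (A r q)).add
    (InWeighted.sum _ fun r => (hZ p r).mul_const (B r q))

theorem kerInt_congr {m : ℕ} {Q : ℝ → Matrix (Fin m) (Fin m) ℂ} {g g' : Fin m → ℝ → ℂ}
    {Y Z : ℝ → Matrix (Fin m) (Fin m) ℂ} {x₁ x₂ : ℝ}
    (h12 : x₁ ≤ x₂) (hg : ∀ p, ∀ t ∈ Set.Ioc x₁ x₂, g p t = g' p t)
    (hYZ : ∀ t ∈ Set.Ioc x₁ x₂, Y t = Z t) : kerInt Q g Y x₁ x₂ = kerInt Q g' Z x₁ x₂ := by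
  ext p q
  simp only [kerInt, Matrix.of_apply]
  refine intervalIntegral.integral_congr_ae (Eventually.of_forall fun t ht => ?_)
  rw [Set.uIoc_of_le h12] at ht
  rw [hg p t ht, hYZ t ht]

theorem kerInt_const_mul {m : ℕ} {Q : ℝ → Matrix (Fin m) (Fin m) ℂ} (c : ℂ)
    (g : Fin m → ℝ → ℂ) (Y : ℝ → Matrix (Fin m) (Fin m) ℂ)
    (x₁ x₂ : ℝ) : kerInt Q (fun p t => c * g p t) Y x₁ x₂ = c • kerInt Q g Y x₁ x₂ := by
  ext p q
  simp only [kerInt, Matrix.of_apply, Matrix.smul_apply, smul_eq_mul]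
  rw [← intervalIntegral.integral_const_mul]
  exact intervalIntegral.integral_congr fun t _ => by ring

/-- The factors ρ^{μ_j} that pass from c_j(ρx) to c_j(x, ρ²) are the source of D_j(ρ) in the leading
term. -/
theorem eFun_eq {m : ℕ} (ν : Fin m → ℝ) (c₀ : Fin 2 → Fin m → ℂ)
    (b : Fin 2 → Fin 2 → Fin m → ℂ) {ρ : ℂ} (hρ : ρ ≠ 0) (k : Fin 2) (p : Fin m) {x : ℝ} (hx : 0 < x) :
    eFun ν c₀ b ρ k p x = ∑ j : Fin 2,
      b k j p * ρ ^ ((mu j (ν p) : ℝ) : ℂ) * cFun ν c₀ (ρ ^ 2) j p x := by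
  unfold eFun jostE
  refine Finset.sum_congr rfl fun j _ => ?_
  have h1 : ρ ^ ((mu j (ν p) : ℝ) : ℂ) * ρ ^ (-((mu j (ν p) : ℝ) : ℂ)) = 1 := by
    rw [← Complex.cpow_add _ _ hρ]; simp
  rw [cFun, besselCLam_sq _ _ _ _ hx _ hρ]
  linear_combination (-(b k j p) * besselC (ν p) j (c₀ j p) (ρ * x)) * h1

section
variable {m : ℕ} [NeZero m] {T : ℝ} {ν : Fin m → ℝ} {Q : ℝ → Matrix (Fin m) (Fin m) ℂ}
  {c₀ : Fin 2 → Fin m → ℂ} {b : Fin 2 → Fin 2 → Fin m → ℂ}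

theorem Setting.le_zero (h : Setting T ν Q c₀ b) (p : Fin m) : ν p ≤ ν 0 := h.anti (Fin.zero_le p)

theorem Setting.cFun_inWeighted (h : Setting T ν Q c₀ b) (lam : ℂ) (j : Fin 2) (p : Fin m) :
    InWeighted T (fun t => t ^ mu 0 (ν 0)) (cFun ν c₀ lam j p) :=
  (besselCLam_inWeighted (h.pos p) (h.nat p) j (c₀ j p) lam T).rpow_mono
    (mu_ge (h.pos p) (h.le_zero p) j)

theorem Setting.gFun_inWeighted (h : Setting T ν Q c₀ b) (lam : ℂ) (x : ℝ) (p : Fin m) :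
    InWeighted T (fun t => t ^ mu 0 (ν 0)) (gFun ν c₀ lam x p) := by
  have := ((h.cFun_inWeighted lam 0 p).const_mul (cFun ν c₀ lam 1 p x)).add
    ((h.cFun_inWeighted lam 1 p).const_mul (-cFun ν c₀ lam 0 p x))
  change InWeighted T _ fun t => gFun ν c₀ lam x p t
  simpa only [gFun, sub_eq_add_neg, neg_mul] using this

theorem Setting.eFun_inWeighted (h : Setting T ν Q c₀ b) {ρ : ℂ} (hρ : ρ ≠ 0) (k : Fin 2)
    (p : Fin m) : InWeighted T (fun t => t ^ mu 0 (ν 0)) (eFun ν c₀ b ρ k p) := by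
  have h1 := InWeighted.sum Finset.univ fun j : Fin 2 =>
    (h.cFun_inWeighted (ρ ^ 2) j p).const_mul (b k j p * ρ ^ ((mu j (ν p) : ℝ) : ℂ))
  obtain ⟨c, M, hM⟩ := h1
  exact ⟨c.congr fun x hx => eFun_eq ν c₀ b hρ k p hx.1,
    M, fun x hx => by rw [eFun_eq ν c₀ b hρ k p hx.1]; exact hM x hx⟩

/-- Both sides are antisymmetric in the pair of solutions, so a change of basis multiplies by its
determinant: det β⁰ · ρ^{μ_1+μ_2} = -2iρ. The growing Birkhoff equation and the Bessel equations
thereby share one Volterra operator. -/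
theorem Setting.gFun_eq (h : Setting T ν Q c₀ b) {ρ : ℂ} (hρ : ρ ≠ 0) (p : Fin m) {x t : ℝ}
    (hx : 0 < x) (ht : 0 < t) :
    gFun ν c₀ (ρ ^ 2) x p t = 1 / (2 * Complex.I * ρ) *
      (eFun ν c₀ b ρ 0 p x * eFun ν c₀ b ρ 1 p t
        - eFun ν c₀ b ρ 1 p x * eFun ν c₀ b ρ 0 p t) := by
  have hdet := (h.jost p).det_eq (h.pos p) (h.nat p) (h.coeff p)
  have hpow : ρ ^ ((mu 0 (ν p) : ℝ) : ℂ) * ρ ^ ((mu 1 (ν p) : ℝ) : ℂ) = ρ := by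
    rw [← Complex.cpow_add _ _ hρ]
    simp [mu]; norm_num
  have hI : (2 * Complex.I * ρ) ≠ 0 := mul_ne_zero (mul_ne_zero two_ne_zero Complex.I_ne_zero) hρ
  rw [one_div, eq_inv_mul_iff_mul_eq₀ hI]
  simp only [eFun_eq ν c₀ b hρ _ p hx, eFun_eq ν c₀ b hρ _ p ht, Fin.sum_univ_two, gFun]
  set α := ρ ^ ((mu 0 (ν p) : ℝ) : ℂ)
  set β := ρ ^ ((mu 1 (ν p) : ℝ) : ℂ)
  set X0 := cFun ν c₀ (ρ ^ 2) 0 p x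
  set X1 := cFun ν c₀ (ρ ^ 2) 1 p x
  set T0 := cFun ν c₀ (ρ ^ 2) 0 p t
  set T1 := cFun ν c₀ (ρ ^ 2) 1 p t
  linear_combination (-(X0 * T1 - X1 * T0) * (α * β)) * hdet
    + (2 * Complex.I * (X0 * T1 - X1 * T0)) * hpow

theorem Setting.intervalIntegrable (h : Setting T ν Q c₀ b) {g : ℝ → ℂ}
    (hg : InWeighted T (fun t => t ^ mu 0 (ν 0)) g) {Y : ℝ → Matrix (Fin m) (Fin m) ℂ}
    (hY : InBirkhoffClass T ν Y) {x₁ x₂ : ℝ} (h1 : 0 ≤ x₁) (h12 : x₁ ≤ x₂) (h2 : x₂ ≤ T)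
    (p q : Fin m) :
    IntervalIntegrable (fun t => g t * ∑ r, Q t p r * Y t r q) volume x₁ x₂ := by
  rw [intervalIntegrable_iff_integrableOn_Ioc_of_le h12]
  exact (h.integrable.integrableOn_mul_sum hg (y := fun t r => Y t r q)
    (fun r => inBirkhoffClass_iff.1 hY r q) p).mono_set (Set.Ioc_subset_Ioc h1 h2)

theorem Setting.kerInt_mul_add_mul (h : Setting T ν Q c₀ b) {g : Fin m → ℝ → ℂ}
    (hg : ∀ p, InWeighted T (fun t => t ^ mu 0 (ν 0)) (g p))
    {Y Z : ℝ → Matrix (Fin m) (Fin m) ℂ} (hY : InBirkhoffClass T ν Y)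
    (hZ : InBirkhoffClass T ν Z) (A B : Matrix (Fin m) (Fin m) ℂ) {x : ℝ} (hx : 0 ≤ x)
    (hxT : x ≤ T) :
    kerInt Q g (fun t => Y t * A + Z t * B) 0 x = kerInt Q g Y 0 x * A + kerInt Q g Z 0 x * B := by
  ext p q
  simp only [kerInt, Matrix.of_apply, Matrix.add_apply, Matrix.mul_apply]
  have hY' := fun l => (h.intervalIntegrable (hg p) hY le_rfl hx hxT p l).mul_const (A l q)
  have hZ' := fun l => (h.intervalIntegrable (hg p) hZ le_rfl hx hxT p l).mul_const (B l q)
  have hYs : IntervalIntegrable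
      (fun t => ∑ l, (g p t * ∑ r, Q t p r * Y t r l) * A l q) volume 0 x := by
    simpa only [Finset.sum_fn] using IntervalIntegrable.sum Finset.univ fun l _ => hY' l
  have hZs : IntervalIntegrable
      (fun t => ∑ l, (g p t * ∑ r, Q t p r * Z t r l) * B l q) volume 0 x := by
    simpa only [Finset.sum_fn] using IntervalIntegrable.sum Finset.univ fun l _ => hZ' l
  simp only [← intervalIntegral.integral_mul_const]
  rw [← intervalIntegral.integral_finsetSum fun l _ => hY' l,
    ← intervalIntegral.integral_finsetSum fun l _ => hZ' l,
    ← intervalIntegral.integral_add hYs hZs]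
  refine intervalIntegral.integral_congr fun t _ => ?_
  simp only [mul_add, Finset.sum_add_distrib, Finset.mul_sum, Finset.sum_mul]
  congr 1
  · rw [Finset.sum_comm]
    exact Finset.sum_congr rfl fun l _ => Finset.sum_congr rfl fun r _ => by ring
  · rw [Finset.sum_comm]
    exact Finset.sum_congr rfl fun l _ => Finset.sum_congr rfl fun r _ => by ring

/-- The Volterra operator of the Bessel-type solutions in terms of the Jost solutions. -/
theorem Setting.kerInt_gFun (h : Setting T ν Q c₀ b) {ρ : ℂ} (hρ : ρ ≠ 0)
    (Y : ℝ → Matrix (Fin m) (Fin m) ℂ) {x : ℝ} (hx : x ∈ Set.Ioc 0 T) :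
    kerInt Q (gFun ν c₀ (ρ ^ 2) x) Y 0 x = (1 / (2 * Complex.I * ρ)) •
      kerInt Q (fun p t => eFun ν c₀ b ρ 0 p x * eFun ν c₀ b ρ 1 p t
          - eFun ν c₀ b ρ 1 p x * eFun ν c₀ b ρ 0 p t) Y 0 x := by
  rw [← kerInt_const_mul]
  exact kerInt_congr hx.1.le (fun p t ht => h.gFun_eq hρ p hx.1 ht.1) fun _ _ => rfl

/-- The operator of the recessive Birkhoff-type solution differs from the Volterra operator by
an operator of finite rank. -/
theorem Setting.bounded_operator_eq (h : Setting T ν Q c₀ b) {ρ : ℂ} (hρ : ρ ≠ 0) (s : Fin 2)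
    {Y : ℝ → Matrix (Fin m) (Fin m) ℂ} (hY : InBirkhoffClass T ν Y) {x : ℝ}
    (hx : x ∈ Set.Ioc 0 T) :
    ((-1) ^ (s : ℕ) / (2 * Complex.I * ρ)) •
        (matInt 0 x (fun t => EMat ν c₀ b s x ρ * EMat ν c₀ b (1 - s) t ρ * Q t * Y t) +
         matInt x T (fun t => EMat ν c₀ b (1 - s) x ρ * EMat ν c₀ b s t ρ * Q t * Y t))
      = kerInt Q (gFun ν c₀ (ρ ^ 2) x) Y 0 x + EMat ν c₀ b (1 - s) x ρ *
        (((-1) ^ (s : ℕ) / (2 * Complex.I * ρ)) • kerInt Q (eFun ν c₀ b ρ s) Y 0 T) := by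
  have hi := fun k p q x₁ x₂ h1 h12 h2 =>
    h.intervalIntegrable (h.eFun_inWeighted hρ k p) hY (x₁ := x₁) (x₂ := x₂) h1 h12 h2 p q
  rw [matInt_EMat_mul, matInt_EMat_mul, h.kerInt_gFun hρ Y hx]
  ext p q
  have hsplit := intervalIntegral.integral_add_adjacent_intervals
    (hi s p q 0 x le_rfl hx.1.le hx.2) (hi s p q x T hx.1.le hx.2 le_rfl)
  have hker : ∫ t in (0 : ℝ)..x, (eFun ν c₀ b ρ 0 p x * eFun ν c₀ b ρ 1 p t
          - eFun ν c₀ b ρ 1 p x * eFun ν c₀ b ρ 0 p t) * ∑ r, Q t p r * Y t r q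
      = eFun ν c₀ b ρ 0 p x * (∫ t in (0 : ℝ)..x, eFun ν c₀ b ρ 1 p t * ∑ r, Q t p r * Y t r q)
        - eFun ν c₀ b ρ 1 p x *
          ∫ t in (0 : ℝ)..x, eFun ν c₀ b ρ 0 p t * ∑ r, Q t p r * Y t r q := by
    rw [← intervalIntegral.integral_const_mul, ← intervalIntegral.integral_const_mul,
      ← intervalIntegral.integral_sub ((hi 1 p q 0 x le_rfl hx.1.le hx.2).const_mul _)
        ((hi 0 p q 0 x le_rfl hx.1.le hx.2).const_mul _)]
    exact intervalIntegral.integral_congr fun t _ => by ring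
  simp only [EMat_eq, Matrix.smul_apply, Matrix.add_apply, Matrix.diagonal_mul, smul_eq_mul,
    kerInt, Matrix.of_apply, hker]
  rw [← hsplit]
  -- The sign (-1)^s compensates the exchange of e_1 and e_2, so both quadrants produce the same
  -- antisymmetric kernel.
  rcases Fin.exists_fin_two.1 ⟨s, rfl⟩ with hs | hs <;> subst hs
  · simp only [sub_zero, Fin.val_zero, pow_zero]
    ring
  · simp only [sub_self, Fin.val_one, pow_one]
    ring

end

/-! ### Estimates for large `ρ` -/

/-- The origin of β = min{1, 2ν_1}. The left side equals R^{-2ν} (1+Rt)^{2ν-1} t^{1-2ν}. If 2ν ≥ 1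
the middle factor is at most ((1+T)R)^{2ν-1} and R^{-1} remains; otherwise it is at most 1 and
R^{-2ν} remains. -/
theorem wt_sq_div_le {ν₀ T : ℝ} (hT : 0 < T) {R t : ℝ} (hR : 1 ≤ R) (ht : 0 < t) (htT : t ≤ T) :
    wt (mu 0 ν₀) (R * t) * wt (mu 0 ν₀) (R * t) / R
      ≤ (1 + T) ^ |2 * ν₀ - 1| * (R ^ (-(min 1 (2 * ν₀))) * t ^ (1 - 2 * ν₀)) := by
  have hR0 : 0 < R := by linarith
  have hRt : 0 < R * t := by positivity
  have h1 : wt (mu 0 ν₀) (R * t) * wt (mu 0 ν₀) (R * t) / R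
      = R ^ (-(2 * ν₀)) * (1 + R * t) ^ (2 * ν₀ - 1) * t ^ (1 - 2 * ν₀) := by
    unfold wt
    rw [← Real.rpow_add (by positivity),
      show mu 0 ν₀ + mu 0 ν₀ = 1 - 2 * ν₀ by simp [mu]; ring,
      Real.div_rpow hRt.le (by positivity), Real.mul_rpow hR0.le ht.le,
      show (1 + R * t) ^ (2 * ν₀ - 1) = ((1 + R * t) ^ (1 - 2 * ν₀))⁻¹ by
        rw [← Real.rpow_neg (by positivity)]; congr 1; ring,
      show R ^ (-(2 * ν₀)) = R ^ (1 - 2 * ν₀) / R by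
        nth_rw 3 [← Real.rpow_one R]
        rw [← Real.rpow_sub hR0]; congr 1; ring]
    ring
  rw [h1, ← mul_assoc]
  refine mul_le_mul_of_nonneg_right ?_ (Real.rpow_nonneg ht.le _)
  rcases le_total 1 (2 * ν₀) with h | h
  · rw [min_eq_left h, abs_of_nonneg (by linarith)]
    have h2 : 1 + R * t ≤ (1 + T) * R := by nlinarith
    calc _ ≤ R ^ (-(2 * ν₀)) * ((1 + T) * R) ^ (2 * ν₀ - 1) := by
          gcongr
      _ = (1 + T) ^ (2 * ν₀ - 1) * R ^ (-1 : ℝ) := by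
          rw [Real.mul_rpow (by positivity) hR0.le,
            show (-1 : ℝ) = -(2 * ν₀) + (2 * ν₀ - 1) by ring, Real.rpow_add hR0]
          ring
  · rw [min_eq_right h]
    have h2 : (1 + R * t) ^ (2 * ν₀ - 1) ≤ 1 :=
      Real.rpow_le_one_of_one_le_of_nonpos (by linarith) (by linarith)
    have h3 : 1 ≤ (1 + T) ^ |2 * ν₀ - 1| :=
      Real.one_le_rpow (by linarith) (abs_nonneg _)
    have h4 := Real.rpow_nonneg hR0.le (-(2 * ν₀))
    nlinarith

theorem exists_rpow_neg_le {β : ℝ} (hβ : 0 < β) (Λ : ℝ) {ε : ℝ} (hε : 0 < ε) :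
    ∃ R, 1 ≤ R ∧ ∀ r, R ≤ r → Λ * r ^ (-β) ≤ ε := by
  have h := (tendsto_rpow_neg_atTop hβ).const_mul Λ
  rw [mul_zero] at h
  obtain ⟨R, hR⟩ := eventually_atTop.1 (h.eventually_le_const hε)
  exact ⟨max 1 R, le_max_left _ _, fun r hr => hR r ((le_max_right _ _).trans hr)⟩

/-- The weight of the dominant solutions. -/
def domWt (ν₀ : ℝ) (ρ : ℂ) (x : ℝ) : ℝ :=
  wt (mu 0 ν₀) (‖ρ‖ * x) * Real.exp (|ρ.im| * x)

theorem inSector_mul {s : Fin 2} {ρ : ℂ} (h : InSector s ρ) {x : ℝ} (hx : 0 < x) :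
    InSector s (ρ * x) := by
  obtain ⟨h1, h2⟩ := h
  refine ⟨by rw [Complex.re_mul_ofReal]; positivity, ?_⟩
  rw [Complex.im_mul_ofReal]
  split_ifs at h2 ⊢
  · positivity
  · exact mul_nonpos_of_nonpos_of_nonneg h2 hx.le

theorem norm_sum_mul_le {m : ℕ} (Q : ℝ → Matrix (Fin m) (Fin m) ℂ) {y : Fin m → ℂ} {N t : ℝ}
    (hy : ∀ r, ‖y r‖ ≤ N) (p : Fin m) :
    ‖∑ r, Q t p r * y r‖ ≤ (∑ r, ‖Q t p r‖) * N := by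
  rw [Finset.sum_mul]
  refine norm_sum_le_of_le _ fun r _ => ?_
  rw [norm_mul]
  gcongr
  exact hy r

section
variable {m : ℕ} [NeZero m] {T : ℝ} {ν : Fin m → ℝ} {Q : ℝ → Matrix (Fin m) (Fin m) ℂ}
  {c₀ : Fin 2 → Fin m → ℂ} {b : Fin 2 → Fin 2 → Fin m → ℂ}

theorem Setting.exists_norm_eFun_le (h : Setting T ν Q c₀ b) :
    ∃ C, 0 ≤ C ∧ ∀ s ρ, InSector s ρ → ρ ≠ 0 → ∀ p x, 0 < x →
      (∀ k, ‖eFun ν c₀ b ρ k p x‖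
        ≤ C * wt (mu 0 (ν 0)) (‖ρ‖ * x) * Real.exp (|ρ.im| * x)) ∧
      ‖eFun ν c₀ b ρ s p x‖ ≤ C * wt (mu 0 (ν 0)) (‖ρ‖ * x) * Real.exp (-(|ρ.im| * x)) := by
  choose C₁ hC₁ h₁ using fun p =>
    norm_jostE_le (h.pos p) (h.nat p) (fun j => c₀ j p) (fun k j => b k j p)
  choose C₂ hC₂ h₂ using fun p => (h.jost p).norm_recessive_le (h.pos p) (h.nat p)
  refine ⟨∑ p, (C₁ p + C₂ p),
    Finset.sum_nonneg fun p _ => add_nonneg (hC₁ p) (hC₂ p), fun s ρ hs hρ p x hx => ?_⟩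
  have hle : C₁ p + C₂ p ≤ ∑ p, (C₁ p + C₂ p) :=
    Finset.single_le_sum (f := fun p => C₁ p + C₂ p)
      (fun p _ => add_nonneg (hC₁ p) (hC₂ p)) (Finset.mem_univ p)
  have hxC : (x : ℂ) ≠ 0 := by exact_mod_cast hx.ne'
  have hz := mul_ne_zero hρ hxC
  have hs' := inSector_mul hs hx
  have hn : ‖ρ * (x : ℂ)‖ = ‖ρ‖ * x := by
    rw [norm_mul, Complex.norm_real, Real.norm_eq_abs, abs_of_pos hx]
  have him : |(ρ * (x : ℂ)).im| = |ρ.im| * x := by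
    rw [Complex.im_mul_ofReal, abs_mul, abs_of_pos hx]
  have hpos : 0 < ‖ρ‖ * x := mul_pos (norm_pos_iff.2 hρ) hx
  have hw : wt (mu 0 (ν p)) (‖ρ‖ * x) ≤ wt (mu 0 (ν 0)) (‖ρ‖ * x) :=
    wt_anti hpos (mu_ge (h.pos p) (h.le_zero p) 0)
  have hw0 := (wt_pos (mu 0 (ν p)) hpos).le
  have hC1p := hC₁ p
  have hC2p := hC₂ p
  constructor
  · intro k
    have := h₁ p k (ρ * x) hs'.1 hz
    rw [hn, him] at this
    refine this.trans ?_
    gcongr <;> linarith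
  · have := h₂ p s (ρ * x) hs' hz
    rw [hn, him] at this
    refine this.trans ?_
    gcongr <;> linarith

/-- Each product in G contains one recessive factor, so the kernel is O(e^{|Im ρ| (x-t)}) and
carries the exponential of the weight from t to x. In the functional over (0, T) the recessive
factor cancels the exponential outright. Either way w²|Q|/|ρ| is left, to which `wt_sq_div_le`
applies. -/
theorem Setting.exists_operator_bounds (h : Setting T ν Q c₀ b) :
    ∃ C Λ, 0 ≤ C ∧ 0 ≤ Λ ∧ ∀ s ρ, InSector s ρ → 1 ≤ ‖ρ‖ →
      (∀ k p, ∀ x ∈ Set.Ioc 0 T, ‖eFun ν c₀ b ρ k p x‖ ≤ C * domWt (ν 0) ρ x) ∧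
      ∀ (y : ℝ → Fin m → ℂ) (M : ℝ), 0 ≤ M →
        (∀ t ∈ Set.Ioc 0 T, ∀ r, ‖y t r‖ ≤ M * domWt (ν 0) ρ t) →
        (∀ x ∈ Set.Ioc 0 T, ∀ p,
          ‖∫ t in (0 : ℝ)..x, gFun ν c₀ (ρ ^ 2) x p t * ∑ r, Q t p r * y t r‖
            ≤ Λ * ‖ρ‖ ^ (-(min 1 (2 * ν 0))) * M * domWt (ν 0) ρ x) ∧
        ∀ p, ‖(-1) ^ (s : ℕ) / (2 * Complex.I * ρ) *
            ∫ t in (0 : ℝ)..T, eFun ν c₀ b ρ s p t * ∑ r, Q t p r * y t r‖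
          ≤ Λ * ‖ρ‖ ^ (-(min 1 (2 * ν 0))) * M := by
  obtain ⟨C, hC, hE⟩ := h.exists_norm_eFun_le
  set I := ∫ t in (0 : ℝ)..T, potWeight (ν 0) Q t
  have hpotT : IntervalIntegrable (potWeight (ν 0) Q) volume 0 T :=
    (intervalIntegrable_iff_integrableOn_Ioc_of_le h.T_pos.le).2
      h.integrable.integrableOn_potWeight
  have hIx : ∀ x ∈ Set.Ioc 0 T, ∫ t in (0 : ℝ)..x, potWeight (ν 0) Q t ≤ I := by
    intro x hx
    refine intervalIntegral.integral_mono_interval le_rfl hx.1.le hx.2 ?_ hpotT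
    exact (ae_restrict_iff' measurableSet_Ioc).2
      (Eventually.of_forall fun t ht => potWeight_nonneg (ν 0) Q ht.1)
  have hI : 0 ≤ I := intervalIntegral.integral_nonneg_of_ae_restrict h.T_pos.le (by
    rw [← restrict_Ioc_eq_restrict_Icc]
    exact (ae_restrict_iff' measurableSet_Ioc).2
      (Eventually.of_forall fun t ht => potWeight_nonneg (ν 0) Q ht.1))
  have hT := h.T_pos
  set K := (1 + T) ^ |2 * ν 0 - 1|
  have hK : 0 ≤ K := by positivity
  -- C² belongs to the Volterra kernel, with two Jost factors; C belongs to the functional, with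
  -- one.
  refine ⟨C, (C ^ 2 + C) * K * I, hC, by positivity, fun s ρ hs hρ1 => ?_⟩
  have hρ : ρ ≠ 0 := by rintro rfl; simp at hρ1; linarith
  have hρ0 : 0 < ‖ρ‖ := norm_pos_iff.2 hρ
  set B := ‖ρ‖ ^ (-(min 1 (2 * ν 0)))
  have hB : 0 ≤ B := by positivity
  set ω : ℝ → ℝ := fun x => wt (mu 0 (ν 0)) (‖ρ‖ * x) with hω
  have hω0 : ∀ x, 0 < x → 0 ≤ ω x := fun x hx => (wt_pos _ (mul_pos hρ0 hx)).le
  have hcoef : ∀ n : ℕ, ‖((-1 : ℂ)) ^ n / (2 * Complex.I * ρ)‖ = 1 / (2 * ‖ρ‖) := by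
    intro n
    rw [norm_div, norm_pow, norm_neg, norm_one, one_pow, norm_mul, norm_mul, Complex.norm_I,
      Complex.norm_two, mul_one]
  -- the common pointwise estimate
  have hpt : ∀ t ∈ Set.Ioc 0 T, ∀ p, ω t * ω t / ‖ρ‖ * (∑ r, ‖Q t p r‖)
      ≤ K * B * potWeight (ν 0) Q t := by
    intro t ht p
    have h1 := wt_sq_div_le (ν₀ := ν 0) hT hρ1 ht.1 ht.2
    have h2 := rpow_mul_row_le_potWeight (ν 0) Q ht.1 p
    calc _ ≤ K * (B * t ^ (1 - 2 * ν 0)) * (∑ r, ‖Q t p r‖) := by gcongr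
      _ = K * B * (t ^ (1 - 2 * ν 0) * ∑ r, ‖Q t p r‖) := by ring
      _ ≤ _ := by gcongr
  refine ⟨fun k p x hx => ?_, fun y M hM hy => ⟨fun x hx p => ?_, fun p => ?_⟩⟩
  · rw [domWt, ← mul_assoc]; exact (hE s ρ hs hρ p x hx.1).1 k
  · have hdx : 0 ≤ domWt (ν 0) ρ x := mul_nonneg (hω0 x hx.1) (Real.exp_pos _).le
    have hInt : IntervalIntegrable (fun t => potWeight (ν 0) Q t) volume 0 x := by
      rw [intervalIntegrable_iff_integrableOn_Ioc_of_le hx.1.le]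
      exact h.integrable.integrableOn_potWeight.mono_set (Set.Ioc_subset_Ioc_right hx.2)
    refine le_trans (intervalIntegral.norm_integral_le_of_norm_le hx.1.le ?_
      (hInt.const_mul (C ^ 2 * K * B * M * domWt (ν 0) ρ x))) ?_
    · refine Eventually.of_forall fun t ht => ?_
      have htT : t ∈ Set.Ioc 0 T := ⟨ht.1, ht.2.trans hx.2⟩
      have hG : ‖gFun ν c₀ (ρ ^ 2) x p t‖
          ≤ C ^ 2 * (ω x * ω t / ‖ρ‖) * Real.exp (|ρ.im| * (x - t)) := by
        have ex := hE s ρ hs hρ p x hx.1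
        have et := hE s ρ hs hρ p t ht.1
        have hωx := hω0 x hx.1
        have hωt := hω0 t ht.1
        have e1 : ∀ k, ‖eFun ν c₀ b ρ s p x * eFun ν c₀ b ρ k p t‖
            ≤ C ^ 2 * (ω x * ω t) * Real.exp (|ρ.im| * (x - t)) := by
          intro k
          rw [norm_mul]
          calc _ ≤ (C * ω x * Real.exp (-(|ρ.im| * x))) * (C * ω t * Real.exp (|ρ.im| * t)) :=
                mul_le_mul ex.2 (et.1 k) (norm_nonneg _) (by positivity)
            _ = C ^ 2 * (ω x * ω t) * Real.exp (-(|ρ.im| * (x - t))) := by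
                rw [show -(|ρ.im| * (x - t)) = -(|ρ.im| * x) + |ρ.im| * t by ring, Real.exp_add]
                ring
            _ ≤ _ := by
                have : 0 ≤ |ρ.im| * (x - t) :=
                  mul_nonneg (abs_nonneg _) (sub_nonneg.2 ht.2)
                gcongr
                linarith
        have e2 : ∀ k, ‖eFun ν c₀ b ρ k p x * eFun ν c₀ b ρ s p t‖
            ≤ C ^ 2 * (ω x * ω t) * Real.exp (|ρ.im| * (x - t)) := by
          intro k
          rw [norm_mul]
          calc _ ≤ (C * ω x * Real.exp (|ρ.im| * x)) * (C * ω t * Real.exp (-(|ρ.im| * t))) :=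
                mul_le_mul (ex.1 k) et.2 (norm_nonneg _) (by positivity)
            _ = _ := by
                rw [show |ρ.im| * (x - t) = |ρ.im| * x + -(|ρ.im| * t) by ring, Real.exp_add]
                ring
        have e3 : ‖eFun ν c₀ b ρ 0 p x * eFun ν c₀ b ρ 1 p t
            - eFun ν c₀ b ρ 1 p x * eFun ν c₀ b ρ 0 p t‖
            ≤ 2 * (C ^ 2 * (ω x * ω t) * Real.exp (|ρ.im| * (x - t))) := by
          refine (norm_sub_le _ _).trans ?_
          rcases Fin.exists_fin_two.1 ⟨s, rfl⟩ with hs0 | hs0 <;> subst hs0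
          · linarith [e1 1, e2 1]
          · linarith [e1 0, e2 0]
        rw [h.gFun_eq hρ p hx.1 ht.1, norm_mul]
        have hc0 := hcoef 0
        rw [pow_zero] at hc0
        rw [hc0]
        calc _ ≤ 1 / (2 * ‖ρ‖) * (2 * (C ^ 2 * (ω x * ω t) * Real.exp (|ρ.im| * (x - t)))) := by
              gcongr
          _ = _ := by field_simp
      have hs1 := norm_sum_mul_le Q (t := t) (hy t htT) p
      rw [norm_mul]
      have hωx := hω0 x hx.1
      have hωt := hω0 t ht.1
      calc _ ≤ (C ^ 2 * (ω x * ω t / ‖ρ‖) * Real.exp (|ρ.im| * (x - t)))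
            * ((∑ r, ‖Q t p r‖) * (M * domWt (ν 0) ρ t)) :=
            mul_le_mul hG hs1 (norm_nonneg _) (by positivity)
        _ = C ^ 2 * M * domWt (ν 0) ρ x * (ω t * ω t / ‖ρ‖ * (∑ r, ‖Q t p r‖)) := by
            simp only [domWt, hω]
            rw [show |ρ.im| * x = |ρ.im| * (x - t) + |ρ.im| * t by ring, Real.exp_add]
            ring
        _ ≤ C ^ 2 * M * domWt (ν 0) ρ x * (K * B * potWeight (ν 0) Q t) :=
            mul_le_mul_of_nonneg_left (hpt t htT p) (by positivity)
        _ = _ := by ring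
    · rw [intervalIntegral.integral_const_mul]
      calc _ ≤ C ^ 2 * K * B * M * domWt (ν 0) ρ x * I := by gcongr; exact hIx x hx
        _ = C ^ 2 * K * I * B * M * domWt (ν 0) ρ x := by ring
        _ ≤ _ := by gcongr; linarith
  · rw [norm_mul, hcoef]
    have hb : ‖∫ t in (0 : ℝ)..T, eFun ν c₀ b ρ s p t * ∑ r, Q t p r * y t r‖
        ≤ ∫ t in (0 : ℝ)..T, C * M * ‖ρ‖ * K * B * potWeight (ν 0) Q t := by
      refine intervalIntegral.norm_integral_le_of_norm_le hT.le ?_ (hpotT.const_mul _)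
      refine Eventually.of_forall fun t ht => ?_
      have hs1 := norm_sum_mul_le Q (t := t) (hy t ht) p
      have hωt := hω0 t ht.1
      rw [norm_mul]
      calc _ ≤ (C * ω t * Real.exp (-(|ρ.im| * t)))
            * ((∑ r, ‖Q t p r‖) * (M * domWt (ν 0) ρ t)) :=
            mul_le_mul (hE s ρ hs hρ p t ht.1).2 hs1 (norm_nonneg _) (by positivity)
        _ = C * M * ‖ρ‖ * (ω t * ω t / ‖ρ‖ * (∑ r, ‖Q t p r‖))
            * (Real.exp (-(|ρ.im| * t)) * Real.exp (|ρ.im| * t)) := by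
            simp only [domWt, hω]
            field_simp
        _ = C * M * ‖ρ‖ * (ω t * ω t / ‖ρ‖ * (∑ r, ‖Q t p r‖)) := by
            rw [← Real.exp_add]; simp
        _ ≤ C * M * ‖ρ‖ * (K * B * potWeight (ν 0) Q t) :=
            mul_le_mul_of_nonneg_left (hpt t ht p) (by positivity)
        _ = _ := by ring
    rw [intervalIntegral.integral_const_mul] at hb
    have hnn : 0 ≤ C * K * I * B * M := by positivity
    have hnn2 : 0 ≤ C ^ 2 * K * I * B * M := by positivity
    calc _ ≤ 1 / (2 * ‖ρ‖) * (C * M * ‖ρ‖ * K * B * I) := by gcongr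
      _ = C * K * I * B * M / 2 := by field_simp
      _ ≤ _ := by linarith

end

/-! ### The Stokes multipliers -/

/-- Absorption entry by entry; a row of the matrix product has m terms, hence the smallness of m η.
-/
theorem norm_le_of_eq_add_mul {m : ℕ} {N L A : Matrix (Fin m) (Fin m) ℂ} {δ η : ℝ} (hδ : 0 ≤ δ)
    (hη : m * η ≤ 1 / 2) (hN : ∀ p q, ‖N p q‖ ≤ δ) (hL : ∀ p q, ‖L p q‖ ≤ η)
    (hA : A = N + L * A) (p q : Fin m) : ‖A p q‖ ≤ 2 * δ := by
  have key := le_of_halving (s := Set.univ) (u := fun z : Fin m × Fin m => ‖A z.1 z.2‖)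
    (W := fun _ => 1) hδ (fun _ _ => zero_le_one) ?_ ?_ (p, q) (Set.mem_univ _)
  · simpa using key
  · refine ⟨∑ z : Fin m × Fin m, ‖A z.1 z.2‖, fun z _ => ?_⟩
    rw [mul_one]
    exact Finset.single_le_sum (f := fun z : Fin m × Fin m => ‖A z.1 z.2‖)
      (fun _ _ => norm_nonneg _) (Finset.mem_univ z)
  · intro M hM hb z _
    have hsum : ‖(L * A) z.1 z.2‖ ≤ ∑ _r : Fin m, η * M := by
      rw [Matrix.mul_apply]
      refine norm_sum_le_of_le _ fun r _ => ?_
      rw [norm_mul]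
      have := hb (r, z.2) (Set.mem_univ _)
      rw [mul_one] at this
      exact mul_le_mul (hL _ _) this (norm_nonneg _) ((norm_nonneg _).trans (hL z.1 r))
    rw [Finset.sum_const, Finset.card_univ, Fintype.card_fin, nsmul_eq_mul, ← mul_assoc] at hsum
    have h1 : ‖A z.1 z.2‖ ≤ ‖N z.1 z.2‖ + ‖(L * A) z.1 z.2‖ := by
      conv_lhs => rw [hA]
      exact norm_add_le _ _
    have h2 := mul_le_mul_of_nonneg_right hη hM
    rw [mul_one]
    linarith [hN z.1 z.2]

/-- The a priori bound with N = 0 makes A ↦ A - L A injective, hence surjective in finite dimension.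
-/
theorem exists_eq_add_mul {m : ℕ} (N : Matrix (Fin m) (Fin m) ℂ) {L : Matrix (Fin m) (Fin m) ℂ}
    {η : ℝ} (hη : m * η ≤ 1 / 2) (hL : ∀ p q, ‖L p q‖ ≤ η) :
    ∃ A : Matrix (Fin m) (Fin m) ℂ, A = N + L * A := by
  let φ : Matrix (Fin m) (Fin m) ℂ →ₗ[ℂ] Matrix (Fin m) (Fin m) ℂ :=
    LinearMap.id - LinearMap.mulLeft ℂ L
  have hφ : ∀ A, φ A = A - L * A := fun A => rfl
  have hinj : Function.Injective φ := by
    rw [injective_iff_map_eq_zero]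
    intro A hA
    rw [hφ, sub_eq_zero] at hA
    ext p q
    have := norm_le_of_eq_add_mul (N := 0) le_rfl hη (by simp) hL (by rwa [zero_add]) p q
    rw [mul_zero] at this
    exact norm_le_zero_iff.1 this
  obtain ⟨A, hA⟩ := LinearMap.injective_iff_surjective.1 hinj N
  exact ⟨A, by rw [← hA, hφ]; abel⟩

theorem domWt_pos (ν₀ : ℝ) {ρ : ℂ} (hρ : ρ ≠ 0) {x : ℝ} (hx : 0 < x) : 0 < domWt ν₀ ρ x :=
  mul_pos (wt_pos _ (mul_pos (norm_pos_iff.2 hρ) hx)) (Real.exp_pos _)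

/-- At fixed ρ the Birkhoff class lies in the class with the dominant weight. The constant depends
on ρ, which is harmless: it only starts the absorption. -/
theorem exists_rpow_le_domWt (ν₀ : ℝ) {ρ : ℂ} (hρ : ρ ≠ 0) (T : ℝ) :
    ∃ M, 0 ≤ M ∧ ∀ x ∈ Set.Ioc 0 T, x ^ mu 0 ν₀ ≤ M * domWt ν₀ ρ x := by
  have hρ0 : 0 < ‖ρ‖ := norm_pos_iff.2 hρ
  refine ⟨‖ρ‖ ^ (-mu 0 ν₀) * |(1 + ‖ρ‖ * T) ^ (|mu 0 ν₀|)|, by positivity, fun x hx => ?_⟩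
  have h1 := rpow_le_wt (mu 0 ν₀) (mul_pos hρ0 hx.1) (mul_le_mul_of_nonneg_left hx.2 hρ0.le)
  have hw := (wt_pos (mu 0 ν₀) (mul_pos hρ0 hx.1)).le
  have h2 : x ^ mu 0 ν₀ = ‖ρ‖ ^ (-mu 0 ν₀) * (‖ρ‖ * x) ^ mu 0 ν₀ := by
    rw [Real.mul_rpow hρ0.le hx.1.le, ← mul_assoc, ← Real.rpow_add hρ0]; simp
  rw [h2, mul_assoc]
  refine mul_le_mul_of_nonneg_left ?_ (by positivity)
  have h3 : 1 ≤ Real.exp (|ρ.im| * x) := Real.one_le_exp (mul_nonneg (abs_nonneg _) hx.1.le)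
  calc _ ≤ (1 + ‖ρ‖ * T) ^ |mu 0 ν₀| * wt (mu 0 ν₀) (‖ρ‖ * x) := h1
    _ ≤ |(1 + ‖ρ‖ * T) ^ (|mu 0 ν₀|)| * wt (mu 0 ν₀) (‖ρ‖ * x) := by
        gcongr; exact le_abs_self _
    _ ≤ |(1 + ‖ρ‖ * T) ^ (|mu 0 ν₀|)| * domWt ν₀ ρ x := by
        gcongr; exact le_mul_of_one_le_right hw h3

theorem EMat_eq_CMat {m : ℕ} (ν : Fin m → ℝ) (c₀ : Fin 2 → Fin m → ℂ)
    (b : Fin 2 → Fin 2 → Fin m → ℂ) {ρ : ℂ} (hρ : ρ ≠ 0) (k : Fin 2) {x : ℝ} (hx : 0 < x) :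
    EMat ν c₀ b k x ρ = CMat ν c₀ 0 x (ρ ^ 2) * (DMat ν 0 ρ * Matrix.diagonal (b k 0))
      + CMat ν c₀ 1 x (ρ ^ 2) * (DMat ν 1 ρ * Matrix.diagonal (b k 1)) := by
  simp only [EMat_eq, CMat_eq, DMat, Matrix.diagonal_mul_diagonal, Matrix.diagonal_add]
  congr 1
  funext p
  rw [eFun_eq ν c₀ b hρ k p hx, Fin.sum_univ_two]
  ring

/-- The combination of the Bessel-type solutions with the unperturbed coefficients. -/
def besselComb {m : ℕ} (ν : Fin m → ℝ) (b : Fin 2 → Fin 2 → Fin m → ℂ) (ρ : ℂ)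
    (S : Fin 2 → ℝ → Matrix (Fin m) (Fin m) ℂ) (k : Fin 2) (x : ℝ) : Matrix (Fin m) (Fin m) ℂ :=
  S 0 x * (DMat ν 0 ρ * Matrix.diagonal (b k 0)) + S 1 x * (DMat ν 1 ρ * Matrix.diagonal (b k 1))

section
variable {m : ℕ} [NeZero m] {T : ℝ} {ν : Fin m → ℝ} {Q : ℝ → Matrix (Fin m) (Fin m) ℂ}
  {c₀ : Fin 2 → Fin m → ℂ} {b : Fin 2 → Fin 2 → Fin m → ℂ}
  {S : Fin 2 → ℝ → Matrix (Fin m) (Fin m) ℂ}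

theorem Setting.inBirkhoffClass (h : Setting T ν Q c₀ b) {j : Fin 2} {lam : ℂ}
    {S : ℝ → Matrix (Fin m) (Fin m) ℂ} (hS : IsBesselType T ν Q c₀ j lam S) :
    InBirkhoffClass T ν S := by
  obtain ⟨M, hM⟩ := hS.bound
  exact inBirkhoffClass_iff.2 fun p q => InWeighted.rpow_mono
    ⟨continuousOn_pi.1 (continuousOn_pi.1 hS.cont p) q, M, fun x hx => hM x hx p q⟩
    (mu_ge (h.pos q) (h.le_zero q) j)

theorem Setting.comb_eq (h : Setting T ν Q c₀ b) {lam : ℂ}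
    (hS : ∀ j, IsBesselType T ν Q c₀ j lam (S j)) (A B : Matrix (Fin m) (Fin m) ℂ) {x : ℝ}
    (hx : x ∈ Set.Ioc 0 T) :
    S 0 x * A + S 1 x * B = CMat ν c₀ 0 x lam * A + CMat ν c₀ 1 x lam * B
      + kerInt Q (gFun ν c₀ lam x) (fun t => S 0 t * A + S 1 t * B) 0 x := by
  rw [h.kerInt_mul_add_mul (h.gFun_inWeighted lam x) (h.inBirkhoffClass (hS 0))
    (h.inBirkhoffClass (hS 1)) A B hx.1.le hx.2]
  conv_lhs => rw [(hS 0).eq x hx, (hS 1).eq x hx, matInt_GMat, matInt_GMat]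
  noncomm_ring

/-- The Bessel-type solutions are linearly independent. -/
theorem Setting.comb_injective (h : Setting T ν Q c₀ b) {ρ : ℂ} (hρ : ρ ∈ Complex.slitPlane)
    (hS : ∀ j, IsBesselType T ν Q c₀ j (ρ ^ 2) (S j)) {A B A' B' : Matrix (Fin m) (Fin m) ℂ}
    (heq : ∀ x ∈ Set.Ioc 0 T, S 0 x * A + S 1 x * B = S 0 x * A' + S 1 x * B') :
    A = A' ∧ B = B' := by
  have hρ0 : ρ ≠ 0 := Complex.slitPlane_ne_zero hρ
  -- Equal combinations have equal Volterra integrals. Subtracting these reduces the claim to the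
  -- unperturbed solutions, where the Wronskian applies.
  have hC : ∀ x ∈ Set.Ioc 0 T, CMat ν c₀ 0 x (ρ ^ 2) * A + CMat ν c₀ 1 x (ρ ^ 2) * B
      = CMat ν c₀ 0 x (ρ ^ 2) * A' + CMat ν c₀ 1 x (ρ ^ 2) * B' := by
    intro x hx
    have h1 := heq x hx
    rw [h.comb_eq hS A B hx, h.comb_eq hS A' B' hx,
      kerInt_congr (g' := gFun ν c₀ (ρ ^ 2) x) (Z := fun t => S 0 t * A' + S 1 t * B') hx.1.le
        (fun _ _ _ => rfl) fun t ht => heq t ⟨ht.1, ht.2.trans hx.2⟩] at h1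
    exact add_right_cancel h1
  have key : ∀ p q, ρ ^ (-((mu 0 (ν p) : ℝ) : ℂ)) * (A p q - A' p q) = 0 ∧
      ρ ^ (-((mu 1 (ν p) : ℝ) : ℂ)) * (B p q - B' p q) = 0 := by
    intro p q
    refine eq_zero_of_besselC_dependent (c₀ := fun j => c₀ j p) (h.pos p) (h.nat p) (h.coeff p) hρ
      h.T_pos fun r hr => ?_
    have h1 := congrFun (congrFun (hC r ⟨hr.1, hr.2.le⟩) p) q
    simp only [CMat, Matrix.add_apply, Matrix.diagonal_mul, besselCLam_sq _ _ _ _ hr.1 _ hρ0] at h1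
    rw [mul_comm (r : ℂ) ρ]
    linear_combination h1
  have hne : ∀ j p, ρ ^ (-((mu j (ν p) : ℝ) : ℂ)) ≠ 0 := fun j p => by
    simp [Complex.cpow_eq_zero_iff, hρ0]
  constructor <;> ext p q
  · exact sub_eq_zero.1 ((mul_eq_zero.1 (key p q).1).resolve_left (hne 0 p))
  · exact sub_eq_zero.1 ((mul_eq_zero.1 (key p q).2).resolve_left (hne 1 p))

/-- The bound for solutions of a Volterra equation whose operator has norm at most `1 / 2`. -/
theorem norm_le_of_volterra {ρ : ℂ} (hρ : ρ ≠ 0)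
    (hop : ∀ (y : ℝ → Fin m → ℂ) (M : ℝ), 0 ≤ M →
      (∀ t ∈ Set.Ioc 0 T, ∀ r, ‖y t r‖ ≤ M * domWt (ν 0) ρ t) → ∀ x ∈ Set.Ioc 0 T, ∀ p,
        ‖∫ t in (0 : ℝ)..x, gFun ν c₀ (ρ ^ 2) x p t * ∑ r, Q t p r * y t r‖
          ≤ M / 2 * domWt (ν 0) ρ x)
    {F E : ℝ → Matrix (Fin m) (Fin m) ℂ} (hF : InBirkhoffClass T ν F) {A : ℝ} (hA : 0 ≤ A)
    (hE : ∀ x ∈ Set.Ioc 0 T, ∀ p q, ‖E x p q‖ ≤ A * domWt (ν 0) ρ x)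
    (heq : ∀ x ∈ Set.Ioc 0 T, F x = E x + kerInt Q (gFun ν c₀ (ρ ^ 2) x) F 0 x)
    {x : ℝ} (hx : x ∈ Set.Ioc 0 T) (p q : Fin m) : ‖F x p q‖ ≤ 2 * A * domWt (ν 0) ρ x := by
  refine le_of_halving (s := {z : ℝ × Fin m | z.1 ∈ Set.Ioc 0 T})
    (u := fun z => ‖F z.1 z.2 q‖) (W := fun z => domWt (ν 0) ρ z.1) hA
    (fun z hz => (domWt_pos _ hρ hz.1).le) ?_ ?_ (x, p) hx
  · obtain ⟨-, M, hM⟩ := hF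
    obtain ⟨K, hK, hKx⟩ := exists_rpow_le_domWt (ν 0) hρ T
    refine ⟨|M| * K, fun z hz => (hM z.1 hz z.2 q).trans ?_⟩
    calc _ ≤ |M| * z.1 ^ mu 0 (ν 0) :=
          mul_le_mul_of_nonneg_right (le_abs_self M) (Real.rpow_nonneg hz.1.le _)
      _ ≤ |M| * (K * domWt (ν 0) ρ z.1) := by gcongr; exact hKx _ hz
      _ = _ := by ring
  · intro M hM hb z hz
    have h1 := hop (fun t r => F t r q) M hM (fun t ht r => hb (t, r) ht) z.1 hz z.2
    have h2 : F z.1 z.2 q = E z.1 z.2 q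
        + ∫ t in (0 : ℝ)..z.1, gFun ν c₀ (ρ ^ 2) z.1 z.2 t * ∑ r, Q t z.2 r * F t r q := by
      conv_lhs => rw [heq z.1 hz]
      rfl
    rw [h2]
    refine (norm_add_le _ _).trans ?_
    rw [add_mul]
    exact add_le_add (hE _ hz _ _) h1

/-- The difference solves the homogeneous equation, so the a priori bound holds for it with A = 0.
-/
theorem Setting.eq_of_volterra (h : Setting T ν Q c₀ b) {ρ : ℂ} (hρ : ρ ≠ 0)
    (hop : ∀ (y : ℝ → Fin m → ℂ) (M : ℝ), 0 ≤ M →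
      (∀ t ∈ Set.Ioc 0 T, ∀ r, ‖y t r‖ ≤ M * domWt (ν 0) ρ t) → ∀ x ∈ Set.Ioc 0 T, ∀ p,
        ‖∫ t in (0 : ℝ)..x, gFun ν c₀ (ρ ^ 2) x p t * ∑ r, Q t p r * y t r‖
          ≤ M / 2 * domWt (ν 0) ρ x)
    {F G E : ℝ → Matrix (Fin m) (Fin m) ℂ} (hF : InBirkhoffClass T ν F)
    (hG : InBirkhoffClass T ν G)
    (hFeq : ∀ x ∈ Set.Ioc 0 T, F x = E x + kerInt Q (gFun ν c₀ (ρ ^ 2) x) F 0 x)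
    (hGeq : ∀ x ∈ Set.Ioc 0 T, G x = E x + kerInt Q (gFun ν c₀ (ρ ^ 2) x) G 0 x)
    {x : ℝ} (hx : x ∈ Set.Ioc 0 T) : F x = G x := by
  ext p q
  have key := norm_le_of_volterra hρ hop (hF.mul_add_mul hG 1 (-1)) le_rfl (E := fun _ => 0)
    (by simp) (fun x hx => ?_) hx p q
  · rw [mul_zero, zero_mul, norm_le_zero_iff] at key
    simpa [sub_eq_zero, ← sub_eq_add_neg] using key
  · rw [h.kerInt_mul_add_mul (h.gFun_inWeighted _ x) hF hG 1 (-1) hx.1.le hx.2]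
    conv_lhs => rw [hFeq x hx, hGeq x hx]
    noncomm_ring

/-- The Birkhoff-type solutions in terms of the Bessel-type solutions, for fixed `ρ`. -/
theorem Setting.birkhoff_eq (h : Setting T ν Q c₀ b) {s : Fin 2} {ρ : ℂ} (hρ : ρ ≠ 0)
    {C ε : ℝ} (hC : 0 ≤ C) (hε : 0 ≤ ε)
    (hE : ∀ k p, ∀ x ∈ Set.Ioc 0 T, ‖eFun ν c₀ b ρ k p x‖ ≤ C * domWt (ν 0) ρ x)
    (hop : ∀ (y : ℝ → Fin m → ℂ) (M : ℝ), 0 ≤ M →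
      (∀ t ∈ Set.Ioc 0 T, ∀ r, ‖y t r‖ ≤ M * domWt (ν 0) ρ t) → ∀ x ∈ Set.Ioc 0 T, ∀ p,
        ‖∫ t in (0 : ℝ)..x, gFun ν c₀ (ρ ^ 2) x p t * ∑ r, Q t p r * y t r‖
          ≤ M / 2 * domWt (ν 0) ρ x)
    (hfin : ∀ (y : ℝ → Fin m → ℂ) (M : ℝ), 0 ≤ M →
      (∀ t ∈ Set.Ioc 0 T, ∀ r, ‖y t r‖ ≤ M * domWt (ν 0) ρ t) → ∀ p,
        ‖(-1) ^ (s : ℕ) / (2 * Complex.I * ρ) *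
          ∫ t in (0 : ℝ)..T, eFun ν c₀ b ρ s p t * ∑ r, Q t p r * y t r‖ ≤ ε * M)
    (hm : m * (ε * (2 * C)) ≤ 1 / 2) (hS : ∀ j, IsBesselType T ν Q c₀ j (ρ ^ 2) (S j)) :
    (∃ Y, IsBirkhoffType T ν Q c₀ b s ρ Y) ∧
    ∀ Y, IsBirkhoffType T ν Q c₀ b s ρ Y →
      (∀ x ∈ Set.Ioc 0 T, Y (1 - s) x = besselComb ν b ρ S (1 - s) x) ∧
      ∃ A : Matrix (Fin m) (Fin m) ℂ, (∀ p q, ‖A p q‖ ≤ 2 * (ε * (2 * C))) ∧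
        ∀ x ∈ Set.Ioc 0 T, Y s x = besselComb ν b ρ S s x + besselComb ν b ρ S (1 - s) x * A := by
  set κ : ℂ := (-1) ^ (s : ℕ) / (2 * Complex.I * ρ) with hκ
  set U := besselComb ν b ρ S with hU
  have hUmem : ∀ k, InBirkhoffClass T ν (U k) := fun k =>
    (h.inBirkhoffClass (hS 0)).mul_add_mul (h.inBirkhoffClass (hS 1)) _ _
  have hUeq : ∀ k, ∀ x ∈ Set.Ioc 0 T,
      U k x = EMat ν c₀ b k x ρ + kerInt Q (gFun ν c₀ (ρ ^ 2) x) (U k) 0 x := fun k x hx => by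
    rw [EMat_eq_CMat ν c₀ b hρ k hx.1]
    exact h.comb_eq hS _ _ hx
  have hUle : ∀ k, ∀ x ∈ Set.Ioc 0 T, ∀ p q, ‖U k x p q‖ ≤ 2 * C * domWt (ν 0) ρ x := by
    refine fun k x hx p q => norm_le_of_volterra hρ hop (hUmem k) hC (fun x hx p q => ?_)
      (hUeq k) hx p q
    rw [EMat_eq, Matrix.diagonal_apply]
    split_ifs
    · exact hE k p x hx
    · rw [norm_zero]
      exact mul_nonneg hC (domWt_pos _ hρ hx.1).le
  have hUA : ∀ A, ∀ x ∈ Set.Ioc 0 T, U s x * 1 + U (1 - s) x * A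
      = (EMat ν c₀ b s x ρ + EMat ν c₀ b (1 - s) x ρ * A)
        + kerInt Q (gFun ν c₀ (ρ ^ 2) x) (fun t => U s t * 1 + U (1 - s) t * A) 0 x := by
    intro A x hx
    rw [h.kerInt_mul_add_mul (h.gFun_inWeighted _ x) (hUmem s) (hUmem (1 - s)) 1 A hx.1.le hx.2]
    conv_lhs => rw [hUeq s x hx, hUeq (1 - s) x hx]
    noncomm_ring
  have hUAmem := fun A => (hUmem s).mul_add_mul (hUmem (1 - s)) 1 A
  -- The finite-rank functional evaluated on U_k, the only data that enter the equation for A.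
  let N := fun k => κ • kerInt Q (eFun ν c₀ b ρ s) (U k) 0 T
  have hN : ∀ k p q, ‖N k p q‖ ≤ ε * (2 * C) := fun k p q =>
    hfin (fun t r => U k t r q) (2 * C) (by positivity) (fun t ht r => hUle k t ht r q) p
  have hNA : ∀ A, κ • kerInt Q (eFun ν c₀ b ρ s) (fun t => U s t * 1 + U (1 - s) t * A) 0 T
      = N s + N (1 - s) * A := fun A => by
    rw [h.kerInt_mul_add_mul (h.eFun_inWeighted hρ s) (hUmem s) (hUmem (1 - s)) 1 A
      h.T_pos.le le_rfl, mul_one, smul_add, Matrix.smul_mul]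
  refine ⟨?_, fun Y hY => ?_⟩
  -- Existence runs the reduction backwards: a solution A of the matrix equation makes U_s + U_{1-s}
  -- A a recessive solution.
  · obtain ⟨A, hA⟩ := exists_eq_add_mul (N s) hm (hN (1 - s))
    have hs1 : 1 - s ≠ s := by fin_cases s <;> simp
    refine ⟨fun k => if k = s then fun t => U s t * 1 + U (1 - s) t * A else U k,
      fun k => ?_, fun x hx => ?_, fun x hx => ?_⟩
    · by_cases hk : k = s
      · simpa only [hk, if_true] using hUAmem A
      · simpa only [hk, if_false] using hUmem k
    · simp only [if_true]
      rw [h.bounded_operator_eq hρ s (hUAmem A) hx, hNA A, ← hA, hUA A x hx]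
      abel
    · simp only [hs1, if_false]
      rw [matInt_EMat_sub, ← h.kerInt_gFun hρ _ hx]
      exact hUeq (1 - s) x hx
  · refine ⟨fun x hx => ?_, κ • kerInt Q (eFun ν c₀ b ρ s) (Y s) 0 T, ?_⟩
    · refine h.eq_of_volterra hρ hop (hY.mem _) (hUmem _) (fun x hx => ?_) (hUeq _) hx
      rw [h.kerInt_gFun hρ _ hx, ← matInt_EMat_sub]
      exact hY.eq_growing x hx
    · set A := κ • kerInt Q (eFun ν c₀ b ρ s) (Y s) 0 T with hAdef
      have hYU : ∀ x ∈ Set.Ioc 0 T, Y s x = U s x * 1 + U (1 - s) x * A := by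
        refine fun x hx => h.eq_of_volterra hρ hop (hY.mem s) (hUAmem A) (fun x hx => ?_)
          (hUA A) hx
        have h1 := hY.eq_bounded x hx
        rw [h.bounded_operator_eq hρ s (hY.mem s) hx] at h1
        conv_lhs => rw [h1]
        rw [hAdef]
        abel
      have hA : A = N s + N (1 - s) * A := by
        rw [← hNA A, hAdef]
        congr 1
        exact kerInt_congr h.T_pos.le (fun _ _ _ => rfl) hYU
      refine ⟨norm_le_of_eq_add_mul (by positivity) hm (hN s) (hN (1 - s)) hA, fun x hx => ?_⟩
      rw [hYU x hx, mul_one]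

/-- The asymptotics of the Stokes multipliers. -/
theorem Setting.exists_stokes (h : Setting T ν Q c₀ b)
    {S : Fin 2 → ℝ → ℂ → Matrix (Fin m) (Fin m) ℂ}
    (hS : ∀ j lam, IsBesselType T ν Q c₀ j lam (fun x => S j x lam)) :
    ∃ R C : ℝ, 0 < R ∧ ∀ (s : Fin 2) (ρ : ℂ), InSector s ρ → R ≤ ‖ρ‖ →
      (∃ Y : Fin 2 → ℝ → Matrix (Fin m) (Fin m) ℂ, IsBirkhoffType T ν Q c₀ b s ρ Y) ∧
      ∀ Y : Fin 2 → ℝ → Matrix (Fin m) (Fin m) ℂ, IsBirkhoffType T ν Q c₀ b s ρ Y →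
        (∃ B : Fin 2 → Fin 2 → Matrix (Fin m) (Fin m) ℂ,
          IsStokesMultiplier T (fun j x => S j x (ρ ^ 2)) Y B) ∧
        ∀ B : Fin 2 → Fin 2 → Matrix (Fin m) (Fin m) ℂ,
          IsStokesMultiplier T (fun j x => S j x (ρ ^ 2)) Y B →
          ∀ k j : Fin 2, ∃ P : Matrix (Fin m) (Fin m) ℂ,
            B k j = DMat ν j ρ * Matrix.diagonal (b k j) * (1 + P) ∧
            ∀ p q, ‖P p q‖ ≤ C * ‖ρ‖ ^ (-(min 1 (2 * ν 0))) := by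
  obtain ⟨C, Λ, hC, hΛ, hbd⟩ := h.exists_operator_bounds
  have hβ : 0 < min 1 (2 * ν 0) := lt_min one_pos (by linarith [h.pos 0])
  obtain ⟨R₁, hR₁, h₁⟩ := exists_rpow_neg_le hβ Λ (ε := 1 / 2) (by norm_num)
  obtain ⟨R₂, -, h₂⟩ := exists_rpow_neg_le hβ (m * (Λ * (2 * C))) (ε := 1 / 2) (by norm_num)
  -- Converts the coefficients of U_{1-s} A into those of U_s times a remainder; the diagonal
  -- matrices D_j commute with these ratios.
  let κ : Fin 2 → Fin 2 → Fin m → ℂ := fun s j p => b (1 - s) j p / b s j p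
  let K : ℝ := ∑ z : Fin 2 × Fin 2 × Fin m, ‖κ z.1 z.2.1 z.2.2‖
  have hK : ∀ s j p, ‖κ s j p‖ ≤ K := fun s j p =>
    Finset.single_le_sum (f := fun z : Fin 2 × Fin 2 × Fin m => ‖κ z.1 z.2.1 z.2.2‖)
      (fun _ _ => norm_nonneg _) (Finset.mem_univ (s, j, p))
  have hK0 : 0 ≤ K := Finset.sum_nonneg fun _ _ => norm_nonneg _
  -- Beyond R₁ the Volterra operator has norm at most 1/2; beyond R₂ the equation for A is solvable.
  -- The constant combines |κ| ≤ K with |A| ≤ 2 · 2C · Λ|ρ|^{-β}.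
  refine ⟨max R₁ R₂, K * (4 * C * Λ), lt_max_of_lt_left (by linarith), fun s ρ hs hρR => ?_⟩
  have hρ1 : 1 ≤ ‖ρ‖ := hR₁.trans ((le_max_left _ _).trans hρR)
  have hρ : ρ ≠ 0 := norm_pos_iff.1 (by linarith)
  obtain ⟨hE, hop⟩ := hbd s ρ hs hρ1
  have hε₁ := h₁ ‖ρ‖ ((le_max_left _ _).trans hρR)
  have hε₂ := h₂ ‖ρ‖ ((le_max_right _ _).trans hρR)
  set ε := Λ * ‖ρ‖ ^ (-(min 1 (2 * ν 0))) with hε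
  have hε0 : 0 ≤ ε := by positivity
  have hb0 : ∀ k j p, b k j p ≠ 0 := fun k j p =>
    (h.jost p).ne_zero (h.pos p) (h.nat p) (h.coeff p) k j
  obtain ⟨hex, hY⟩ := h.birkhoff_eq (s := s) (S := fun j x => S j x (ρ ^ 2)) hρ hC hε0 hE
    (fun y M hM hy x hx p => ((hop y M hM hy).1 x hx p).trans (by
      have := (domWt_pos (ν 0) hρ hx.1).le
      gcongr
      nlinarith))
    (fun y M hM hy => (hop y M hM hy).2) (by rw [hε]; linarith) (fun j => hS j (ρ ^ 2))
  refine ⟨hex, fun Y hYB => ?_⟩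
  obtain ⟨hY1, A, hA, hY2⟩ := hY Y hYB
  -- The growing solution has no remainder at all: its multipliers are exactly D_j B⁰.
  let P : Fin 2 → Fin 2 → Matrix (Fin m) (Fin m) ℂ := fun k j =>
    if k = s then Matrix.diagonal (κ s j) * A else 0
  have hP : ∀ k, ∀ x ∈ Set.Ioc 0 T, Y k x
      = S 0 x (ρ ^ 2) * (DMat ν 0 ρ * Matrix.diagonal (b k 0) * (1 + P k 0))
        + S 1 x (ρ ^ 2) * (DMat ν 1 ρ * Matrix.diagonal (b k 1) * (1 + P k 1)) := by
    intro k x hx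
    by_cases hk : k = s
    · subst hk
      have hmul : ∀ j, Matrix.diagonal (b k j) * (Matrix.diagonal (κ k j) * A)
          = Matrix.diagonal (b (1 - k) j) * A := fun j => by
        rw [← mul_assoc, Matrix.diagonal_mul_diagonal]
        congr 2
        funext p
        exact mul_div_cancel₀ _ (hb0 k j p)
      rw [hY2 x hx]
      simp only [P, if_true, mul_add, mul_one, mul_assoc, hmul, besselComb, add_mul]
      abel
    · have hk' : k = 1 - s := by
        revert hk; fin_cases k <;> fin_cases s <;> simp
      have := hY1 x hx
      rw [← hk'] at this
      simp only [this, P, hk, if_false, add_zero, mul_one, besselComb]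
  refine ⟨⟨fun k j => DMat ν j ρ * Matrix.diagonal (b k j) * (1 + P k j), hP⟩,
    fun B hB k j => ⟨P k j, ?_, fun p q => ?_⟩⟩
  · obtain ⟨e0, e1⟩ := h.comb_injective (S := fun j x => S j x (ρ ^ 2))
      (mem_slitPlane_of_re_nonneg hs.1 hρ) (fun j => hS j (ρ ^ 2))
      fun x hx => (hB k x hx).symm.trans (hP k x hx)
    fin_cases j
    · exact e0
    · exact e1
  · have hnn : 0 ≤ K * (4 * C * Λ) * ‖ρ‖ ^ (-(min 1 (2 * ν 0))) := by positivity
    by_cases hk : k = s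
    · simp only [P, hk, if_true, Matrix.diagonal_mul, norm_mul]
      calc _ ≤ K * (2 * (ε * (2 * C))) := mul_le_mul (hK s j p) (hA p q) (norm_nonneg _) hK0
        _ = _ := by rw [hε]; ring
    · simpa only [P, hk, if_false, Matrix.zero_apply, norm_zero] using hnn

end

end StokesSL
end

theorem theorem2 {m : ℕ} [NeZero m] (T : ℝ) (hT : 0 < T)
    (ν : Fin m → ℝ) (hν_anti : Antitone ν) (hν_pos : ∀ q, 0 < ν q)
    (hν_nat : ∀ q, ∀ n : ℕ, ν q ≠ n)
    (Q : ℝ → Matrix (Fin m) (Fin m) ℂ)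
    (hQ : ∀ p q, IntegrableOn (fun x : ℝ => ((x ^ (1 - 2 * ν 0) : ℝ) : ℂ) * Q x p q)
      (Set.Ioo 0 T))
    (c₀ : Fin 2 → Fin m → ℂ) (hc₀ : ∀ q, c₀ 0 q * c₀ 1 q = ((2 * ν q : ℝ) : ℂ)⁻¹) :
    (∃ b : Fin 2 → Fin 2 → Fin m → ℂ,
      ∀ q, IsJostConnection (ν q) (fun j => c₀ j q) (fun k j => b k j q)) ∧
    (∃ S : Fin 2 → ℝ → ℂ → Matrix (Fin m) (Fin m) ℂ,
      ∀ j lam, IsBesselType T ν Q c₀ j lam (fun x => S j x lam)) ∧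
    ∀ b : Fin 2 → Fin 2 → Fin m → ℂ,
      (∀ q, IsJostConnection (ν q) (fun j => c₀ j q) (fun k j => b k j q)) →
    ∀ S : Fin 2 → ℝ → ℂ → Matrix (Fin m) (Fin m) ℂ,
      (∀ j lam, IsBesselType T ν Q c₀ j lam (fun x => S j x lam)) →
    ∃ R C : ℝ, 0 < R ∧ ∀ (s : Fin 2) (ρ : ℂ), InSector s ρ → R ≤ ‖ρ‖ →
      (∃ Y : Fin 2 → ℝ → Matrix (Fin m) (Fin m) ℂ, IsBirkhoffType T ν Q c₀ b s ρ Y) ∧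
      ∀ Y : Fin 2 → ℝ → Matrix (Fin m) (Fin m) ℂ, IsBirkhoffType T ν Q c₀ b s ρ Y →
        (∃ B : Fin 2 → Fin 2 → Matrix (Fin m) (Fin m) ℂ,
          IsStokesMultiplier T (fun j x => S j x (ρ ^ 2)) Y B) ∧
        ∀ B : Fin 2 → Fin 2 → Matrix (Fin m) (Fin m) ℂ,
          IsStokesMultiplier T (fun j x => S j x (ρ ^ 2)) Y B →
          ∀ k j : Fin 2, ∃ P : Matrix (Fin m) (Fin m) ℂ,
            B k j = DMat ν j ρ * Matrix.diagonal (b k j) * (1 + P) ∧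
            ∀ p q, ‖P p q‖ ≤ C * ‖ρ‖ ^ (-(min 1 (2 * ν 0))) := by
  refine ⟨?_, ?_, fun b hb S hS =>
    Setting.exists_stokes ⟨hT, hν_anti, hν_pos, hν_nat, hQ, hc₀, hb⟩ hS⟩
  · choose b hb using fun q =>
      exists_isJostConnection (c₀ := fun j => c₀ j q) (hν_pos q) (hν_nat q) (hc₀ q)
    exact ⟨fun k j q => b q k j, hb⟩
  · choose S hS using fun j lam =>
      exists_isBesselType hT hν_anti hν_pos hν_nat hQ c₀ j lam
    exact ⟨fun j x lam => S j lam x, hS⟩
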